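/- Setting. Let $\mathcal H$ have orthonormal Fock basis $(|n\rangle)_{n\ge 0}$, let $a|n\rangle=\sqrt n\,|n-1\rangle$, $a^\dagger|n\rangle=\sqrt{n+1}\,|n+1\rangle$, $X_\phi=\tfrac12(a^\dagger e^{i\phi}+ae^{-i\phi})$, $D(z)=e^{za^\dagger-\bar z a}$; exponentials act on Fock states through their (norm convergent) power series. Let $|x\rangle_\phi$ be the generalized eigenvector of $X_\phi$ with components $\langle n|x\rangle_\phi=e^{in\phi}\,(2/\pi)^{1/4}(n!)^{-1/2}\,\mathrm{He}_n(2x)\,e^{-x^2}$ ($\mathrm{He}_n$ the probabilists' Hermite polynomial); then $X_\phi|x\rangle_\phi=x|x\rangle_\phi$ weakly on finite vectors, and $\int dx\,e^{ikx}|x\rangle_\phi{}_\phi\langle x|=e^{ikX_\phi}$ in matrix elements. The map $A\mapsto|A\rangle\rangle=\sum_{n,m}\langle n|A|m\rangle\,|n\rangle\otimes|m\rangle$ is a bijection of the Hilbert–Schmidt operators onto $\mathcal H\otimes\mathcal H=\ell^2(\mathbb N^2)$, with $\langle\langle A|B\rangle\rangle=\mathrm{Tr}[A^\dagger B]$. Write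 $\zeta=(\phi,x)\in[0,\pi)\times\mathbb R$, $d\mu(\zeta)=\frac{d\phi}{\pi}\,dx$, and $\Xi(\zeta)=|x\rangle_\phi{}_\phi\langle x|$. For a family $\Phi(\zeta)$ of generalized vectors with $\mu$-square-integrable components let $T_\Phi$ be the closure of $w\mapsto\langle\langle\Phi(\cdot)|w\rangle\rangle\in L^2(\mu)$, defined on vectors $w$ with finitely many nonzero components. Put $T=T_\Xi$ and $F=\int d\mu\,|\Xi\rangle\rangle\langle\langle\Xi|:=T^\dagger T$. Products of unbounded operators have their natural domains, and $|N|$ is the positive self-adjoint operator with $|N|^2=N^\dagger N$. Theorem. 1. (Frame.) $\Xi$ has square-integrable components, $T$ is well defined (the operator on finite vectors is closable), and the frame operator $F$ is positive, self-adjoint and injective with dense range. 2. (Frame operator.) Let $a-b^\dagger$ be the closure of $a\otimes1-1\otimes a^\dagger$ from the finite vectors. Then $|a-b^\dagger|$ is injective and $$F=\frac1{\pi|a-b^\dagger|},\qquad F^{-1}=\pi|a-b^\dagger|.$$ Moreover, on finite vectors, with absolutely convergent integrals, $F=\frac1\pi\int_{\mathbb C}\frac{d^2z}{\pi}\frac1{|z|}|D(z)\rangle\rangle\langle\langle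 D(z)|$ as a quadratic form, and $F^{-1}=\int_{\mathbb C}d^2z\,|z|\,|D(z)\rangle\rangle\langle\langle D(z)|$ in matrix elements (finite vectors lie in the domain of $F^{-1}$). 3. (Canonical dual.) The homodyne kernel $$\Psi(\phi,x)=\frac14\int_{-\infty}^{\infty}dk\,|k|\,e^{ik(X_\phi-x)},$$ absolutely convergent in matrix elements and with square-integrable components, is the canonical dual $F^{-1}|\Xi\rangle\rangle$: for every finite $w$, $F^{-1}w$ lies in the domain of $T$ and $(TF^{-1}w)(\zeta)=\langle\langle\Psi(\zeta)|w\rangle\rangle$ for a.e. $\zeta$. Moreover $T_\Psi$ is well defined and is the closure of $TF^{-1}$, and the identity is resolved: $\langle\langle A|B\rangle\rangle=\int d\mu\,\langle\langle A|\Psi\rangle\rangle\langle\langle\Xi|B\rangle\rangle$ for all $A\in\mathrm{dom}\,T_\Psi$, $B\in\mathrm{dom}\,T$ (that is, $\langle A,B\rangle=\langle T_\Psi A,TB\rangle$). 4. (Biorthogonality.) $\langle\langle\Xi(x',\phi')|F^{-1}|\Xi(x,\phi)\rangle\rangle=\pi\,\delta(x-x')\,\delta_\pi(\phi-\phi')$,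 which means: (i) for every compactly supported $C^\infty$ function $g$ on $\mathbb R^2$ the vector $G=\int d\mu(\zeta)\,g(\zeta)\,\Psi(\zeta)$ (with absolutely convergent components) belongs to the domain of $T$ and $TG=g$ a.e. on $[0,\pi)\times\mathbb R$; (ii) the operator $K=TF^{-1}T^\dagger$ on $L^2(\mu)$, whose kernel is $\langle\langle\Xi(\zeta)|F^{-1}|\Xi(\zeta')\rangle\rangle$, is densely defined and closable, and its closure is the identity of $L^2(\mu)$. 5. (Li's formula.) Let $f(\zeta)$ be any Bessel family of (possibly generalized) vectors, i.e. its components are measurable and for some $B$, $\int d\mu\,|\langle\langle f|w\rangle\rangle|^2\le B\|w\|^2$ for all finite $w$. Then a family $\Theta$ is given by Li's formula $$|\Theta(\zeta)\rangle\rangle=F^{-1}|\Xi(\zeta)\rangle\rangle+|f(\zeta)\rangle\rangle-\int d\mu(\zeta')\,\langle\langle\Xi(\zeta')|F^{-1}|\Xi(\zeta)\rangle\rangle\,|f(\zeta')\rangle\rangle$$ (paired with finite vectors, a.e. in $\zeta$, the integral being the closure of $K$ applied to $\langle\langle f(\cdot)|w\rangle\rangle$) if and only if $\Theta=\Psi$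 a.e. So Li's formula yields no new dual. -/

import Mathlib

open MeasureTheory
open scoped ContDiff

noncomputable section

/-! ### Unbounded operators -/

/-- The composition `g ∘ f` of unbounded operators, on its natural domain
`{x ∈ dom f | f x ∈ dom g}`. -/
def pcomp {E F G : Type*} [AddCommGroup E] [Module ℂ E] [AddCommGroup F] [Module ℂ F]
    [AddCommGroup G] [Module ℂ G] (g : F →ₗ.[ℂ] G) (f : E →ₗ.[ℂ] F) : E →ₗ.[ℂ] G :=
  g.comp (f.domRestrict ((g.domain.comap f.toFun).map f.domain.subtype)) (by
    rintro ⟨x, hx⟩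
    obtain ⟨y, hy, hyx⟩ := (Submodule.mem_inf.mp hx).1
    subst hyx
    exact hy)

/-- A positive self-adjoint (densely defined, possibly unbounded) operator. -/
def IsPosSelfAdjoint {E : Type*} [NormedAddCommGroup E] [InnerProductSpace ℂ E]
    [CompleteSpace E] (T : E →ₗ.[ℂ] E) : Prop :=
  IsSelfAdjoint T ∧ ∀ u : T.domain, 0 ≤ (inner ℂ (u : E) (T u)).re

/-- `P = |N|`: the positive self-adjoint operator with `P² = N† N` (equality of unbounded
operators, domains included). -/
def IsModulus {E : Type*} [NormedAddCommGroup E] [InnerProductSpace ℂ E]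
    [CompleteSpace E] (N P : E →ₗ.[ℂ] E) : Prop :=
  IsPosSelfAdjoint P ∧ pcomp P P = pcomp N.adjoint N

/-! ### The spaces and the finite vectors -/

/-- `ℓ²(ι)`.  With `ι = ℕ` it is the Hilbert space of one mode, with Fock basis `|n⟩`;
with `ι = ℕ × ℕ` it is the doubled space, with product basis `|n⟩ ⊗ |m⟩`. -/
abbrev Ell2 (ι : Type) : Type := lp (fun _ : ι => ℂ) 2

/-- The basis vectors. -/
def ket {ι : Type} [DecidableEq ι] (i : ι) : Ell2 ι := lp.single 2 i (1 : ℂ)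

/-- A finitely supported vector, regarded as an element of `ℓ²`. -/
def toEll2 {ι : Type} [DecidableEq ι] : (ι →₀ ℂ) →ₗ[ℂ] Ell2 ι :=
  Finsupp.linearCombination ℂ ket

theorem toEll2_apply {ι : Type} [DecidableEq ι] (w : ι →₀ ℂ) (i : ι) :
    (toEll2 w : Ell2 ι) i = w i := by
  induction w using Finsupp.induction_linear with
  | zero => simp
  | add f g hf hg => simp [map_add, hf, hg]
  | single j c =>
    simp only [toEll2, Finsupp.linearCombination_single, lp.coeFn_smul, Pi.smul_apply, ket,
      smul_eq_mul, lp.single_apply]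
    by_cases h : i = j
    · subst h; simp
    · simp [Pi.single_eq_of_ne h, Finsupp.single_eq_of_ne h]

theorem toEll2_injective {ι : Type} [DecidableEq ι] :
    Function.Injective (toEll2 : (ι →₀ ℂ) →ₗ[ℂ] Ell2 ι) := by
  intro v w h
  ext i
  rw [← toEll2_apply v i, ← toEll2_apply w i, h]

/-- A linear map on the finitely supported vectors, as a densely defined operator on `ℓ²`. -/
def coreOp {ι : Type} [DecidableEq ι] {F : Type*} [AddCommGroup F] [Module ℂ F]
    (L : (ι →₀ ℂ) →ₗ[ℂ] F) : Ell2 ι →ₗ.[ℂ] F where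
  domain := LinearMap.range (toEll2 : (ι →₀ ℂ) →ₗ[ℂ] Ell2 ι)
  toFun := L ∘ₗ (LinearEquiv.ofInjective toEll2 toEll2_injective).symm.toLinearMap

/-- The pairing `⟨v|w⟩` of a generalized vector `v` with a finitely supported vector `w`. -/
def pairing {ι : Type} (v : ι → ℂ) (w : ι →₀ ℂ) : ℂ :=
  w.sum fun i c => starRingEnd ℂ (v i) * c

/-! ### Hilbert–Schmidt operators and the doubled space -/

/-- The matrix `A_{nm} = ⟨n|A|m⟩` in the Fock basis. -/
def matrixOf (A : Ell2 ℕ →L[ℂ] Ell2 ℕ) : ℕ × ℕ → ℂ := fun p => (A (ket p.2)) p.1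

/-- Hilbert–Schmidt operators: `∑ |A_{nm}|² < ∞`. -/
abbrev HSOperator : Type := {A : Ell2 ℕ →L[ℂ] Ell2 ℕ // Memℓp (matrixOf A) 2}

/-- `|A⟩⟩ = ∑ A_{nm} |n⟩ ⊗ |m⟩`. -/
def dket (A : HSOperator) : Ell2 (ℕ × ℕ) := ⟨matrixOf A.1, A.2⟩

/-! ### One mode -/

/-- The annihilation operator `a` on finite Fock vectors: `a|n⟩ = √n |n-1⟩`. -/
def lowering : Module.End ℂ (ℕ →₀ ℂ) :=
  Finsupp.linearCombination ℂ fun n => Finsupp.single (n - 1) ((Real.sqrt n : ℝ) : ℂ)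

/-- The creation operator `a†` on finite Fock vectors: `a†|n⟩ = √(n+1) |n+1⟩`. -/
def raising : Module.End ℂ (ℕ →₀ ℂ) :=
  Finsupp.linearCombination ℂ fun n => Finsupp.single (n + 1) ((Real.sqrt (n + 1) : ℝ) : ℂ)

/-- The quadrature `X_φ = (a† e^{iφ} + a e^{-iφ}) / 2`. -/
def quadrature (φ : ℝ) : Module.End ℂ (ℕ →₀ ℂ) :=
  (1 / 2 : ℂ) • (Complex.exp (Complex.I * φ) • raising + Complex.exp (-(Complex.I * φ)) • lowering)

/-- The `j`-th term `G^j |m⟩ / j!` of the exponential series of `G` on the Fock state `|m⟩`. -/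
def expTerm (G : Module.End ℂ (ℕ →₀ ℂ)) (m j : ℕ) : Ell2 ℕ :=
  ((j.factorial : ℂ))⁻¹ • toEll2 ((G ^ j) (Finsupp.single m 1))

/-- The matrix element `⟨n| e^G |m⟩`, where `e^G |m⟩` is the sum of the exponential series. -/
def expEntry (G : Module.End ℂ (ℕ →₀ ℂ)) (n m : ℕ) : ℂ := (∑' j, expTerm G m j) n

/-- The doubled ket `|D(z)⟩⟩` of the displacement operator `D(z) = exp (z a† - z̄ a)`. -/
def displacementKet (z : ℂ) : ℕ × ℕ → ℂ := fun p =>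
  expEntry (z • raising - starRingEnd ℂ z • lowering) p.1 p.2

/-- `⟨n|x⟩₀`: the normalized eigenfunction
`(2/π)^{1/4} (n!)^{-1/2} He_n(2x) e^{-x²}`, where `He_n` is the probabilists' Hermite polynomial. -/
def fockWave (n : ℕ) (x : ℝ) : ℝ :=
  (2 / Real.pi) ^ (1 / 4 : ℝ) * (Real.sqrt (n.factorial : ℝ))⁻¹ *
    Polynomial.aeval (2 * x) (Polynomial.hermite n) * Real.exp (-x ^ 2)

/-- The generalized eigenvector `|x⟩_φ = e^{iφ a†a} |x⟩₀` of `X_φ`, by Fock components. -/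
def quadKet (φ x : ℝ) : ℕ → ℂ := fun n =>
  Complex.exp (Complex.I * (n * φ)) * (fockWave n x : ℂ)

/-- The generalized projector `|x⟩_φ ⟨x|`, as a generalized vector of the doubled space
(matrix elements in the Fock basis); the parameter is `ζ = (φ, x)`. -/
def quadProjector (ζ : ℝ × ℝ) : ℕ × ℕ → ℂ := fun p =>
  quadKet ζ.1 ζ.2 p.1 * starRingEnd ℂ (quadKet ζ.1 ζ.2 p.2)

/-- The homodyne kernel `(1/4) ∫ dk |k| e^{ik(X_φ - x)}`, by matrix elements; `ζ = (φ, x)`. -/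
def homodyneKernel (ζ : ℝ × ℝ) : ℕ × ℕ → ℂ := fun p =>
  (1 / 4 : ℂ) * ∫ k : ℝ,
    ((|k| : ℝ) : ℂ) * expEntry ((Complex.I * k) • (quadrature ζ.1 - (ζ.2 : ℂ) • 1)) p.1 p.2

/-! ### Two modes -/

/-- `L ⊗ 1` on finite vectors of the doubled space. -/
def onModeA (L : Module.End ℂ (ℕ →₀ ℂ)) : Module.End ℂ (ℕ × ℕ →₀ ℂ) :=
  Finsupp.linearCombination ℂ fun p =>
    (L (Finsupp.single p.1 1)).mapDomain fun n => (n, p.2)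

/-- `1 ⊗ L` on finite vectors of the doubled space. -/
def onModeB (L : Module.End ℂ (ℕ →₀ ℂ)) : Module.End ℂ (ℕ × ℕ →₀ ℂ) :=
  Finsupp.linearCombination ℂ fun p =>
    (L (Finsupp.single p.2 1)).mapDomain fun m => (p.1, m)

/-- `a - b†` on finite vectors of the doubled space, as an operator on the Hilbert space. -/
def modeDifferenceCore : Ell2 (ℕ × ℕ) →ₗ.[ℂ] Ell2 (ℕ × ℕ) :=
  coreOp (toEll2 ∘ₗ (onModeA lowering - onModeB raising))

/-- The closed operator `a - b†`. -/
def modeDifference : Ell2 (ℕ × ℕ) →ₗ.[ℂ] Ell2 (ℕ × ℕ) := modeDifferenceCore.closure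

/-! ### Continuous families of generalized vectors, frame operator, duals -/

/-- The measure `dφ/π dx` on `[0,π) × ℝ`. -/
def quorumMeasure : Measure (ℝ × ℝ) :=
  (ENNReal.ofReal Real.pi⁻¹ • volume.restrict (Set.Ico 0 Real.pi)).prod volume

/-- `L²([0,π) × ℝ, dφ/π dx)`. -/
abbrev QuorumL2 : Type := Lp ℂ 2 quorumMeasure

open Classical in
/-- For a family `Φ` with square-integrable components, the map sending a finite vector `w`
to the function `ζ ↦ ⟨Φ(ζ)|w⟩`. -/
def analysisMap (Φ : ℝ × ℝ → ℕ × ℕ → ℂ) : (ℕ × ℕ →₀ ℂ) →ₗ[ℂ] QuorumL2 :=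
  Finsupp.linearCombination ℂ fun p =>
    if h : MemLp (fun ζ => starRingEnd ℂ (Φ ζ p)) 2 quorumMeasure then h.toLp else 0

/-- The (closed) analysis operator of the family `Φ`. -/
def analysisOp (Φ : ℝ × ℝ → ℕ × ℕ → ℂ) : Ell2 (ℕ × ℕ) →ₗ.[ℂ] QuorumL2 :=
  (coreOp (analysisMap Φ)).closure

/-- The frame operator `∫ dφ/π ∫ dx |Φ⟩⟩⟨⟨Φ|`, i.e. `T† T` for the analysis operator `T`. -/
def frameOp (Φ : ℝ × ℝ → ℕ × ℕ → ℂ) : Ell2 (ℕ × ℕ) →ₗ.[ℂ] Ell2 (ℕ × ℕ) :=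
  pcomp (analysisOp Φ).adjoint (analysisOp Φ)

/-- The operator on `L²([0,π) × ℝ)` with integral kernel `⟨⟨Φ(ζ)|F⁻¹|Φ(ζ')⟩⟩`,
`F` the frame operator: `T F⁻¹ T†` on its natural domain. -/
def kernelOp (Φ : ℝ × ℝ → ℕ × ℕ → ℂ) : QuorumL2 →ₗ.[ℂ] QuorumL2 :=
  pcomp (analysisOp Φ) (pcomp (frameOp Φ).inverse (analysisOp Φ).adjoint)

/-- Bessel families (of possibly generalized vectors):
`∫ |⟨⟨f(ζ)|w⟩⟩|² ≤ B ‖w‖²` for all finite vectors `w`. -/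
def IsBesselFamily (f : ℝ × ℝ → ℕ × ℕ → ℂ) : Prop :=
  (∀ p, AEStronglyMeasurable (fun ζ => f ζ p) quorumMeasure) ∧
    ∃ B : NNReal, ∀ w : ℕ × ℕ →₀ ℂ,
      ∫⁻ ζ, ‖pairing (f ζ) w‖ₑ ^ 2 ∂quorumMeasure ≤ B * ‖(toEll2 w : Ell2 (ℕ × ℕ))‖ₑ ^ 2

/-- `Θ` is given by Li's formula from the frame `Φ`, its canonical dual `Ψ` and the family `f`:
`|Θ(ζ)⟩⟩ = |Ψ(ζ)⟩⟩ + |f(ζ)⟩⟩ - ∫ dζ' ⟨⟨Φ(ζ')|F⁻¹|Φ(ζ)⟩⟩ |f(ζ')⟩⟩`,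
read through the pairings with finite vectors `w`, so that the last term is the
(closed) kernel operator applied to `ζ' ↦ ⟨⟨f(ζ')|w⟩⟩`. -/
def IsLiDual (Φ Ψ f Θ : ℝ × ℝ → ℕ × ℕ → ℂ) : Prop :=
  ∀ w : ℕ × ℕ →₀ ℂ, ∃ g : (kernelOp Φ).closure.domain,
    (((g : QuorumL2) : ℝ × ℝ → ℂ) =ᵐ[quorumMeasure] fun ζ => pairing (f ζ) w) ∧
    ∀ᵐ ζ ∂quorumMeasure, pairing (Θ ζ) w =
      pairing (Ψ ζ) w + pairing (f ζ) w - ((kernelOp Φ).closure g : ℝ × ℝ → ℂ) ζ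

end

/-!
Write `ŵ(z) = ⟨⟨D(z)|w⟩⟩` for the Weyl symbol of a finite vector `w` of the doubled space.  The
commutators of `a` and `a†` with the displacement operators say that `w ↦ ŵ` turns `a - b†` into
multiplication by `z` and `a† - b` into multiplication by `z̄` (`weylSymbol_modeDiff`,
`weylSymbol_modeDiffAdj`), and the symbol of the vacuum is the Gaussian `e^(-|z|²/2)`.  Hence the
Weyl transform is isometric into `L²(d²z/π)` (`integral_weylSymbol_mul`): both inner products make
`a - b†` and `a† - b` mutually adjoint commuting operators with the vacuum as cyclic vector, and
their moments in the vacuum agree.  The symbols are the polynomials in `z`, `z̄` times a Gaussian;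
they are total, also in weighted spaces, because the moment problem for densities with Gaussian
decay is determinate (`ae_eq_zero_of_integral_weylSymbol`).  So the Weyl transform extends to a
unitary (`weylUnitary`), and an operator which on finite vectors multiplies symbols by a function
of polynomial growth has the maximal multiplication operator as its closure
(`closure_coreOp_eq_mulOp`).

On the line `z = iπκ e^(iφ)` the displacement operator is `e^(2πiκX_φ)`
(`displacementKet_slicePoint`), and the oscillator functions diagonalize `X_φ`.  The Fourier
transform in `x` of `⟨⟨Ξ(φ,x)|w⟩⟩` is therefore the restriction of `ŵ` to that line, and the one of
`⟨⟨Ψ(φ,x)|w⟩⟩` is the restriction of `π|z| ŵ(z)`.  The lines with `φ ∈ [0,π)` sweep the plane with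
`dφ/π dκ = d²z/(π²|z|)` (`map_slicePoint`).  Between the Weyl representation and the partial
Fourier transform, all operators of the frame are thus multiplication operators:

* `T` is multiplication by `(π|z|)^(-1/2)` and `T_Ψ` by `(π|z|)^(1/2)`
  (`analysisOp_quadProjector_eq`, `analysisOp_homodyneKernel_eq`);
* `F = T† T` is multiplication by `1/(π|z|)`, and `a - b†` by `z`, so that `F⁻¹ = π|a - b†|`;
* `T F⁻¹ ⊆ T_Ψ` with the same closure, and `T F⁻¹ T†` is a densely defined restriction of the
  identity (`mem_graph_kernelOp_imp`, `dense_domain_kernelOp`).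

The frame operator, its inverse, the canonical dual and the resolution of the identity are read off
from these symbols.  A test function `g` lies in the range of `T` because `T` intertwines `a - b†`
with `½ e^(iφ) ∂ₓ`: one derivative of `g` shows that `z̄` times its transform is square-integrable,
hence so is `(π|z|)^(1/2)` times its transform (`exists_preimage_test`).  Since the closure of the
kernel operator is the identity, the last two terms of Li's formula cancel for every Bessel family
(`isLiDual_iff`).
-/

/-! ### Graphs and closures of unbounded operators -/

theorem mem_graph_pcomp {E F G : Type*} [AddCommGroup E] [Module ℂ E] [AddCommGroup F] [Module ℂ F]
    [AddCommGroup G] [Module ℂ G] (g : F →ₗ.[ℂ] G) (f : E →ₗ.[ℂ] F) (x : E) (z : G) :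
    (x, z) ∈ (pcomp g f).graph ↔ ∃ y, (x, y) ∈ f.graph ∧ (y, z) ∈ g.graph := by
  simp only [LinearPMap.mem_graph_iff]
  constructor
  · rintro ⟨⟨u, hu⟩, h1, h2⟩
    obtain ⟨y, hy, hyx⟩ := (Submodule.mem_inf.mp hu).1
    refine ⟨f y, ⟨y, hyx.trans h1, rfl⟩, ⟨f y, hy⟩, rfl, ?_⟩
    rw [← h2]
    subst hyx
    rfl
  · rintro ⟨y, ⟨u, hu, huy⟩, ⟨v, hv, hvz⟩⟩
    have hfu : f u ∈ g.domain := by rw [huy, ← hv]; exact v.2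
    refine ⟨⟨u, Submodule.mem_inf.mpr ⟨⟨u, hfu, rfl⟩, u.2⟩⟩, hu, ?_⟩
    rw [← hvz]
    change g ⟨f u, _⟩ = g v
    congr 1
    ext
    exact huy.trans hv.symm

theorem mem_graph_inverse {E F : Type*} [AddCommGroup E] [Module ℂ E] [AddCommGroup F] [Module ℂ F]
    {f : E →ₗ.[ℂ] F} (hf : LinearMap.ker f.toFun = ⊥) (x : E) (y : F) :
    (y, x) ∈ f.inverse.graph ↔ (x, y) ∈ f.graph := by
  rw [LinearPMap.inverse_graph hf, Submodule.mem_map]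
  constructor
  · rintro ⟨⟨a, b⟩, hab, h⟩
    simp only [LinearEquiv.coe_coe, LinearEquiv.prodComm_apply, Prod.swap_prod_mk, Prod.mk.injEq] at h
    obtain ⟨rfl, rfl⟩ := h
    exact hab
  · intro h
    exact ⟨(x, y), h, rfl⟩

/-- An operator between a closable operator and its closure is closable, with the same closure. -/
theorem LinearPMap.isClosable_closure_eq_of_le {E F : Type*} [AddCommGroup E] [Module ℂ E]
    [TopologicalSpace E] [ContinuousAdd E] [ContinuousSMul ℂ E] [AddCommGroup F] [Module ℂ F]
    [TopologicalSpace F] [ContinuousAdd F] [ContinuousSMul ℂ F]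
    {f g : E →ₗ.[ℂ] F} (hf : f.IsClosable) (hfg : f ≤ g) (hgf : g ≤ f.closure) :
    g.IsClosable ∧ g.closure = f.closure := by
  have hg : g.IsClosable := hf.closureIsClosable.leIsClosable hgf
  refine ⟨hg, le_antisymm ?_ (hg.closure_mono hfg)⟩
  rw [← LinearPMap.le_graph_iff, ← hg.graph_closure_eq_closure_graph]
  refine Submodule.topologicalClosure_minimal _ (LinearPMap.le_graph_of_le hgf) ?_
  exact hf.closure_isClosed

/-! ### Multiplication operators -/

section MulOp

variable {X : Type*} [MeasurableSpace X] {μ : Measure X}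
  {E F G : Type*} [NormedAddCommGroup E] [InnerProductSpace ℂ E]
  [NormedAddCommGroup F] [InnerProductSpace ℂ F] [NormedAddCommGroup G] [InnerProductSpace ℂ G]

/-- The graph of multiplication by `m` on `L²(μ)`, on its maximal domain, transported along two
unitaries `A` and `B` onto `L²(μ)`. -/
def mulGraph (A : E ≃ₗᵢ[ℂ] Lp ℂ 2 μ) (B : F ≃ₗᵢ[ℂ] Lp ℂ 2 μ) (m : X → ℂ) :
    Submodule ℂ (E × F) where
  carrier := {p | (B p.2 : X → ℂ) =ᵐ[μ] fun x => m x * (A p.1 : X → ℂ) x}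
  zero_mem' := by
    simp only [Set.mem_ofPred_eq, Prod.fst_zero, Prod.snd_zero, map_zero]
    filter_upwards [Lp.coeFn_zero ℂ 2 μ] with x hx
    rw [hx, Pi.zero_apply, mul_zero]
  add_mem' := by
    rintro ⟨a, b⟩ ⟨c, d⟩ h1 h2
    simp only [Set.mem_ofPred_eq, Prod.mk_add_mk, map_add] at *
    filter_upwards [h1, h2, Lp.coeFn_add (A a) (A c), Lp.coeFn_add (B b) (B d)] with x h1 h2 h3 h4
    rw [h3, h4, Pi.add_apply, Pi.add_apply, h1, h2, mul_add]
  smul_mem' := by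
    rintro c ⟨a, b⟩ h1
    simp only [Set.mem_ofPred_eq, Prod.smul_mk, map_smul] at *
    filter_upwards [h1, Lp.coeFn_smul c (A a), Lp.coeFn_smul c (B b)] with x h1 h3 h4
    simp only [h3, h4, Pi.smul_apply, h1, smul_eq_mul]
    ring

/-- Multiplication by `m` on `L²(μ)`, on its maximal domain, read through the unitaries `A`
and `B` as an operator from `E` to `F`. -/
noncomputable def mulOp (A : E ≃ₗᵢ[ℂ] Lp ℂ 2 μ) (B : F ≃ₗᵢ[ℂ] Lp ℂ 2 μ) (m : X → ℂ) :
    E →ₗ.[ℂ] F :=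
  (mulGraph A B m).toLinearPMap

theorem mem_graph_mulOp (A : E ≃ₗᵢ[ℂ] Lp ℂ 2 μ) (B : F ≃ₗᵢ[ℂ] Lp ℂ 2 μ) (m : X → ℂ)
    (e : E) (f : F) :
    (e, f) ∈ (mulOp A B m).graph ↔ (B f : X → ℂ) =ᵐ[μ] fun x => m x * (A e : X → ℂ) x := by
  rw [mulOp, Submodule.toLinearPMap_graph_eq]
  · rfl
  · rintro ⟨a, b⟩ h h0
    simp only at h0
    subst h0
    have h1 : (B b : X → ℂ) =ᵐ[μ] fun x => m x * (A 0 : X → ℂ) x := h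
    rw [map_zero] at h1
    have : B b = 0 := by
      rw [Lp.eq_zero_iff_ae_eq_zero]
      filter_upwards [h1, Lp.coeFn_zero ℂ 2 μ] with x hx hx'
      rw [hx, hx', Pi.zero_apply, mul_zero]
    simpa using this

theorem mulOp_congr (A : E ≃ₗᵢ[ℂ] Lp ℂ 2 μ) (B : F ≃ₗᵢ[ℂ] Lp ℂ 2 μ) {m m' : X → ℂ}
    (h : m =ᵐ[μ] m') : mulOp A B m = mulOp A B m' := by
  apply LinearPMap.eq_of_eq_graph
  ext ⟨e, f⟩
  rw [mem_graph_mulOp, mem_graph_mulOp]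
  constructor <;> intro h1 <;> filter_upwards [h, h1] with x hx hx1 <;> simp [hx1, hx]

theorem mem_domain_mulOp_of_memLp {A : E ≃ₗᵢ[ℂ] Lp ℂ 2 μ} (B : F ≃ₗᵢ[ℂ] Lp ℂ 2 μ) {m : X → ℂ}
    {e : E} (h : MemLp (fun x => m x * (A e : X → ℂ) x) 2 μ) :
    (e, B.symm (h.toLp _)) ∈ (mulOp A B m).graph := by
  rw [mem_graph_mulOp, LinearIsometryEquiv.apply_symm_apply]
  exact h.coeFn_toLp

theorem mulOp_apply_ae (A : E ≃ₗᵢ[ℂ] Lp ℂ 2 μ) (B : F ≃ₗᵢ[ℂ] Lp ℂ 2 μ) (m : X → ℂ)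
    (e : (mulOp A B m).domain) :
    (B (mulOp A B m e) : X → ℂ) =ᵐ[μ] fun x => m x * (A (e : E) : X → ℂ) x :=
  (mem_graph_mulOp A B m e _).1 (LinearPMap.mem_graph _ e)

/-- A submodule of `L²` is dense if it contains all `L²` functions carried by the sublevel sets
`{‖M‖ ≤ n}` of some measurable `M`. -/
theorem dense_of_truncations {M : X → ℂ} (hM : Measurable M) (S : Submodule ℂ (Lp ℂ 2 μ))
    (hS : ∀ v : Lp ℂ 2 μ, ∀ n : ℕ, (∀ᵐ x ∂μ, (n : ℝ) < ‖M x‖ → (v : X → ℂ) x = 0) → v ∈ S) :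
    Dense (S : Set (Lp ℂ 2 μ)) := by
  rw [Submodule.dense_iff_topologicalClosure_eq_top, Submodule.topologicalClosure_eq_top_iff,
    Submodule.eq_bot_iff]
  intro v hv
  rw [Submodule.mem_orthogonal] at hv
  have key : ∀ n : ℕ, ∀ᵐ x ∂μ, ‖M x‖ ≤ n → (v : X → ℂ) x = 0 := by
    intro n
    have hs : MeasurableSet {x | ‖M x‖ ≤ n} := measurableSet_le hM.norm measurable_const
    have hmem : MemLp ({x | ‖M x‖ ≤ (n : ℝ)}.indicator (v : X → ℂ)) 2 μ := (Lp.memLp v).indicator hs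
    have h0 := hv (hmem.toLp _) (hS _ n (by
      filter_upwards [hmem.coeFn_toLp] with x hx h
      rw [hx, Set.indicator_of_notMem]
      simpa using h))
    have h1 : inner ℂ (hmem.toLp _) (hmem.toLp _) = (0 : ℂ) := by
      rw [← h0, L2.inner_def, L2.inner_def]
      apply integral_congr_ae
      filter_upwards [hmem.coeFn_toLp] with x hx
      rw [hx]
      by_cases h : x ∈ {x | ‖M x‖ ≤ (n : ℝ)}
      · simp [Set.indicator_of_mem h]
      · simp [Set.indicator_of_notMem h]
    rw [inner_self_eq_zero, Lp.eq_zero_iff_ae_eq_zero] at h1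
    filter_upwards [h1, hmem.coeFn_toLp] with x h1 h2 h3
    rw [h2, Set.indicator_of_mem (by exact h3)] at h1
    exact h1
  rw [Lp.eq_zero_iff_ae_eq_zero]
  filter_upwards [ae_all_iff.2 key] with x hx
  obtain ⟨n, hn⟩ := exists_nat_ge ‖M x‖
  exact hx n hn

theorem memLp_mul_of_truncation {m : X → ℂ} (hm : Measurable m) (v : Lp ℂ 2 μ) {C : ℝ}
    (hv : ∀ᵐ x ∂μ, C < ‖m x‖ → (v : X → ℂ) x = 0) :
    MemLp (fun x => m x * (v : X → ℂ) x) 2 μ := by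
  refine MemLp.of_le_mul (c := C) (Lp.memLp v)
    (hm.aestronglyMeasurable.mul (Lp.aestronglyMeasurable v)) ?_
  filter_upwards [hv] with x hx
  rw [norm_mul]
  by_cases h : C < ‖m x‖
  · simp [hx h]
  · exact mul_le_mul_of_nonneg_right (not_lt.1 h) (norm_nonneg _)

theorem dense_preimage_isometryEquiv (A : E ≃ₗᵢ[ℂ] Lp ℂ 2 μ) {S : Set E} {S' : Set (Lp ℂ 2 μ)}
    (hS' : Dense S') (h : ∀ v ∈ S', A.symm v ∈ S) : Dense S := by
  have := A.symm.surjective.denseRange.dense_image A.symm.continuous hS'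
  refine this.mono ?_
  rintro _ ⟨v, hv, rfl⟩
  exact h v hv

theorem dense_domain_mulOp (A : E ≃ₗᵢ[ℂ] Lp ℂ 2 μ) (B : F ≃ₗᵢ[ℂ] Lp ℂ 2 μ) {m : X → ℂ}
    (hm : Measurable m) : Dense ((mulOp A B m).domain : Set E) := by
  have h := dense_of_truncations (μ := μ) hm
    ((mulOp A B m).domain.map (A.toLinearEquiv : E →ₗ[ℂ] Lp ℂ 2 μ)) (by
      intro v n hv
      refine ⟨A.symm v, ?_, by simp⟩
      exact LinearPMap.mem_domain_of_mem_graph (mem_domain_mulOp_of_memLp B (by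
        simpa using memLp_mul_of_truncation hm v hv)))
  refine dense_preimage_isometryEquiv A h ?_
  rintro _ ⟨e, he, rfl⟩
  simpa using he

/-- The adjoint of multiplication by `m` is multiplication by `m̄`.  The maximal domain is dense, so
the adjoint is the genuine one. -/
theorem mulOp_adjoint [CompleteSpace E] (A : E ≃ₗᵢ[ℂ] Lp ℂ 2 μ) (B : F ≃ₗᵢ[ℂ] Lp ℂ 2 μ)
    {m : X → ℂ} (hm : Measurable m) :
    (mulOp A B m).adjoint = mulOp B A (fun x => starRingEnd ℂ (m x)) := by
  have hd := dense_domain_mulOp A B hm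
  apply LinearPMap.eq_of_eq_graph
  rw [LinearPMap.adjoint_graph_eq_graph_adjoint hd]
  ext ⟨f, e⟩
  rw [Submodule.mem_adjoint_iff, mem_graph_mulOp]
  simp only
  constructor
  · intro h
    -- test against the function `conj (m) * B f - A e`, truncated to `‖m‖ ≤ n`
    have key : ∀ n : ℕ, ∀ᵐ x ∂μ, ‖m x‖ ≤ n →
        (A e : X → ℂ) x = starRingEnd ℂ (m x) * (B f : X → ℂ) x := by
      intro n
      set s : Set X := {x | ‖m x‖ ≤ n} with hs_def
      have hs : MeasurableSet s := measurableSet_le hm.norm measurable_const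
      have hconj : Measurable fun x => starRingEnd ℂ (m x) := Complex.continuous_conj.measurable.comp hm
      have h1 : MemLp (s.indicator fun x => starRingEnd ℂ (m x) * (B f : X → ℂ) x) 2 μ := by
        refine MemLp.of_le_mul (c := (n : ℝ)) (Lp.memLp (B f))
          ((hconj.aestronglyMeasurable.mul (Lp.aestronglyMeasurable (B f))).indicator hs) ?_
        filter_upwards with x
        by_cases hx : x ∈ s
        · rw [Set.indicator_of_mem hx, norm_mul, RCLike.norm_conj]
          exact mul_le_mul_of_nonneg_right hx (norm_nonneg _)
        · rw [Set.indicator_of_notMem hx]; simp; positivity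
      have h2 : MemLp (s.indicator (A e : X → ℂ)) 2 μ := (Lp.memLp (A e)).indicator hs
      set v : Lp ℂ 2 μ := h1.toLp _ - h2.toLp _ with hv
      have hvx : ∀ᵐ x ∂μ, (v : X → ℂ) x =
          s.indicator (fun x => starRingEnd ℂ (m x) * (B f : X → ℂ) x - (A e : X → ℂ) x) x := by
        filter_upwards [Lp.coeFn_sub (h1.toLp _) (h2.toLp _), h1.coeFn_toLp, h2.coeFn_toLp]
          with x a b c
        rw [hv, a, Pi.sub_apply, b, c]
        by_cases hx : x ∈ s <;> simp [hx]
      have hmv : MemLp (fun x => m x * (v : X → ℂ) x) 2 μ := by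
        refine memLp_mul_of_truncation hm v (C := n) ?_
        filter_upwards [hvx] with x hx h
        rw [hx, Set.indicator_of_notMem]
        simpa [hs_def] using h
      have hmv' : MemLp (fun x => m x * (A (A.symm v) : X → ℂ) x) 2 μ := by simpa using hmv
      have h3 := h _ _ (mem_domain_mulOp_of_memLp B hmv')
      have h4 : inner ℂ v v = (0 : ℂ) := by
        rw [sub_eq_zero, ← B.inner_map_map, ← A.inner_map_map] at h3
        simp only [LinearIsometryEquiv.apply_symm_apply] at h3
        rw [L2.inner_def, L2.inner_def] at h3
        have i1 := L2.integrable_inner (𝕜 := ℂ) (hmv.toLp _) (B f)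
        have i2 := L2.integrable_inner (𝕜 := ℂ) v (A e)
        rw [← sub_eq_zero, ← integral_sub i1 i2] at h3
        rw [L2.inner_def, ← h3]
        apply integral_congr_ae
        filter_upwards [hvx, hmv.coeFn_toLp] with x a b
        rw [b]
        simp only [a]
        by_cases hx : x ∈ s
        · simp only [Set.indicator_of_mem hx, RCLike.inner_apply, map_mul, map_sub]
          ring
        · simp [Set.indicator_of_notMem hx]
      rw [inner_self_eq_zero, Lp.eq_zero_iff_ae_eq_zero] at h4
      filter_upwards [h4, hvx] with x a b c
      rw [b, Set.indicator_of_mem (by exact c)] at a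
      exact (sub_eq_zero.1 a).symm
    filter_upwards [ae_all_iff.2 key] with x hx
    obtain ⟨n, hn⟩ := exists_nat_ge ‖m x‖
    exact hx n hn
  · intro h a b hab
    rw [mem_graph_mulOp] at hab
    rw [sub_eq_zero, ← B.inner_map_map, ← A.inner_map_map, L2.inner_def, L2.inner_def]
    apply integral_congr_ae
    filter_upwards [h, hab] with x h1 h2
    simp only [RCLike.inner_apply, h1, h2, map_mul]
    ring

theorem mulOp_ker (A : E ≃ₗᵢ[ℂ] Lp ℂ 2 μ) (B : F ≃ₗᵢ[ℂ] Lp ℂ 2 μ) {m : X → ℂ}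
    (hm : ∀ᵐ x ∂μ, m x ≠ 0) : LinearMap.ker (mulOp A B m).toFun = ⊥ := by
  rw [LinearMap.ker_eq_bot']
  intro e he
  have h1 := mulOp_apply_ae A B m e
  have h2 : mulOp A B m e = 0 := he
  rw [h2, map_zero] at h1
  have : A (e : E) = 0 := by
    rw [Lp.eq_zero_iff_ae_eq_zero]
    filter_upwards [h1, hm, Lp.coeFn_zero ℂ 2 μ] with x a b c
    rw [c] at a
    exact (mul_eq_zero.1 a.symm).resolve_left b
  simpa using this

theorem mulOp_inverse (A : E ≃ₗᵢ[ℂ] Lp ℂ 2 μ) (B : F ≃ₗᵢ[ℂ] Lp ℂ 2 μ) {m : X → ℂ}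
    (hm : ∀ᵐ x ∂μ, m x ≠ 0) : (mulOp A B m).inverse = mulOp B A (fun x => (m x)⁻¹) := by
  apply LinearPMap.eq_of_eq_graph
  ext ⟨f, e⟩
  rw [mem_graph_inverse (mulOp_ker A B hm), mem_graph_mulOp, mem_graph_mulOp]
  constructor <;> intro h <;> filter_upwards [h, hm] with x h1 h2 <;> rw [h1] <;> field_simp

/-- A product of multiplication operators has the natural domain of the product symbol, provided
the symbol of the first factor is controlled by the symbol of the product. -/
theorem pcomp_mulOp (A : E ≃ₗᵢ[ℂ] Lp ℂ 2 μ) (B : F ≃ₗᵢ[ℂ] Lp ℂ 2 μ) (D : G ≃ₗᵢ[ℂ] Lp ℂ 2 μ)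
    {m m' : X → ℂ} (hm : Measurable m) (hmm' : ∀ᵐ x ∂μ, ‖m x‖ ≤ 1 + ‖m' x * m x‖) :
    pcomp (mulOp B D m') (mulOp A B m) = mulOp A D (fun x => m' x * m x) := by
  apply LinearPMap.eq_of_eq_graph
  ext ⟨e, g⟩
  rw [mem_graph_pcomp, mem_graph_mulOp]
  constructor
  · rintro ⟨f, h1, h2⟩
    rw [mem_graph_mulOp] at h1 h2
    filter_upwards [h1, h2] with x a b
    rw [b, a]; ring
  · intro h
    have hmem : MemLp (fun x => m x * (A e : X → ℂ) x) 2 μ := by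
      refine MemLp.of_le (g := fun x => ‖(A e : X → ℂ) x‖ + ‖(D g : X → ℂ) x‖)
        ((Lp.memLp (A e)).norm.add (Lp.memLp (D g)).norm)
        (hm.aestronglyMeasurable.mul (Lp.aestronglyMeasurable (A e))) ?_
      filter_upwards [h, hmm'] with x a b
      rw [a, norm_mul, norm_mul, Real.norm_of_nonneg (by positivity)]
      calc ‖m x‖ * ‖(A e : X → ℂ) x‖ ≤ (1 + ‖m' x * m x‖) * ‖(A e : X → ℂ) x‖ := by gcongr
        _ = _ := by ring
    refine ⟨_, mem_domain_mulOp_of_memLp B hmem, ?_⟩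
    rw [mem_graph_mulOp, LinearIsometryEquiv.apply_symm_apply]
    filter_upwards [h, hmem.coeFn_toLp] with x a b
    rw [a, b]; ring

theorem smul_mulOp (A : E ≃ₗᵢ[ℂ] Lp ℂ 2 μ) (B : F ≃ₗᵢ[ℂ] Lp ℂ 2 μ) {m : X → ℂ} {c : ℂ}
    (hc : c ≠ 0) : c • mulOp A B m = mulOp A B (fun x => c * m x) := by
  apply LinearPMap.eq_of_eq_graph
  ext ⟨e, f⟩
  rw [mem_graph_mulOp, LinearPMap.mem_graph_iff]
  constructor
  · rintro ⟨y, h1, h2⟩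
    simp only at h1 h2
    have h3 := mulOp_apply_ae A B m y
    rw [← h2, ← h1, LinearPMap.smul_apply, map_smul]
    filter_upwards [h3, Lp.coeFn_smul c (B (mulOp A B m y))] with x a b
    rw [b, Pi.smul_apply, a, smul_eq_mul, mul_assoc]
  · intro h
    have : (e, c⁻¹ • f) ∈ (mulOp A B m).graph := by
      rw [mem_graph_mulOp, map_smul]
      filter_upwards [h, Lp.coeFn_smul c⁻¹ (B f)] with x a b
      rw [b, Pi.smul_apply, a, smul_eq_mul]
      field_simp
    rw [LinearPMap.mem_graph_iff] at this
    obtain ⟨y, h1, h2⟩ := this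
    refine ⟨y, h1, ?_⟩
    simp only at h2
    rw [LinearPMap.smul_apply, h2, smul_smul, mul_inv_cancel₀ hc, one_smul]

theorem mulOp_isClosed [CompleteSpace F] (A : E ≃ₗᵢ[ℂ] Lp ℂ 2 μ) (B : F ≃ₗᵢ[ℂ] Lp ℂ 2 μ)
    {m : X → ℂ} (hm : Measurable m) : (mulOp A B m).IsClosed := by
  have hc : Measurable fun x => starRingEnd ℂ (m x) := Complex.continuous_conj.measurable.comp hm
  have h : mulOp A B m = (mulOp B A fun x => starRingEnd ℂ (m x)).adjoint := by
    rw [mulOp_adjoint B A hc]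
    simp
  rw [h]
  exact LinearPMap.adjoint_isClosed (dense_domain_mulOp B A hc)

theorem mulOp_isPosSelfAdjoint [CompleteSpace E] (A : E ≃ₗᵢ[ℂ] Lp ℂ 2 μ) {m : X → ℝ}
    (hm : Measurable m) (h0 : ∀ x, 0 ≤ m x) : IsPosSelfAdjoint (mulOp A A fun x => (m x : ℂ)) := by
  constructor
  · rw [LinearPMap.isSelfAdjoint_def,
      mulOp_adjoint (m := fun x => (m x : ℂ)) A A (Complex.measurable_ofReal.comp hm)]
    simp
  · intro u
    have h := mulOp_apply_ae A A (fun x => (m x : ℂ)) u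
    rw [← A.inner_map_map, L2.inner_def]
    have : ∫ x, inner ℂ ((A (u : E) : X → ℂ) x) ((A (mulOp A A (fun x => (m x : ℂ)) u) : X → ℂ) x) ∂μ
        = ((∫ x, m x * ‖(A (u : E) : X → ℂ) x‖ ^ 2 ∂μ : ℝ) : ℂ) := by
      rw [← integral_complex_ofReal]
      apply integral_congr_ae
      filter_upwards [h] with x hx
      rw [hx, RCLike.inner_apply, mul_assoc, Complex.mul_conj, Complex.normSq_eq_norm_sq]
      push_cast; ring
    rw [this, Complex.ofReal_re]
    exact integral_nonneg fun x => mul_nonneg (h0 x) (by positivity)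

/-- An operator contained in a multiplication operator is closable, and its closure is the
multiplication operator if its domain is dense in the graph norm, expressed by duality. -/
theorem closure_eq_mulOp [CompleteSpace E] [CompleteSpace F]
    (A : E ≃ₗᵢ[ℂ] Lp ℂ 2 μ) (B : F ≃ₗᵢ[ℂ] Lp ℂ 2 μ) {m : X → ℂ}
    (hm : Measurable m) {f : E →ₗ.[ℂ] F} (hf : f ≤ mulOp A B m)
    (hdense : ∀ v v' : Lp ℂ 2 μ, ((v' : X → ℂ) =ᵐ[μ] fun x => m x * (v : X → ℂ) x) →
      (∀ e : f.domain, ∫ x, starRingEnd ℂ ((A (e : E) : X → ℂ) x) *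
        ((v : X → ℂ) x + starRingEnd ℂ (m x) * (v' : X → ℂ) x) ∂μ = 0) → v = 0) :
    f.IsClosable ∧ f.closure = mulOp A B m := by
  have hcl := mulOp_isClosed A B hm
  have hfc : f.IsClosable := hcl.isClosable.leIsClosable hf
  refine ⟨hfc, ?_⟩
  apply LinearPMap.eq_of_eq_graph
  rw [← hfc.graph_closure_eq_closure_graph]
  refine le_antisymm (Submodule.topologicalClosure_minimal _ (LinearPMap.le_graph_of_le hf) hcl) ?_
  -- work in the Hilbert space `WithLp 2 (E × F)`
  rintro ⟨e, g⟩ heg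
  let Φ : WithLp 2 (E × F) ≃L[ℂ] E × F := WithLp.prodContinuousLinearEquiv 2 ℂ E F
  let S : Submodule ℂ (WithLp 2 (E × F)) := f.graph.comap (Φ : WithLp 2 (E × F) →ₗ[ℂ] E × F)
  let S' : Submodule ℂ (WithLp 2 (E × F)) := S.topologicalClosure
  have : CompleteSpace S' := S.isClosed_topologicalClosure.completeSpace_coe
  have hmemS : ∀ p ∈ S', Φ p ∈ f.graph.topologicalClosure := by
    intro p hp
    have : S' ≤ (f.graph.topologicalClosure).comap (Φ : WithLp 2 (E × F) →ₗ[ℂ] E × F) := by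
      refine Submodule.topologicalClosure_minimal _ ?_ ?_
      · intro q hq
        exact Submodule.le_topologicalClosure _ hq
      · exact (Submodule.isClosed_topologicalClosure _).preimage Φ.continuous
    exact this hp
  have hgraph : ∀ p ∈ S', Φ p ∈ (mulOp A B m).graph := by
    intro p hp
    exact Submodule.topologicalClosure_minimal _ (LinearPMap.le_graph_of_le hf) hcl (hmemS p hp)
  obtain ⟨p, hp, q, hq, hpq⟩ := Submodule.exists_add_mem_mem_orthogonal (K := S') (Φ.symm (e, g))
  have hΦ : (e, g) = Φ p + Φ q := by rw [← map_add, ← hpq]; simp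
  have hqg : Φ q ∈ (mulOp A B m).graph := by
    have : Φ q = (e, g) - Φ p := by rw [hΦ]; abel
    rw [this]
    exact sub_mem heg (hgraph p hp)
  have hq0 : Φ q = 0 := by
    rcases hΦq : Φ q with ⟨a, b⟩
    rw [hΦq] at hqg
    have hab := (mem_graph_mulOp A B m a b).1 hqg
    have ha : A a = 0 := by
      refine hdense (A a) (B b) hab ?_
      intro u
      have h1 := hq (Φ.symm ((u : E), f u)) (Submodule.le_topologicalClosure _ (by
        change Φ (Φ.symm _) ∈ f.graph
        rw [ContinuousLinearEquiv.apply_symm_apply]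
        exact LinearPMap.mem_graph _ u))
      have h2 : inner ℂ (Φ.symm ((u : E), f u)) q = inner ℂ (u : E) a + inner ℂ (f u) b := by
        rw [WithLp.prod_inner_apply]
        have e1 : q.ofLp.1 = a := congrArg Prod.fst hΦq
        have e2 : q.ofLp.2 = b := congrArg Prod.snd hΦq
        rw [e1, e2]
        rfl
      have hfu : ((u : E), f u) ∈ (mulOp A B m).graph :=
        LinearPMap.le_graph_of_le hf (LinearPMap.mem_graph _ u)
      rw [mem_graph_mulOp] at hfu
      rw [h2, ← A.inner_map_map, ← B.inner_map_map, L2.inner_def, L2.inner_def,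
        ← integral_add (L2.integrable_inner _ _) (L2.integrable_inner _ _)] at h1
      rw [← h1]
      apply integral_congr_ae
      filter_upwards [hfu] with x hx
      rw [hx]
      simp only [RCLike.inner_apply, map_mul]
      ring
    have ha' : a = 0 := by simpa using ha
    have hb : b = 0 := LinearPMap.graph_fst_eq_zero_snd _ hqg ha'
    rw [ha', hb]; rfl
  rw [hΦ, hq0, add_zero]
  exact hmemS p hp

end MulOp

/-! ### Matrix elements of exponentials of ladder operators -/

theorem hasSum_iff_of_forall_eq {f g : ℕ → ℂ} {a : ℂ} (h : ∀ j, f j = g j) :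
    HasSum f a ↔ HasSum g a := by
  rw [funext h]

theorem lowering_single (n : ℕ) (c : ℂ) :
    lowering (Finsupp.single n c) = (c * (Real.sqrt n : ℝ)) • Finsupp.single (n - 1) 1 := by
  simp [lowering]

theorem raising_single (n : ℕ) (c : ℂ) :
    raising (Finsupp.single n c) = (c * (Real.sqrt (n + 1) : ℝ)) • Finsupp.single (n + 1) 1 := by
  simp [raising]

theorem lowering_apply (w : ℕ →₀ ℂ) (n : ℕ) :
    lowering w n = (Real.sqrt (n + 1) : ℝ) * w (n + 1) := by
  induction w using Finsupp.induction_linear with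
  | zero => simp
  | add f g hf hg => simp [hf, hg, mul_add]
  | single j c =>
    rw [lowering_single]
    cases j with
    | zero => simp
    | succ j =>
      by_cases h : j = n
      · subst h; simp [mul_comm]
      · simp [h]

theorem raising_apply_zero (w : ℕ →₀ ℂ) : raising w 0 = 0 := by
  induction w using Finsupp.induction_linear with
  | zero => simp
  | add f g hf hg => simp [hf, hg]
  | single j c => simp [raising_single]

theorem raising_apply_succ (w : ℕ →₀ ℂ) (n : ℕ) :
    raising w (n + 1) = (Real.sqrt (n + 1) : ℝ) * w n := by
  induction w using Finsupp.induction_linear with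
  | zero => simp
  | add f g hf hg => simp [hf, hg, mul_add]
  | single j c =>
    rw [raising_single]
    by_cases h : j = n
    · subst h; simp [mul_comm]
    · simp [h]

theorem sqrt_mul_self_cast (n : ℕ) :
    ((Real.sqrt (n + 1) : ℝ) : ℂ) * (Real.sqrt (n + 1) : ℝ) = n + 1 := by
  rw [← Complex.ofReal_mul, Real.mul_self_sqrt (by positivity)]
  push_cast; ring

/-- The canonical commutation relation `[a, a†] = 1`. -/
theorem lowering_mul_raising : lowering * raising = raising * lowering + 1 := by
  apply LinearMap.ext
  intro w
  ext n
  simp only [Module.End.mul_apply, LinearMap.add_apply, Module.End.one_apply, Finsupp.add_apply]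
  rw [lowering_apply, raising_apply_succ, ← mul_assoc, sqrt_mul_self_cast]
  cases n with
  | zero => simp [raising_apply_zero]
  | succ n =>
    rw [raising_apply_succ, lowering_apply, ← mul_assoc, sqrt_mul_self_cast]
    push_cast; ring

/-- The exponent `α a† + β a + γ`. -/
noncomputable def ladder (α β γ : ℂ) : Module.End ℂ (ℕ →₀ ℂ) := α • raising + β • lowering + γ • 1

theorem ladder_single (α β γ : ℂ) (m : ℕ) : ladder α β γ (Finsupp.single m 1) =
    (α * (Real.sqrt (m + 1) : ℝ)) • Finsupp.single (m + 1) 1 +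
      (β * (Real.sqrt m : ℝ)) • Finsupp.single (m - 1) 1 + γ • Finsupp.single m 1 := by
  simp only [ladder, LinearMap.add_apply, LinearMap.smul_apply, raising_single, lowering_single,
    Module.End.one_apply, one_mul, smul_smul]

/-- Each power of the exponent raises the excitation number by at most one, so `‖G^j |m⟩‖` grows like
`K^j √((m+j)! / m!)`; this is beaten by `j!`, and the exponential series converges in norm. -/
theorem norm_ladder_pow_le (α β γ : ℂ) (j m : ℕ) :
    ‖(toEll2 ((ladder α β γ ^ j) (Finsupp.single m 1)) : Ell2 ℕ)‖ ≤
      (‖α‖ + ‖β‖ + ‖γ‖ + 1) ^ j * ∏ i ∈ Finset.range j, Real.sqrt (m + i + 1) := by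
  induction j generalizing m with
  | zero =>
    simp only [pow_zero, Module.End.one_apply, Finset.range_zero, Finset.prod_empty, mul_one]
    simp [toEll2, ket]
  | succ j ih =>
    set K := ‖α‖ + ‖β‖ + ‖γ‖ + 1 with hK
    have hmono : ∀ a b : ℕ, a ≤ b → ∏ i ∈ Finset.range j, Real.sqrt (a + i + 1) ≤
        ∏ i ∈ Finset.range j, Real.sqrt (b + i + 1) := by
      intro a b hab
      refine Finset.prod_le_prod (fun _ _ => Real.sqrt_nonneg _) fun i _ => Real.sqrt_le_sqrt ?_
      have : (a : ℝ) ≤ b := by exact_mod_cast hab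
      linarith
    set Q := ∏ i ∈ Finset.range j, Real.sqrt ((m + 1 : ℕ) + i + 1) with hQ
    have hQ0 : 0 ≤ Q := Finset.prod_nonneg fun _ _ => Real.sqrt_nonneg _
    have hsplit : ∏ i ∈ Finset.range (j + 1), Real.sqrt (m + i + 1) = Q * Real.sqrt (m + 1) := by
      rw [Finset.prod_range_succ']
      congr 1
      · refine Finset.prod_congr rfl fun i _ => ?_
        congr 1; push_cast; ring
      · simp
    have hb : ∀ a : ℕ, a ≤ m + 1 →
        ‖(toEll2 ((ladder α β γ ^ j) (Finsupp.single a 1)) : Ell2 ℕ)‖ ≤ K ^ j * Q := by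
      intro a ha
      exact (ih a).trans (mul_le_mul_of_nonneg_left (hmono _ _ ha) (by positivity))
    have hs1 : Real.sqrt m ≤ Real.sqrt (m + 1) := Real.sqrt_le_sqrt (by linarith)
    have hs2 : 1 ≤ Real.sqrt (m + 1) := by
      rw [Real.one_le_sqrt]; linarith [(Nat.cast_nonneg m : (0 : ℝ) ≤ m)]
    rw [pow_succ, Module.End.mul_apply, ladder_single, hsplit]
    simp only [map_add, map_smul]
    refine (norm_add₃_le).trans ?_
    rw [norm_smul, norm_smul, norm_smul, norm_mul, norm_mul, Complex.norm_real, Complex.norm_real,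
      Real.norm_of_nonneg (Real.sqrt_nonneg _), Real.norm_of_nonneg (Real.sqrt_nonneg _)]
    calc _ ≤ ‖α‖ * Real.sqrt (m + 1) * (K ^ j * Q) + ‖β‖ * Real.sqrt (m + 1) * (K ^ j * Q)
          + ‖γ‖ * Real.sqrt (m + 1) * (K ^ j * Q) := by
          have h1 := hb (m + 1) le_rfl
          have h2 := hb (m - 1) (by omega)
          have h3 := hb m (by omega)
          have h4 : ‖γ‖ ≤ ‖γ‖ * Real.sqrt (m + 1) := le_mul_of_one_le_right (norm_nonneg _) hs2
          gcongr
      _ = (‖α‖ + ‖β‖ + ‖γ‖) * (Real.sqrt (m + 1) * (K ^ j * Q)) := by ring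
      _ ≤ K * (Real.sqrt (m + 1) * (K ^ j * Q)) := by
          gcongr
          linarith
      _ = K ^ (j + 1) * (Q * Real.sqrt (m + 1)) := by ring

theorem summable_expTerm_norm (α β γ : ℂ) (m : ℕ) :
    Summable fun j => ‖expTerm (ladder α β γ) m j‖ := by
  set K := ‖α‖ + ‖β‖ + ‖γ‖ + 1 with hK
  have hK0 : 0 < K := by positivity
  have hle : ∀ j, ‖expTerm (ladder α β γ) m j‖ ≤
      ((j.factorial : ℝ))⁻¹ * (K ^ j * ∏ i ∈ Finset.range j, Real.sqrt (m + i + 1)) := by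
    intro j
    rw [expTerm, norm_smul, norm_inv, Complex.norm_natCast]
    exact mul_le_mul_of_nonneg_left (norm_ladder_pow_le α β γ j m) (by positivity)
  refine Summable.of_nonneg_of_le (fun _ => norm_nonneg _) hle ?_
  -- the ratio `K √(m + j + 1) / (j + 1)` of consecutive terms is eventually at most `1 / 2`
  refine summable_of_ratio_norm_eventually_le (r := 1 / 2) (by norm_num) ?_
  obtain ⟨N, hN⟩ := exists_nat_ge (4 * K ^ 2 * (m + 1))
  filter_upwards [Filter.eventually_ge_atTop N] with j hj
  have hP0 : 0 ≤ ∏ i ∈ Finset.range j, Real.sqrt (m + i + 1) :=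
    Finset.prod_nonneg fun _ _ => Real.sqrt_nonneg _
  have hkey : K * Real.sqrt (m + j + 1) ≤ (j + 1) / 2 := by
    have h1 : 4 * K ^ 2 * (m + 1) ≤ j + 1 := by
      have : (N : ℝ) ≤ j := by exact_mod_cast hj
      linarith
    have h2 : (0 : ℝ) ≤ m := Nat.cast_nonneg m
    have h3 : (0 : ℝ) ≤ j := Nat.cast_nonneg j
    rw [← Real.sqrt_sq hK0.le, ← Real.sqrt_mul (by positivity), Real.sqrt_le_left (by positivity)]
    have : 4 * K ^ 2 * ((m + 1) * (j + 1)) ≤ (j + 1) ^ 2 := by nlinarith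
    nlinarith [mul_nonneg h2 h3, sq_nonneg K]
  rw [Finset.prod_range_succ, Nat.factorial_succ, Real.norm_of_nonneg (by positivity),
    Real.norm_of_nonneg (by positivity)]
  push_cast
  rw [mul_inv]
  calc _ = ((j : ℝ) + 1)⁻¹ * (K * Real.sqrt (m + j + 1)) *
        ((j.factorial : ℝ)⁻¹ * (K ^ j * ∏ i ∈ Finset.range j, Real.sqrt (m + i + 1))) := by ring
    _ ≤ ((j : ℝ) + 1)⁻¹ * ((j + 1) / 2) *
        ((j.factorial : ℝ)⁻¹ * (K ^ j * ∏ i ∈ Finset.range j, Real.sqrt (m + i + 1))) := by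
        gcongr
    _ = _ := by field_simp

theorem summable_expTerm (α β γ : ℂ) (m : ℕ) : Summable (expTerm (ladder α β γ) m) :=
  (summable_expTerm_norm α β γ m).of_norm

theorem expTerm_apply (G : Module.End ℂ (ℕ →₀ ℂ)) (m j n : ℕ) :
    (expTerm G m j : Ell2 ℕ) n = ((j.factorial : ℂ))⁻¹ * (G ^ j) (Finsupp.single m 1) n := by
  rw [expTerm, lp.coeFn_smul, Pi.smul_apply, toEll2_apply, smul_eq_mul]

theorem hasSum_expEntry (α β γ : ℂ) (n m : ℕ) :
    HasSum (fun j => ((j.factorial : ℂ))⁻¹ * (ladder α β γ ^ j) (Finsupp.single m 1) n)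
      (expEntry (ladder α β γ) n m) := by
  have h := (summable_expTerm α β γ m).hasSum.mapL (lp.evalCLM ℂ (fun _ : ℕ => ℂ) 2 n)
  simp only [← expTerm_apply]
  exact h

theorem summable_norm_expEntry (α β γ : ℂ) (n m : ℕ) :
    Summable fun j => ‖((j.factorial : ℂ))⁻¹ * (ladder α β γ ^ j) (Finsupp.single m 1) n‖ := by
  refine Summable.of_nonneg_of_le (fun _ => norm_nonneg _) (fun j => ?_)
    (summable_expTerm_norm α β γ m)
  rw [← expTerm_apply]
  exact lp.norm_apply_le_norm (by norm_num) _ _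

/-- If `[A, G] = c` is a scalar, then `A G^(j+1) = G^(j+1) A + (j+1) c G^j`. -/
theorem mul_pow_succ_of_commutator {A G : Module.End ℂ (ℕ →₀ ℂ)} {c : ℂ}
    (h : A * G = G * A + c • 1) (j : ℕ) :
    A * G ^ (j + 1) = G ^ (j + 1) * A + ((j + 1 : ℂ) * c) • G ^ j := by
  induction j with
  | zero => simp [h]
  | succ j ih =>
    rw [pow_succ, ← mul_assoc, ih, add_mul, mul_assoc, h, smul_mul_assoc, ← pow_succ, mul_add,
      ← mul_assoc, ← pow_succ, mul_smul_comm, mul_one, add_assoc, ← add_smul]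
    congr 2
    push_cast; ring

theorem lowering_mul_ladder (α β γ : ℂ) :
    lowering * ladder α β γ = ladder α β γ * lowering + α • 1 := by
  simp only [ladder, mul_add, add_mul, mul_smul_comm, smul_mul_assoc, lowering_mul_raising,
    smul_add, mul_one, one_mul]
  abel

theorem raising_mul_ladder (α β γ : ℂ) :
    raising * ladder α β γ = ladder α β γ * raising + (-β) • 1 := by
  simp only [ladder, mul_add, add_mul, mul_smul_comm, smul_mul_assoc, lowering_mul_raising,
    smul_add, mul_one, one_mul]
  module

/-- Summed over the exponential series, `[A, G] = c` becomes `[A, e^G] = c e^G`. -/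
theorem hasSum_commutator {A : Module.End ℂ (ℕ →₀ ℂ)} {α β γ c : ℂ}
    (h : A * ladder α β γ = ladder α β γ * A + c • 1) (n m : ℕ) {s : ℂ}
    (hs : HasSum (fun j => ((j.factorial : ℂ))⁻¹ *
      ((ladder α β γ ^ j) (A (Finsupp.single m 1))) n) s) :
    HasSum (fun j => ((j.factorial : ℂ))⁻¹ * (A ((ladder α β γ ^ j) (Finsupp.single m 1))) n)
      (s + c * expEntry (ladder α β γ) n m) := by
  have h1 := (hasSum_expEntry α β γ n m).mul_left c
  rw [← hasSum_nat_add_iff' 1] at hs ⊢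
  rw [Finset.sum_range_one] at hs ⊢
  simp only [pow_zero, Module.End.one_apply] at hs ⊢
  have h2 := hs.add h1
  rw [sub_add_eq_add_sub] at h2
  rw [add_comm s, add_sub_assoc, add_comm, sub_add_eq_add_sub]
  refine (hasSum_iff_of_forall_eq fun j => ?_).mpr h2
  · rw [← Module.End.mul_apply A, mul_pow_succ_of_commutator h]
    simp only [LinearMap.add_apply, Module.End.mul_apply, LinearMap.smul_apply, Finsupp.add_apply,
      Finsupp.smul_apply, smul_eq_mul]
    rw [Nat.factorial_succ]
    push_cast
    have : (j : ℂ) + 1 ≠ 0 := by exact_mod_cast Nat.succ_ne_zero j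
    field_simp

/-- The commutator `[a, e^G] = α e^G`, by matrix elements. -/
theorem expEntry_succ_left (α β γ : ℂ) (n m : ℕ) :
    (Real.sqrt (n + 1) : ℝ) * expEntry (ladder α β γ) (n + 1) m =
      (Real.sqrt m : ℝ) * expEntry (ladder α β γ) n (m - 1) + α * expEntry (ladder α β γ) n m := by
  have h1 := (hasSum_expEntry α β γ (n + 1) m).mul_left ((Real.sqrt (n + 1) : ℝ) : ℂ)
  have h2 := (hasSum_expEntry α β γ n (m - 1)).mul_left ((Real.sqrt m : ℝ) : ℂ)
  refine h1.unique ?_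
  have h3 := hasSum_commutator (lowering_mul_ladder α β γ) n m (s := (Real.sqrt m : ℝ) *
    expEntry (ladder α β γ) n (m - 1)) (by
      refine (hasSum_iff_of_forall_eq fun j => ?_).mpr h2
      rw [lowering_single, map_smul, Finsupp.smul_apply, smul_eq_mul]; ring)
  refine (hasSum_iff_of_forall_eq fun j => ?_).mpr h3
  rw [lowering_apply]; ring

/-- The commutator `[a†, e^G] = -β e^G`, by matrix elements. -/
theorem expEntry_succ_right (α β γ : ℂ) (n m : ℕ) :
    (Real.sqrt (m + 1) : ℝ) * expEntry (ladder α β γ) n (m + 1) =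
      (Real.sqrt n : ℝ) * expEntry (ladder α β γ) (n - 1) m + β * expEntry (ladder α β γ) n m := by
  have h2 := (hasSum_expEntry α β γ n (m + 1)).mul_left ((Real.sqrt (m + 1) : ℝ) : ℂ)
  have h3 := hasSum_commutator (raising_mul_ladder α β γ) n m (s := (Real.sqrt (m + 1) : ℝ) *
    expEntry (ladder α β γ) n (m + 1)) (by
      refine (hasSum_iff_of_forall_eq fun j => ?_).mpr h2
      rw [raising_single, map_smul, Finsupp.smul_apply, smul_eq_mul]; ring)
  cases n with
  | zero =>
    have h4 : HasSum (fun _ : ℕ => (0 : ℂ)) 0 := hasSum_zero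
    have := h3.unique ((hasSum_iff_of_forall_eq fun j => by rw [raising_apply_zero, mul_zero]).mpr h4)
    simp only [Nat.cast_zero, Real.sqrt_zero, Complex.ofReal_zero, zero_mul, zero_add]
    linear_combination this
  | succ n =>
    have h1 := (hasSum_expEntry α β γ n m).mul_left ((Real.sqrt (n + 1) : ℝ) : ℂ)
    have := h3.unique ((hasSum_iff_of_forall_eq fun j => by
      rw [raising_apply_succ]; ring).mpr h1)
    simp only [Nat.cast_add, Nat.cast_one, Nat.add_sub_cancel]
    linear_combination this

/-- Vacuum moments of `G = α a† + β a` (Wick): `⟨0|G^(i+2)|0⟩ = (i+1) αβ ⟨0|G^i|0⟩`, whence the even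
moments are those of a Gaussian of variance `αβ` and the odd ones vanish. -/
theorem ladder_vacuum_moment (α β : ℂ) (j : ℕ) :
    (ladder α β 0 ^ (2 * j)) (Finsupp.single 0 1) 0 =
      ((2 * j).factorial : ℂ) * ((j.factorial : ℂ)⁻¹ * (α * β / 2) ^ j) ∧
    (ladder α β 0 ^ (2 * j + 1)) (Finsupp.single 0 1) 0 = 0 := by
  have hstep : ∀ i : ℕ, (ladder α β 0 ^ (i + 2)) (Finsupp.single 0 1) 0 =
      (i + 1) * (α * β) * (ladder α β 0 ^ i) (Finsupp.single 0 1) 0 := by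
    intro i
    have h := congrArg (fun L => L (Finsupp.single 0 1) 0)
      (mul_pow_succ_of_commutator (lowering_mul_ladder α β 0) i)
    rw [pow_succ', Module.End.mul_apply]
    simp only [Module.End.mul_apply, LinearMap.add_apply, LinearMap.smul_apply, Finsupp.add_apply,
      Finsupp.smul_apply, smul_eq_mul, lowering_single] at h
    simp only [ladder] at h ⊢
    simp only [LinearMap.add_apply, LinearMap.smul_apply, Finsupp.add_apply, Finsupp.smul_apply,
      smul_eq_mul, raising_apply_zero, zero_smul, LinearMap.zero_apply, Finsupp.coe_zero,
      Pi.zero_apply] at h ⊢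
    rw [h]
    simp
    ring
  induction j with
  | zero =>
    constructor
    · simp
    · simp [ladder, raising_single, lowering_single]
  | succ j ih =>
    constructor
    · rw [show 2 * (j + 1) = 2 * j + 2 by ring, hstep, ih.1, Nat.factorial_succ, Nat.factorial_succ,
        Nat.factorial_succ]
      push_cast
      have : (j : ℂ) + 1 ≠ 0 := by exact_mod_cast Nat.succ_ne_zero j
      field_simp
      ring
    · rw [show 2 * (j + 1) + 1 = 2 * j + 1 + 2 by ring, hstep, ih.2, mul_zero]

/-- `⟨0| e^(α a† + β a) |0⟩ = e^(αβ/2)`. -/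
theorem expEntry_vacuum (α β : ℂ) :
    expEntry (ladder α β 0) 0 0 = Complex.exp (α * β / 2) := by
  refine (hasSum_expEntry α β 0 0 0).unique ?_
  have h1 : HasSum (fun j : ℕ => (((2 * j).factorial : ℂ))⁻¹ *
      (ladder α β 0 ^ (2 * j)) (Finsupp.single 0 1) 0) (Complex.exp (α * β / 2)) := by
    have := NormedSpace.expSeries_div_hasSum_exp (𝔸 := ℂ) (α * β / 2)
    rw [← Complex.exp_eq_exp_ℂ] at this
    refine (hasSum_iff_of_forall_eq fun j => ?_).mpr this
    rw [(ladder_vacuum_moment α β j).1]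
    have : ((2 * j).factorial : ℂ) ≠ 0 := by exact_mod_cast Nat.factorial_ne_zero _
    field_simp
  have h2 : HasSum (fun j : ℕ => (((2 * j + 1).factorial : ℂ))⁻¹ *
      (ladder α β 0 ^ (2 * j + 1)) (Finsupp.single 0 1) 0) 0 := by
    simp only [(ladder_vacuum_moment α β _).2, mul_zero]
    exact hasSum_zero
  have h3 := HasSum.even_add_odd (f := fun i : ℕ => ((i.factorial : ℂ))⁻¹ *
    (ladder α β 0 ^ i) (Finsupp.single 0 1) 0) h1 h2
  rwa [add_zero] at h3

/-- The scalar part of the exponent factors out: `e^(G + γ) = e^γ e^G`. -/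
theorem expEntry_add_scalar (α β γ : ℂ) (n m : ℕ) :
    expEntry (ladder α β γ) n m = Complex.exp γ * expEntry (ladder α β 0) n m := by
  refine (hasSum_expEntry α β γ n m).unique ?_
  have hγ : Complex.exp γ = ∑' j : ℕ, γ ^ j / (j.factorial : ℂ) := by
    rw [Complex.exp_eq_exp_ℂ, NormedSpace.exp_eq_tsum_div]
  have hs := NormedSpace.norm_expSeries_div_summable (𝔸 := ℂ) γ
  have h0 := summable_norm_expEntry α β 0 n m
  rw [hγ, ← (hasSum_expEntry α β 0 n m).tsum_eq,
    tsum_mul_tsum_eq_tsum_sum_antidiagonal_of_summable_norm hs h0]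
  have hsum := (summable_norm_sum_mul_antidiagonal_of_summable_norm hs h0).of_norm.hasSum
  refine (hasSum_iff_of_forall_eq fun j => ?_).mpr hsum
  have hl : ladder α β γ = γ • 1 + ladder α β 0 := by simp [ladder, add_comm]
  have hcomm : Commute (γ • (1 : Module.End ℂ (ℕ →₀ ℂ))) (ladder α β 0) :=
    (Commute.one_left _).smul_left γ
  rw [hl, hcomm.add_pow', LinearMap.sum_apply, Finsupp.finsetSum_apply, Finset.mul_sum]
  refine Finset.sum_congr rfl fun p hp => ?_
  rw [Finset.HasAntidiagonal.mem_antidiagonal] at hp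
  rw [LinearMap.smul_apply, smul_pow, one_pow, smul_mul_assoc, one_mul, LinearMap.smul_apply,
    Finsupp.smul_apply, Finsupp.smul_apply, smul_eq_mul, nsmul_eq_mul]
  have hch : (((p.1 + p.2).choose p.1 : ℕ) : ℂ) * p.1.factorial * p.2.factorial =
      (p.1 + p.2).factorial := by
    rw [Nat.choose_symm_add]
    exact_mod_cast Nat.add_choose_mul_factorial_mul_factorial p.1 p.2
  rw [← hp, ← hch]
  have e1 : (p.1.factorial : ℂ) ≠ 0 := by exact_mod_cast Nat.factorial_ne_zero _
  have e2 : (p.2.factorial : ℂ) ≠ 0 := by exact_mod_cast Nat.factorial_ne_zero _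
  have e3 : (((p.1 + p.2).choose p.1 : ℕ) : ℂ) ≠ 0 := by
    exact_mod_cast (Nat.choose_pos (Nat.le_add_right _ _)).ne'
  field_simp

theorem sqrt_succ_ne_zero (n : ℕ) : ((Real.sqrt (n + 1) : ℝ) : ℂ) ≠ 0 := by
  rw [Complex.ofReal_ne_zero]; positivity

/-- The matrix of `e^(α a† + β a)` is determined by the two commutation relations and its vacuum
element. -/
theorem eq_expEntry_of_recursion {α β : ℂ} {f : ℕ → ℕ → ℂ}
    (h00 : f 0 0 = Complex.exp (α * β / 2))
    (h0 : ∀ m : ℕ, (Real.sqrt (m + 1) : ℝ) * f 0 (m + 1) = β * f 0 m)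
    (hl : ∀ n m : ℕ, (Real.sqrt (n + 1) : ℝ) * f (n + 1) m =
      (Real.sqrt m : ℝ) * f n (m - 1) + α * f n m) (n m : ℕ) :
    f n m = expEntry (ladder α β 0) n m := by
  induction n generalizing m with
  | zero =>
    induction m with
    | zero => rw [h00, expEntry_vacuum]
    | succ m ih =>
      have h1 := expEntry_succ_right α β 0 0 m
      simp only [Nat.cast_zero, Real.sqrt_zero, Complex.ofReal_zero, zero_mul, zero_add] at h1
      apply mul_left_cancel₀ (sqrt_succ_ne_zero m)
      rw [h0, h1, ih]
  | succ n ih =>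
    apply mul_left_cancel₀ (sqrt_succ_ne_zero n)
    rw [hl, expEntry_succ_left, ih, ih]

/-! ### Oscillator functions and quadratures -/

theorem derivative_hermite_succ (n : ℕ) :
    Polynomial.derivative (Polynomial.hermite (n + 1)) = (n + 1 : ℤ) • Polynomial.hermite n := by
  induction n with
  | zero => simp
  | succ n ih =>
    rw [Polynomial.hermite_succ (n + 1), Polynomial.derivative_sub, Polynomial.derivative_mul, ih,
      Polynomial.derivative_X, Polynomial.derivative_smul, Polynomial.hermite_succ n]
    simp only [zsmul_eq_mul]
    push_cast
    ring

theorem aeval_hermite_succ (n : ℕ) (y : ℝ) : Polynomial.aeval y (Polynomial.hermite (n + 1)) =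
    y * Polynomial.aeval y (Polynomial.hermite n) -
      n * Polynomial.aeval y (Polynomial.hermite (n - 1)) := by
  rw [Polynomial.hermite_succ]
  cases n with
  | zero => simp
  | succ n =>
    rw [derivative_hermite_succ]
    simp

theorem hasDerivAt_hermite (n : ℕ) (y : ℝ) :
    HasDerivAt (fun y : ℝ => Polynomial.aeval y (Polynomial.hermite n))
      (n * Polynomial.aeval y (Polynomial.hermite (n - 1))) y := by
  have h := Polynomial.hasDerivAt_aeval (Polynomial.hermite n) y
  cases n with
  | zero => simpa using h
  | succ n =>
    rw [derivative_hermite_succ] at h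
    simpa using h

theorem sqrt_factorial_inv_succ (n : ℕ) :
    Real.sqrt (n + 1) * (Real.sqrt ((n + 1).factorial : ℝ))⁻¹ = (Real.sqrt (n.factorial : ℝ))⁻¹ := by
  rw [Nat.factorial_succ, Nat.cast_mul, Real.sqrt_mul (by positivity)]
  push_cast
  have : Real.sqrt ((n : ℝ) + 1) ≠ 0 := by positivity
  rw [mul_inv, ← mul_assoc, mul_inv_cancel₀ this, one_mul]

theorem sqrt_factorial_inv_pred (n : ℕ) :
    n * (Real.sqrt (n.factorial : ℝ))⁻¹ = Real.sqrt n * (Real.sqrt ((n - 1).factorial : ℝ))⁻¹ := by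
  cases n with
  | zero => simp
  | succ n =>
    have h := sqrt_factorial_inv_succ n
    simp only [Nat.cast_add, Nat.cast_one, Nat.add_sub_cancel]
    rw [← h, ← mul_assoc, Real.mul_self_sqrt (by positivity)]

/-- The position operator in the Fock basis: `2 x u_n = √n u_(n-1) + √(n+1) u_(n+1)`. -/
theorem two_mul_fockWave (n : ℕ) (x : ℝ) : 2 * x * fockWave n x =
    Real.sqrt n * fockWave (n - 1) x + Real.sqrt (n + 1) * fockWave (n + 1) x := by
  simp only [fockWave, aeval_hermite_succ]
  have h1 := sqrt_factorial_inv_succ n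
  have h2 := sqrt_factorial_inv_pred n
  linear_combination ((2 / Real.pi) ^ (1 / 4 : ℝ) *
    Polynomial.aeval (2 * x) (Polynomial.hermite (n - 1)) * Real.exp (-x ^ 2)) * h2 -
    ((2 / Real.pi) ^ (1 / 4 : ℝ) * (2 * x * Polynomial.aeval (2 * x) (Polynomial.hermite n) -
      n * Polynomial.aeval (2 * x) (Polynomial.hermite (n - 1))) * Real.exp (-x ^ 2)) * h1

/-- The momentum operator in the Fock basis: `u_n' = √n u_(n-1) - √(n+1) u_(n+1)`. -/
theorem hasDerivAt_fockWave (n : ℕ) (x : ℝ) : HasDerivAt (fockWave n)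
    (Real.sqrt n * fockWave (n - 1) x - Real.sqrt (n + 1) * fockWave (n + 1) x) x := by
  have hH : HasDerivAt (fun x : ℝ => Polynomial.aeval (2 * x) (Polynomial.hermite n))
      (n * Polynomial.aeval (2 * x) (Polynomial.hermite (n - 1)) * 2) x := by
    have h2 : HasDerivAt (fun x : ℝ => 2 * x) 2 x := by simpa using (hasDerivAt_id x).const_mul 2
    exact HasDerivAt.comp x (hasDerivAt_hermite n (2 * x)) h2
  have hE : HasDerivAt (fun x : ℝ => Real.exp (-x ^ 2)) (Real.exp (-x ^ 2) * (-(2 * x))) x := by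
    have : HasDerivAt (fun x : ℝ => -x ^ 2) (-(2 * x)) x := by simpa using (hasDerivAt_pow 2 x).fun_neg
    exact this.exp
  have h := (hH.const_mul ((2 / Real.pi) ^ (1 / 4 : ℝ) * (Real.sqrt (n.factorial : ℝ))⁻¹)).mul hE
  refine h.congr_deriv ?_
  simp only [fockWave, aeval_hermite_succ]
  have h1 := sqrt_factorial_inv_succ n
  have h2 := sqrt_factorial_inv_pred n
  linear_combination ((2 / Real.pi) ^ (1 / 4 : ℝ) *
    Polynomial.aeval (2 * x) (Polynomial.hermite (n - 1)) * Real.exp (-x ^ 2)) * h2 +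
    ((2 / Real.pi) ^ (1 / 4 : ℝ) * (2 * x * Polynomial.aeval (2 * x) (Polynomial.hermite n) -
      n * Polynomial.aeval (2 * x) (Polynomial.hermite (n - 1))) * Real.exp (-x ^ 2)) * h1

theorem continuous_fockWave (n : ℕ) : Continuous (fockWave n) :=
  continuous_iff_continuousAt.2 fun x => (hasDerivAt_fockWave n x).continuousAt

/-- Half of the Gaussian factor absorbs the Hermite polynomial. -/
theorem exists_fockWave_bound (n : ℕ) :
    ∃ C : ℝ, 0 ≤ C ∧ ∀ x, |fockWave n x| ≤ C * Real.exp (-x ^ 2 / 2) := by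
  set p := Polynomial.hermite n with hp
  set C₀ : ℝ := ∑ i ∈ Finset.range (p.natDegree + 1), |(p.coeff i : ℝ)| * i.factorial with hC₀
  set K : ℝ := (2 / Real.pi) ^ (1 / 4 : ℝ) * (Real.sqrt (n.factorial : ℝ))⁻¹ with hK
  have hK0 : 0 ≤ K := by positivity
  have hC₀0 : 0 ≤ C₀ := Finset.sum_nonneg fun _ _ => by positivity
  refine ⟨K * C₀ * Real.exp 2, by positivity, fun x => ?_⟩
  have h1 : |Polynomial.aeval (2 * x) p| ≤ C₀ * Real.exp |2 * x| := by
    rw [Polynomial.aeval_eq_sum_range, hC₀, Finset.sum_mul]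
    refine (Finset.abs_sum_le_sum_abs _ _).trans (Finset.sum_le_sum fun i _ => ?_)
    rw [zsmul_eq_mul, abs_mul, abs_pow, mul_assoc]
    refine mul_le_mul_of_nonneg_left ?_ (abs_nonneg _)
    have := Real.pow_div_factorial_le_exp |2 * x| (abs_nonneg _) i
    rw [div_le_iff₀ (by positivity)] at this
    linarith
  have h2 : Real.exp |2 * x| * Real.exp (-x ^ 2) ≤ Real.exp 2 * Real.exp (-x ^ 2 / 2) := by
    rw [← Real.exp_add, ← Real.exp_add, Real.exp_le_exp, abs_mul, abs_two, ← sq_abs x]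
    nlinarith [sq_nonneg (|x| - 2)]
  rw [fockWave, abs_mul, abs_mul, ← hK, abs_of_nonneg hK0, abs_of_pos (Real.exp_pos _)]
  calc K * |Polynomial.aeval (2 * x) p| * Real.exp (-x ^ 2)
      ≤ K * (C₀ * Real.exp |2 * x|) * Real.exp (-x ^ 2) := by gcongr
    _ = K * C₀ * (Real.exp |2 * x| * Real.exp (-x ^ 2)) := by ring
    _ ≤ K * C₀ * (Real.exp 2 * Real.exp (-x ^ 2 / 2)) := by gcongr
    _ = _ := by ring

theorem exists_fockWave_mul_bound (n m : ℕ) :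
    ∃ C : ℝ, 0 ≤ C ∧ ∀ x, |fockWave n x * fockWave m x| ≤ C * Real.exp (-x ^ 2) := by
  obtain ⟨C, hC, h1⟩ := exists_fockWave_bound n
  obtain ⟨D, hD, h2⟩ := exists_fockWave_bound m
  refine ⟨C * D, by positivity, fun x => ?_⟩
  rw [abs_mul]
  calc _ ≤ (C * Real.exp (-x ^ 2 / 2)) * (D * Real.exp (-x ^ 2 / 2)) := by
        gcongr
        · exact h1 x
        · exact h2 x
    _ = C * D * (Real.exp (-x ^ 2 / 2) * Real.exp (-x ^ 2 / 2)) := by ring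
    _ = _ := by rw [← Real.exp_add]; ring_nf

theorem integrable_exp_neg_sq : Integrable fun x : ℝ => Real.exp (-x ^ 2) := by
  simpa using integrable_exp_neg_mul_sq (b := 1) one_pos

theorem integrable_mul_fockWave {e : ℝ → ℂ} (he : Continuous e) (he1 : ∀ x, ‖e x‖ ≤ 1) (n m : ℕ) :
    Integrable fun x : ℝ => e x * (fockWave n x * fockWave m x : ℝ) := by
  obtain ⟨C, hC, h⟩ := exists_fockWave_mul_bound n m
  refine (integrable_exp_neg_sq.const_mul C).mono' ?_ ?_
  · exact (he.mul (Complex.continuous_ofReal.comp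
      ((continuous_fockWave n).mul (continuous_fockWave m)))).aestronglyMeasurable
  · filter_upwards with x
    rw [norm_mul, Complex.norm_real, Real.norm_eq_abs]
    exact (mul_le_of_le_one_left (abs_nonneg _) (he1 x)).trans (h x)

theorem norm_exp_I_mul_mul (k x : ℝ) : ‖Complex.exp (Complex.I * (k * x))‖ = 1 := by
  rw [← Complex.ofReal_mul, mul_comm, Complex.norm_exp_ofReal_mul_I]

theorem integrable_exp_mul_fockWave (k : ℝ) (n m : ℕ) :
    Integrable fun x : ℝ =>
      Complex.exp (Complex.I * (k * x)) * (fockWave n x * fockWave m x : ℝ) :=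
  integrable_mul_fockWave (by fun_prop) (fun x => (norm_exp_I_mul_mul k x).le) n m

/-- The matrix element `∫ e^(ikx) u_n u_m dx` of `e^(ikx)` between oscillator states. -/
noncomputable def fockFourier (k : ℝ) (n m : ℕ) : ℂ :=
  ∫ x : ℝ, Complex.exp (Complex.I * (k * x)) * (fockWave n x * fockWave m x : ℝ)

theorem fockFourier_comm (k : ℝ) (n m : ℕ) : fockFourier k n m = fockFourier k m n := by
  simp only [fockFourier, mul_comm (fockWave n _)]

theorem integral_exp_mul_sum_fockWave (k c d : ℝ) (n m n' m' : ℕ) :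
    ∫ x : ℝ, Complex.exp (Complex.I * (k * x)) * (c * (fockWave n x * fockWave m x) +
        d * (fockWave n' x * fockWave m' x) : ℝ) =
      c * fockFourier k n m + d * fockFourier k n' m' := by
  rw [fockFourier, fockFourier, ← integral_const_mul, ← integral_const_mul, ← integral_add
    ((integrable_exp_mul_fockWave k n m).const_mul _)
    ((integrable_exp_mul_fockWave k n' m').const_mul _)]
  congr 1
  funext x
  push_cast
  ring

/-- Integration by parts turns the ladder relations of the oscillator functions into
`[a, e^(ikx)] = (ik/2) e^(ikx)`. -/
theorem fockFourier_succ_left (k : ℝ) (n m : ℕ) :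
    (Real.sqrt (n + 1) : ℝ) * fockFourier k (n + 1) m =
      (Real.sqrt m : ℝ) * fockFourier k n (m - 1) + Complex.I * k / 2 * fockFourier k n m := by
  -- `hpos`: multiplication by `2x` acts symmetrically on `u_n` and `u_m`; `hparts`: integration by
  -- parts of the product of `e^(ikx) u_m` with `∂ₓ u_n`; the claim is half their difference
  have hpos : (Real.sqrt n : ℝ) * fockFourier k (n - 1) m
        + (Real.sqrt (n + 1) : ℝ) * fockFourier k (n + 1) m =
      (Real.sqrt m : ℝ) * fockFourier k n (m - 1)
        + (Real.sqrt (m + 1) : ℝ) * fockFourier k n (m + 1) := by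
    rw [← integral_exp_mul_sum_fockWave, ← integral_exp_mul_sum_fockWave]
    congr 1
    funext x
    congr 2
    have h1 := two_mul_fockWave n x
    have h2 := two_mul_fockWave m x
    linear_combination (fockWave n x) * h2 - (fockWave m x) * h1
  have hparts : (Real.sqrt n : ℝ) * fockFourier k (n - 1) m
        + (-Real.sqrt (n + 1) : ℝ) * fockFourier k (n + 1) m =
      -(Complex.I * k * fockFourier k n m + ((Real.sqrt m : ℝ) * fockFourier k n (m - 1)
        + (-Real.sqrt (m + 1) : ℝ) * fockFourier k n (m + 1))) := by
    have hu : ∀ x : ℝ, HasDerivAt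
        (fun x : ℝ => Complex.exp (Complex.I * (k * x)) * (fockWave m x : ℝ))
        (Complex.exp (Complex.I * (k * x)) * (Complex.I * k) * (fockWave m x : ℝ) +
          Complex.exp (Complex.I * (k * x)) *
          (Real.sqrt m * fockWave (m - 1) x - Real.sqrt (m + 1) * fockWave (m + 1) x : ℝ)) x := by
      intro x
      have h1 : HasDerivAt (fun x : ℝ => Complex.I * (k * (x : ℂ))) (Complex.I * k) x := by
        have := ((Complex.ofRealCLM.hasDerivAt (x := x)).const_mul (k : ℂ)).const_mul Complex.I
        simpa using this
      exact h1.cexp.mul (hasDerivAt_fockWave m x).ofReal_comp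
    have hv : ∀ x : ℝ, HasDerivAt (fun x : ℝ => ((fockWave n x : ℝ) : ℂ))
        ((Real.sqrt n * fockWave (n - 1) x - Real.sqrt (n + 1) * fockWave (n + 1) x : ℝ)) x :=
      fun x => (hasDerivAt_fockWave n x).ofReal_comp
    have key := integral_mul_deriv_eq_deriv_mul_of_integrable (fun x _ => hu x) (fun x _ => hv x)
      (by
        refine (((integrable_exp_mul_fockWave k (n - 1) m).const_mul (Real.sqrt n : ℂ)).sub
          ((integrable_exp_mul_fockWave k (n + 1) m).const_mul (Real.sqrt (n + 1) : ℂ))).congr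
          (Filter.Eventually.of_forall fun x => ?_)
        simp only [Pi.mul_apply, Pi.sub_apply]
        push_cast
        ring)
      (by
        refine (((integrable_exp_mul_fockWave k n m).const_mul (Complex.I * k)).add
          (((integrable_exp_mul_fockWave k n (m - 1)).const_mul (Real.sqrt m : ℂ)).sub
          ((integrable_exp_mul_fockWave k n (m + 1)).const_mul (Real.sqrt (m + 1) : ℂ)))).congr
          (Filter.Eventually.of_forall fun x => ?_)
        simp only [Pi.mul_apply, Pi.add_apply, Pi.sub_apply]
        push_cast
        ring)
      (by
        refine (integrable_exp_mul_fockWave k n m).congr (Filter.Eventually.of_forall fun x => ?_)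
        simp only [Pi.mul_apply]
        push_cast
        ring)
    rw [← integral_exp_mul_sum_fockWave, ← integral_exp_mul_sum_fockWave]
    rw [fockFourier, ← integral_const_mul, ← integral_add
      ((integrable_exp_mul_fockWave k n m).const_mul _)]
    · convert key using 1
      · congr 1
        funext x
        push_cast
        ring
      · congr 2
        funext x
        push_cast
        ring
    · refine (((integrable_exp_mul_fockWave k n (m - 1)).const_mul (Real.sqrt m : ℂ)).sub
        ((integrable_exp_mul_fockWave k n (m + 1)).const_mul (Real.sqrt (m + 1) : ℂ))).congr
        (Filter.Eventually.of_forall fun x => ?_)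
      simp only [Pi.sub_apply]
      push_cast
      ring
  push_cast at hparts
  linear_combination (1 / 2 : ℂ) * hpos - (1 / 2 : ℂ) * hparts

/-- The characteristic function of the vacuum, which is a Gaussian. -/
theorem fockFourier_zero_zero (k : ℝ) :
    fockFourier k 0 0 = Complex.exp (-(k : ℂ) ^ 2 / 8) := by
  have h := fourierIntegral_gaussian (b := 2) (by norm_num) (k : ℂ)
  have hc : (((2 / Real.pi : ℝ) ^ (1 / 4 : ℝ) * (2 / Real.pi : ℝ) ^ (1 / 4 : ℝ) : ℝ) : ℂ) *
      ((Real.pi : ℂ) / 2) ^ (1 / 2 : ℂ) = 1 := by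
    rw [show ((Real.pi : ℂ) / 2) = ((Real.pi / 2 : ℝ) : ℂ) by push_cast; ring,
      show (1 / 2 : ℂ) = ((1 / 2 : ℝ) : ℂ) by push_cast; ring,
      ← Complex.ofReal_cpow (by positivity), ← Complex.ofReal_mul, ← Complex.ofReal_one,
      ← Real.rpow_add (by positivity)]
    congr 1
    rw [show (1 / 4 + 1 / 4 : ℝ) = 1 / 2 by norm_num,
      ← Real.mul_rpow (by positivity) (by positivity)]
    have : 2 / Real.pi * (Real.pi / 2) = 1 := by field_simp
    rw [this, Real.one_rpow]
  have h2 : fockFourier k 0 0 = (((2 / Real.pi : ℝ) ^ (1 / 4 : ℝ) *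
      (2 / Real.pi : ℝ) ^ (1 / 4 : ℝ) : ℝ) : ℂ) *
      ∫ x : ℝ, Complex.exp (Complex.I * k * x) * Complex.exp (-2 * (x : ℂ) ^ 2) := by
    rw [fockFourier, ← integral_const_mul]
    congr 1
    funext x
    have : Complex.exp (-2 * (x : ℂ) ^ 2) = Complex.exp (-(x : ℂ) ^ 2) * Complex.exp (-(x : ℂ) ^ 2) := by
      rw [← Complex.exp_add]; ring_nf
    rw [this]
    simp only [fockWave, Nat.factorial_zero, Nat.cast_one, Real.sqrt_one, inv_one, mul_one,
      Polynomial.hermite_zero, map_one]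
    push_cast
    ring_nf
  rw [h2, h, ← mul_assoc, hc, one_mul]
  congr 1
  ring

/-- The Fock-basis phases `e^(i(n-m)φ)`. -/
noncomputable def fockPhase (φ : ℝ) (n m : ℕ) : ℂ :=
  Complex.exp (Complex.I * (n * φ)) * starRingEnd ℂ (Complex.exp (Complex.I * (m * φ)))

theorem fockPhase_eq (φ : ℝ) (n m : ℕ) :
    fockPhase φ n m = Complex.exp (Complex.I * (((n : ℂ) - m) * φ)) := by
  rw [fockPhase, ← Complex.exp_conj, ← Complex.exp_add]
  congr 1
  simp only [map_mul, Complex.conj_I, Complex.conj_ofReal, map_natCast]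
  ring

theorem norm_fockPhase (φ : ℝ) (n m : ℕ) : ‖fockPhase φ n m‖ = 1 := by
  rw [fockPhase_eq, mul_comm, show ((n : ℂ) - m) * φ = ((((n : ℝ) - m) * φ : ℝ) : ℂ) by push_cast; ring,
    Complex.norm_exp_ofReal_mul_I]

theorem quadProjector_eq (φ x : ℝ) (p : ℕ × ℕ) : quadProjector (φ, x) p =
    fockPhase φ p.1 p.2 * (fockWave p.1 x * fockWave p.2 x : ℝ) := by
  simp only [quadProjector, quadKet, fockPhase, map_mul, Complex.conj_ofReal]
  push_cast
  ring

theorem quadrature_exponent (φ : ℝ) (c x : ℂ) : c • (quadrature φ - x • 1) =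
    ladder (Complex.exp (Complex.I * φ) * (c / 2)) (Complex.exp (-(Complex.I * φ)) * (c / 2))
      (-(c * x)) := by
  simp only [quadrature, ladder]
  module

theorem quadrature_exponent_zero (φ : ℝ) (c : ℂ) : c • quadrature φ =
    ladder (Complex.exp (Complex.I * φ) * (c / 2)) (Complex.exp (-(Complex.I * φ)) * (c / 2)) 0 := by
  simp only [quadrature, ladder]
  module

/-- `e^(ikX_φ)` in the Fock basis is the Fourier transform of the spectral density of `X_φ`. -/
theorem expEntry_quadrature (φ k : ℝ) (n m : ℕ) :
    expEntry ((Complex.I * k) • quadrature φ) n m = fockPhase φ n m * fockFourier k n m := by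
  rw [quadrature_exponent_zero]
  symm
  refine eq_expEntry_of_recursion (f := fun n m => fockPhase φ n m * fockFourier k n m) ?_ ?_ ?_ n m
  · simp only [fockFourier_zero_zero]
    have h1 : fockPhase φ 0 0 = 1 := by simp [fockPhase_eq]
    have h2 : Complex.exp (Complex.I * φ) * Complex.exp (-(Complex.I * φ)) = 1 := by
      rw [← Complex.exp_add]; simp
    rw [h1, one_mul]
    congr 1
    linear_combination (-(k : ℂ) ^ 2 / 8) * (-h2) - (Complex.exp (Complex.I * φ) *
      Complex.exp (-(Complex.I * φ)) * k ^ 2 / 8) * Complex.I_sq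
  · intro m
    have h := fockFourier_succ_left k m 0
    simp only [Nat.cast_zero, Real.sqrt_zero, Complex.ofReal_zero, zero_mul, zero_add] at h
    rw [fockFourier_comm k 0, fockFourier_comm k 0]
    have hp : fockPhase φ 0 (m + 1) = Complex.exp (-(Complex.I * φ)) * fockPhase φ 0 m := by
      rw [fockPhase_eq, fockPhase_eq, ← Complex.exp_add]
      congr 1; push_cast; ring
    rw [hp]
    linear_combination (Complex.exp (-(Complex.I * φ)) * fockPhase φ 0 m) * h
  · intro n m
    have h := fockFourier_succ_left k n m
    have hp : fockPhase φ (n + 1) m = Complex.exp (Complex.I * φ) * fockPhase φ n m := by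
      rw [fockPhase_eq, fockPhase_eq, ← Complex.exp_add]
      congr 1; push_cast; ring
    have hm : ((Real.sqrt m : ℝ) : ℂ) * fockPhase φ n (m - 1) =
        (Real.sqrt m : ℝ) * (Complex.exp (Complex.I * φ) * fockPhase φ n m) := by
      cases m with
      | zero => simp
      | succ m =>
        congr 1
        rw [fockPhase_eq, fockPhase_eq, ← Complex.exp_add, Nat.add_sub_cancel]
        congr 1; push_cast; ring
    rw [hp]
    linear_combination (Complex.exp (Complex.I * φ) * fockPhase φ n m) * h - fockFourier k n (m - 1) * hm

theorem integrable_exp_mul_quadProjector (φ k : ℝ) (p : ℕ × ℕ) :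
    Integrable (fun x : ℝ => Complex.exp (Complex.I * (k * x)) * quadProjector (φ, x) p) := by
  refine ((integrable_exp_mul_fockWave k p.1 p.2).const_mul (fockPhase φ p.1 p.2)).congr
    (Filter.Eventually.of_forall fun x => ?_)
  simp only [quadProjector_eq]
  ring

theorem integral_exp_mul_quadProjector (φ k : ℝ) (p : ℕ × ℕ) :
    ∫ x : ℝ, Complex.exp (Complex.I * (k * x)) * quadProjector (φ, x) p =
      expEntry ((Complex.I * k) • quadrature φ) p.1 p.2 := by
  rw [expEntry_quadrature, fockFourier, ← integral_const_mul]
  congr 1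
  funext x
  rw [quadProjector_eq]
  ring

theorem pairing_single {ι : Type} (v : ι → ℂ) (i : ι) (c : ℂ) :
    pairing v (Finsupp.single i c) = starRingEnd ℂ (v i) * c := by
  simp [pairing]

theorem pairing_add {ι : Type} (v : ι → ℂ) (w w' : ι →₀ ℂ) :
    pairing v (w + w') = pairing v w + pairing v w' := by
  classical
  exact Finsupp.sum_add_index' (by simp) (by intros; ring)

theorem pairing_smul {ι : Type} (v : ι → ℂ) (c : ℂ) (w : ι →₀ ℂ) :
    pairing v (c • w) = c * pairing v w := by
  rw [pairing, pairing, Finsupp.sum_smul_index' (by simp), Finsupp.mul_sum]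
  refine Finsupp.sum_congr fun i _ => ?_
  rw [smul_eq_mul]; ring

theorem pairing_zero {ι : Type} (v : ι → ℂ) : pairing v 0 = 0 := by simp [pairing]

/-- `|x⟩_φ` is a generalized eigenvector of `X_φ`: on each Fock state this is the three-term recursion
of the oscillator functions. -/
theorem pairing_quadKet_quadrature (φ x : ℝ) (w : ℕ →₀ ℂ) :
    pairing (quadKet φ x) (quadrature φ w) = x * pairing (quadKet φ x) w := by
  induction w using Finsupp.induction_linear with
  | zero => simp [pairing_zero]
  | add f g hf hg => rw [map_add, pairing_add, pairing_add, hf, hg, mul_add]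
  | single n c =>
    have h := two_mul_fockWave n x
    have hc : (2 * x * fockWave n x : ℂ) = (Real.sqrt n : ℝ) * (fockWave (n - 1) x : ℝ) +
      (Real.sqrt (n + 1) : ℝ) * (fockWave (n + 1) x : ℝ) := by exact_mod_cast h
    simp only [quadrature, LinearMap.smul_apply, LinearMap.add_apply, raising_single,
      lowering_single, pairing_smul, pairing_add, pairing_single, quadKet, map_mul,
      Complex.conj_ofReal, ← Complex.exp_conj, Complex.conj_I, map_natCast]
    have e1 : Complex.exp (Complex.I * φ) * Complex.exp (-Complex.I * ((n + 1 : ℕ) * φ)) =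
        Complex.exp (-Complex.I * (n * φ)) := by
      rw [← Complex.exp_add]; congr 1; push_cast; ring
    have e2 : (Real.sqrt n : ℂ) * (Complex.exp (-(Complex.I * φ)) *
        Complex.exp (-Complex.I * ((n - 1 : ℕ) * φ))) =
        (Real.sqrt n : ℂ) * Complex.exp (-Complex.I * (n * φ)) := by
      cases n with
      | zero => simp
      | succ n => congr 1; rw [← Complex.exp_add]; congr 1; push_cast; ring
    linear_combination (c / 2 * (Real.sqrt (n + 1) : ℂ) * fockWave (n + 1) x) * e1 +
      (c / 2 * fockWave (n - 1) x) * e2 - (c / 2 * Complex.exp (-Complex.I * (n * φ))) * hc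

/-! ### Slices of phase space -/

/-- The point `i π κ e^(iφ)` of phase space, with `D(i π κ e^(iφ)) = e^(2 π i κ X_φ)`: the
coordinate `κ` is dual to the quadrature `x` in the normalization of the Fourier transform with
kernel `e^(-2 π i κ x)`. -/
noncomputable def slicePoint (ζ : ℝ × ℝ) : ℂ :=
  Complex.I * Real.pi * (ζ.2 * Complex.exp (Complex.I * ζ.1))

theorem continuous_slicePoint : Continuous slicePoint := by
  unfold slicePoint; fun_prop

theorem norm_slicePoint (ζ : ℝ × ℝ) : ‖slicePoint ζ‖ = Real.pi * |ζ.2| := by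
  rw [slicePoint, norm_mul, norm_mul, norm_mul, Complex.norm_I, Complex.norm_real,
    Complex.norm_real, mul_comm Complex.I, Complex.norm_exp_ofReal_mul_I, Real.norm_eq_abs,
    Real.norm_eq_abs, abs_of_pos Real.pi_pos]
  ring

/-- A measurable left inverse of `slicePoint`, up to a null set. -/
noncomputable def sliceCoord (z : ℂ) : ℝ × ℝ :=
  if 0 ≤ (z / (Complex.I * Real.pi)).arg then
    ((z / (Complex.I * Real.pi)).arg, ‖z / (Complex.I * Real.pi)‖)
  else ((z / (Complex.I * Real.pi)).arg + Real.pi, -‖z / (Complex.I * Real.pi)‖)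

theorem measurable_sliceCoord : Measurable sliceCoord := by
  have h1 : Measurable fun z : ℂ => (z / (Complex.I * Real.pi)).arg :=
    Complex.measurable_arg.comp (measurable_id.div_const _)
  have h2 : Measurable fun z : ℂ => ‖z / (Complex.I * Real.pi)‖ :=
    (measurable_id.div_const _).norm
  exact Measurable.ite (measurableSet_le measurable_const h1) (h1.prodMk h2)
    ((h1.add_const _).prodMk h2.neg)

theorem sliceCoord_slicePoint {ζ : ℝ × ℝ} (h0 : 0 < ζ.1) (h1 : ζ.1 < Real.pi) (h2 : ζ.2 ≠ 0) :
    sliceCoord (slicePoint ζ) = ζ := by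
  have hπ : (Complex.I * Real.pi : ℂ) ≠ 0 :=
    mul_ne_zero Complex.I_ne_zero (Complex.ofReal_ne_zero.2 Real.pi_ne_zero)
  have hdiv : slicePoint ζ / (Complex.I * Real.pi) = ζ.2 * Complex.exp (Complex.I * ζ.1) := by
    rw [slicePoint, mul_div_cancel_left₀ _ hπ]
  have hnorm : ‖(ζ.2 : ℂ) * Complex.exp (Complex.I * ζ.1)‖ = |ζ.2| := by
    rw [norm_mul, mul_comm Complex.I, Complex.norm_exp_ofReal_mul_I, Complex.norm_real,
      Real.norm_eq_abs, mul_one]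
  rw [sliceCoord, hdiv, hnorm]
  rcases lt_or_gt_of_ne h2 with h | h
  · have harg : ((ζ.2 : ℂ) * Complex.exp (Complex.I * ζ.1)).arg = ζ.1 - Real.pi := by
      have := Complex.arg_mul_cos_add_sin_mul_I (r := -ζ.2) (by linarith)
        (θ := ζ.1 - Real.pi) ⟨by linarith, by linarith⟩
      rw [← this]
      congr 1
      rw [← Complex.exp_mul_I]
      push_cast
      rw [sub_mul, Complex.exp_sub, Complex.exp_pi_mul_I, mul_comm Complex.I]
      ring
    rw [harg, if_neg (by linarith), abs_of_neg h]
    ext <;> simp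
  · have harg : ((ζ.2 : ℂ) * Complex.exp (Complex.I * ζ.1)).arg = ζ.1 := by
      have := Complex.arg_mul_cos_add_sin_mul_I (r := ζ.2) h
        (θ := ζ.1) ⟨by linarith, by linarith⟩
      rw [← Complex.exp_mul_I] at this
      rw [mul_comm Complex.I]
      exact this
    rw [harg, if_pos h0.le, abs_of_pos h]

instance : IsFiniteMeasure (ENNReal.ofReal Real.pi⁻¹ • volume.restrict (Set.Ico 0 Real.pi)) :=
  Measure.smul_finite _ ENNReal.ofReal_ne_top

instance : SigmaFinite quorumMeasure := by
  unfold quorumMeasure; infer_instance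

theorem ae_quorumMeasure_fst {s : Set ℝ}
    (h : ∀ᵐ φ : ℝ, φ ∈ Set.Ico 0 Real.pi → φ ∈ s) : ∀ᵐ ζ ∂quorumMeasure, ζ.1 ∈ s := by
  have h1 : ∀ᵐ φ ∂(ENNReal.ofReal Real.pi⁻¹ • volume.restrict (Set.Ico 0 Real.pi)), φ ∈ s :=
    Measure.ae_smul_measure ((ae_restrict_iff' measurableSet_Ico).2 h) _
  exact Measure.quasiMeasurePreserving_fst.ae h1

theorem ae_quorumMeasure_interior : ∀ᵐ ζ ∂quorumMeasure, 0 < ζ.1 ∧ ζ.1 < Real.pi ∧ ζ.2 ≠ 0 := by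
  have h1 : ∀ᵐ ζ ∂quorumMeasure, ζ.1 ∈ Set.Ioo 0 Real.pi := by
    refine ae_quorumMeasure_fst ?_
    have : ∀ᵐ φ : ℝ, φ ≠ 0 := Measure.ae_ne volume 0
    filter_upwards [this] with φ h0 h
    exact ⟨lt_of_le_of_ne h.1 (Ne.symm h0), h.2⟩
  have h2 : ∀ᵐ ζ ∂quorumMeasure, ζ.2 ≠ 0 :=
    Measure.quasiMeasurePreserving_snd.ae (Measure.ae_ne volume 0)
  filter_upwards [h1, h2] with ζ a b
  exact ⟨a.1, a.2, b⟩

theorem ae_sliceCoord_slicePoint : ∀ᵐ ζ ∂quorumMeasure, sliceCoord (slicePoint ζ) = ζ := by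
  filter_upwards [ae_quorumMeasure_interior] with ζ h
  exact sliceCoord_slicePoint h.1 h.2.1 h.2.2

theorem lintegral_quorumMeasure {f : ℝ × ℝ → ENNReal} (hf : Measurable f) :
    ∫⁻ ζ, f ζ ∂quorumMeasure = ENNReal.ofReal Real.pi⁻¹ *
      ∫⁻ φ in Set.Ico 0 Real.pi, ∫⁻ x, f (φ, x) := by
  rw [quorumMeasure, lintegral_prod _ hf.aemeasurable, lintegral_smul_measure, smul_eq_mul]

/-- Polar coordinates with the radius allowed to be negative and the angle in a half-turn. -/
theorem lintegral_halfturn_polar {F : ℂ → ENNReal} (hF : Measurable F) :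
    ∫⁻ φ in Set.Ico 0 Real.pi, ∫⁻ x : ℝ, F (x * Complex.exp (Complex.I * φ)) =
      ∫⁻ z : ℂ, ENNReal.ofReal ‖z‖⁻¹ * F z := by
  set H : ℝ → ENNReal := fun θ => ∫⁻ r in Set.Ioi (0 : ℝ), F (r * Complex.exp (Complex.I * θ))
    with hH
  have hmeas : Measurable fun p : ℝ × ℝ => F (p.2 * Complex.exp (Complex.I * p.1)) :=
    hF.comp (by fun_prop : Continuous fun p : ℝ × ℝ =>
      (p.2 : ℂ) * Complex.exp (Complex.I * p.1)).measurable
  have hHm : Measurable H := hmeas.lintegral_prod_right'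
  have hinner : ∀ φ : ℝ, ∫⁻ x : ℝ, F (x * Complex.exp (Complex.I * φ)) = H φ + H (φ + -Real.pi) := by
    intro φ
    rw [← lintegral_add_compl _ (measurableSet_Ioi (a := (0 : ℝ))), Set.compl_Ioi]
    congr 1
    rw [setLIntegral_congr Iio_ae_eq_Iic.symm]
    have h := (Measure.measurePreserving_neg (volume : Measure ℝ)).setLIntegral_comp_preimage_emb
      (MeasurableEquiv.neg ℝ).measurableEmbedding
      (fun x : ℝ => F (x * Complex.exp (Complex.I * φ))) (Set.Iio 0)
    rw [← h]
    have hpre : Neg.neg ⁻¹' Set.Iio (0 : ℝ) = Set.Ioi 0 := by ext; simp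
    rw [hpre]
    refine lintegral_congr fun r => ?_
    congr 1
    push_cast
    rw [mul_add, Complex.exp_add, mul_neg, Complex.exp_neg, mul_comm Complex.I (Real.pi : ℂ),
      Complex.exp_pi_mul_I]
    norm_num
  have hshift : ∫⁻ φ in Set.Ico 0 Real.pi, H (φ + -Real.pi) = ∫⁻ φ in Set.Ico (-Real.pi) 0, H φ := by
    have h := (measurePreserving_add_right (volume : Measure ℝ) (-Real.pi)).setLIntegral_comp_preimage_emb
      (MeasurableEquiv.addRight (-Real.pi)).measurableEmbedding H (Set.Ico (-Real.pi) 0)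
    rw [← h]
    congr 2
    ext x
    simp [Set.mem_Ico]
  have hright : ∫⁻ z : ℂ, ENNReal.ofReal ‖z‖⁻¹ * F z = ∫⁻ θ in Set.Ioo (-Real.pi) Real.pi, H θ := by
    rw [← Complex.lintegral_comp_polarCoord_symm, polarCoord_target, Measure.volume_eq_prod,
      ← Measure.prod_restrict]
    have hcongr : ∀ᵐ p : ℝ × ℝ ∂((volume.restrict (Set.Ioi (0 : ℝ))).prod
        (volume.restrict (Set.Ioo (-Real.pi) Real.pi))),
        ENNReal.ofReal p.1 • (ENNReal.ofReal ‖Complex.polarCoord.symm p‖⁻¹ *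
          F (Complex.polarCoord.symm p)) = F (p.1 * Complex.exp (Complex.I * p.2)) := by
      have : ∀ᵐ r ∂(volume.restrict (Set.Ioi (0 : ℝ))), r ∈ Set.Ioi (0 : ℝ) :=
        ae_restrict_mem measurableSet_Ioi
      filter_upwards [Measure.quasiMeasurePreserving_fst.ae this] with p hp
      have hp' : 0 < p.1 := hp
      rw [Complex.norm_polarCoord_symm, Complex.polarCoord_symm_apply, smul_eq_mul, ← mul_assoc,
        ← ENNReal.ofReal_mul hp'.le, abs_of_pos hp', mul_inv_cancel₀ hp'.ne', ENNReal.ofReal_one,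
        one_mul, mul_comm Complex.I, Complex.exp_mul_I]
      push_cast
      rfl
    rw [lintegral_congr_ae hcongr]
    rw [lintegral_prod_symm']
    exact hF.comp (by fun_prop : Continuous fun p : ℝ × ℝ =>
      (p.1 : ℂ) * Complex.exp (Complex.I * p.2)).measurable
  rw [hright, setLIntegral_congr Ioo_ae_eq_Ico]
  simp_rw [hinner]
  rw [lintegral_add_left hHm, hshift, add_comm,
    ← lintegral_union measurableSet_Ico (by
      rw [Set.disjoint_left]; intro x h1 h2; exact absurd h1.2 (not_lt.2 h2.1)),
    Set.Ico_union_Ico_eq_Ico (by linarith [Real.pi_pos]) Real.pi_pos.le]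

theorem lintegral_comp_I_mul_pi_mul {F : ℂ → ENNReal} (hF : Measurable F) :
    ∫⁻ z : ℂ, F (Complex.I * Real.pi * z) =
      ENNReal.ofReal (Real.pi ^ 2)⁻¹ * ∫⁻ z : ℂ, F z := by
  have hrot : MeasurePreserving (fun z : ℂ => Complex.I * z) := by
    have h := (rotation (Circle.exp (Real.pi / 2))).measurePreserving
    have he : ((Circle.exp (Real.pi / 2) : Circle) : ℂ) = Complex.I := by
      rw [Circle.coe_exp]; push_cast; exact Complex.exp_pi_div_two_mul_I
    have hfun : (rotation (Circle.exp (Real.pi / 2)) : ℂ → ℂ) = fun z => Complex.I * z := by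
      funext z; rw [rotation_apply, he]
    rwa [hfun] at h
  have h1 := hrot.lintegral_comp hF
  have h2 := Measure.map_addHaar_smul (volume : Measure ℂ) Real.pi_ne_zero
  have h3 : ∫⁻ z : ℂ, F (Complex.I * (Real.pi • z)) =
      ∫⁻ z, F (Complex.I * z) ∂(Measure.map (fun z : ℂ => Real.pi • z) volume) := by
    rw [lintegral_map (f := fun z => F (Complex.I * z))
      (hF.comp (measurable_const.mul measurable_id)) (by fun_prop)]
  rw [h2, lintegral_smul_measure, h1, Complex.finrank_real_complex,
    abs_of_pos (by positivity), smul_eq_mul] at h3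
  rw [← h3]
  refine lintegral_congr fun z => ?_
  rw [Complex.real_smul, mul_assoc]

/-- The change of variables from `(φ, κ)` to phase space: `dφ/π dκ = d²z / (π² |z|)`. -/
theorem map_slicePoint : Measure.map slicePoint quorumMeasure =
    (volume : Measure ℂ).withDensity fun z => ENNReal.ofReal (1 / (Real.pi ^ 2 * ‖z‖)) := by
  have hd : Measurable fun z : ℂ => ENNReal.ofReal (1 / (Real.pi ^ 2 * ‖z‖)) := by fun_prop
  refine Measure.ext_of_lintegral _ fun F hF => ?_
  rw [lintegral_map hF continuous_slicePoint.measurable, lintegral_withDensity_eq_lintegral_mul _ hd hF,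
    lintegral_quorumMeasure (f := fun ζ => F (slicePoint ζ))
      (hF.comp continuous_slicePoint.measurable)]
  have h1 := lintegral_halfturn_polar (F := fun z => F (Complex.I * Real.pi * z))
    (hF.comp (by fun_prop))
  simp only [slicePoint]
  rw [h1]
  have h2 := lintegral_comp_I_mul_pi_mul (F := fun z => ENNReal.ofReal (Real.pi * ‖z‖⁻¹) * F z)
    ((by fun_prop : Measurable fun z : ℂ => ENNReal.ofReal (Real.pi * ‖z‖⁻¹)).mul hF)
  have h3 : ∀ z : ℂ, ENNReal.ofReal ‖z‖⁻¹ = ENNReal.ofReal (Real.pi * ‖Complex.I * Real.pi * z‖⁻¹) := by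
    intro z
    rw [norm_mul, norm_mul, Complex.norm_I, Complex.norm_real, Real.norm_of_nonneg Real.pi_pos.le,
      one_mul, mul_inv, ← mul_assoc, mul_inv_cancel₀ Real.pi_ne_zero, one_mul]
  simp_rw [h3]
  rw [h2, ← mul_assoc, ← ENNReal.ofReal_mul (by positivity), ← lintegral_const_mul]
  · refine lintegral_congr fun z => ?_
    rw [← mul_assoc, ← ENNReal.ofReal_mul (by positivity), Pi.mul_apply]
    congr 2
    field_simp
  · exact (by fun_prop : Measurable fun z : ℂ => ENNReal.ofReal (Real.pi * ‖z‖⁻¹)).mul hF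

theorem integral_comp_slicePoint {f : ℂ → ℂ} (hf : AEStronglyMeasurable f) :
    ∫ ζ, f (slicePoint ζ) ∂quorumMeasure =
      ∫ z : ℂ, ((1 / (Real.pi ^ 2 * ‖z‖) : ℝ) : ℂ) * f z := by
  have hd : Measurable fun z : ℂ => ENNReal.ofReal (1 / (Real.pi ^ 2 * ‖z‖)) := by fun_prop
  have hac : Measure.map slicePoint quorumMeasure ≪ volume := by
    rw [map_slicePoint]; exact withDensity_absolutelyContinuous _ _
  rw [← integral_map continuous_slicePoint.aemeasurable (hf.mono_ac hac), map_slicePoint,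
    integral_withDensity_eq_integral_toReal_smul hd
      (Filter.Eventually.of_forall fun _ => ENNReal.ofReal_lt_top)]
  congr 1
  funext z
  rw [ENNReal.toReal_ofReal (by positivity), Complex.real_smul]

theorem integrable_comp_slicePoint_iff {f : ℂ → ℂ} (hf : AEStronglyMeasurable f) :
    Integrable (fun ζ => f (slicePoint ζ)) quorumMeasure ↔
      Integrable fun z : ℂ => ((1 / (Real.pi ^ 2 * ‖z‖) : ℝ) : ℂ) * f z := by
  have hd : Measurable fun z : ℂ => ENNReal.ofReal (1 / (Real.pi ^ 2 * ‖z‖)) := by fun_prop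
  have hac : Measure.map slicePoint quorumMeasure ≪ volume := by
    rw [map_slicePoint]; exact withDensity_absolutelyContinuous _ _
  have h1 := integrable_map_measure (hf.mono_ac hac) continuous_slicePoint.aemeasurable
  rw [map_slicePoint, integrable_withDensity_iff_integrable_smul' hd
      (Filter.Eventually.of_forall fun _ => ENNReal.ofReal_lt_top)] at h1
  change Integrable (f ∘ slicePoint) quorumMeasure ↔ _
  rw [← h1]
  refine integrable_congr (Filter.Eventually.of_forall fun z => ?_)
  simp only
  rw [ENNReal.toReal_ofReal (by positivity), Complex.real_smul]

/-! ### The normal operator `a - b†` on finite vectors -/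

theorem onModeA_single (L : Module.End ℂ (ℕ →₀ ℂ)) (n m : ℕ) :
    onModeA L (Finsupp.single (n, m) 1) = (L (Finsupp.single n 1)).mapDomain fun n => (n, m) := by
  simp [onModeA]

theorem onModeB_single (L : Module.End ℂ (ℕ →₀ ℂ)) (n m : ℕ) :
    onModeB L (Finsupp.single (n, m) 1) = (L (Finsupp.single m 1)).mapDomain fun m => (n, m) := by
  simp [onModeB]

/-- `a - b†` on finite vectors. -/
noncomputable def modeDiff : Module.End ℂ (ℕ × ℕ →₀ ℂ) := onModeA lowering - onModeB raising

/-- `a† - b`, the formal adjoint of `a - b†`, on finite vectors. -/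
noncomputable def modeDiffAdj : Module.End ℂ (ℕ × ℕ →₀ ℂ) := onModeA raising - onModeB lowering

theorem modeDiff_single (n m : ℕ) : modeDiff (Finsupp.single (n, m) 1) =
    (Real.sqrt n : ℂ) • Finsupp.single (n - 1, m) 1 -
      (Real.sqrt (m + 1) : ℂ) • Finsupp.single (n, m + 1) 1 := by
  rw [modeDiff, LinearMap.sub_apply, onModeA_single, onModeB_single, lowering_single,
    raising_single, Finsupp.mapDomain_smul, Finsupp.mapDomain_smul, Finsupp.mapDomain_single,
    Finsupp.mapDomain_single, one_mul, one_mul]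

theorem modeDiffAdj_single (n m : ℕ) : modeDiffAdj (Finsupp.single (n, m) 1) =
    (Real.sqrt (n + 1) : ℂ) • Finsupp.single (n + 1, m) 1 -
      (Real.sqrt m : ℂ) • Finsupp.single (n, m - 1) 1 := by
  rw [modeDiffAdj, LinearMap.sub_apply, onModeA_single, onModeB_single, lowering_single,
    raising_single, Finsupp.mapDomain_smul, Finsupp.mapDomain_smul, Finsupp.mapDomain_single,
    Finsupp.mapDomain_single, one_mul, one_mul]

theorem finsupp_eq_top_of_single_mem {ι : Type} {P : Submodule ℂ (ι →₀ ℂ)}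
    (h : ∀ i, Finsupp.single i 1 ∈ P) : P = ⊤ := by
  rw [eq_top_iff]
  intro w _
  induction w using Finsupp.induction_linear with
  | zero => exact P.zero_mem
  | add f g hf hg => exact P.add_mem (hf trivial) (hg trivial)
  | single i c => rw [← mul_one c, ← smul_eq_mul, ← Finsupp.smul_single]; exact P.smul_mem _ (h i)

/-- The vacuum is cyclic for `a - b†` and `a† - b`. -/
theorem eq_top_of_modeDiff_stable {P : Submodule ℂ (ℕ × ℕ →₀ ℂ)}
    (h0 : Finsupp.single (0, 0) 1 ∈ P) (h1 : ∀ w ∈ P, modeDiff w ∈ P)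
    (h2 : ∀ w ∈ P, modeDiffAdj w ∈ P) : P = ⊤ := by
  refine finsupp_eq_top_of_single_mem ?_
  rintro ⟨n, m⟩
  induction n generalizing m with
  | zero =>
    induction m with
    | zero => exact h0
    | succ m ih =>
      have h := h1 _ ih
      rw [modeDiff_single] at h
      have h3 := P.smul_mem (-(Real.sqrt (m + 1) : ℂ)⁻¹) h
      simpa [smul_smul, sqrt_succ_ne_zero m] using h3
  | succ n ih =>
    have h := P.add_mem (h2 _ (ih m)) (P.smul_mem (Real.sqrt m : ℂ) (ih (m - 1)))
    rw [modeDiffAdj_single, sub_add_cancel] at h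
    have h3 := P.smul_mem (Real.sqrt (n + 1) : ℂ)⁻¹ h
    rwa [smul_smul, inv_mul_cancel₀ (sqrt_succ_ne_zero n), one_smul] at h3

/-- `a - b†` is formally normal. -/
theorem modeDiff_mul_modeDiffAdj : modeDiff * modeDiffAdj = modeDiffAdj * modeDiff := by
  refine Finsupp.lhom_ext' fun p => LinearMap.ext_ring ?_
  obtain ⟨n, m⟩ := p
  -- opaque names for the basis vectors, so that `module` treats them as atoms
  obtain ⟨E, hE⟩ : ∃ E : ℕ → ℕ → (ℕ × ℕ →₀ ℂ), ∀ n m, Finsupp.single (n, m) 1 = E n m := ⟨_, fun _ _ => rfl⟩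
  have hs : ∀ k : ℕ, (Real.sqrt (k + 1) : ℂ) * (Real.sqrt (k + 1) : ℂ) = k + 1 := sqrt_mul_self_cast
  have e1 : ∀ n m, modeDiff (E n m) = (Real.sqrt n : ℂ) • E (n - 1) m -
      (Real.sqrt (m + 1) : ℂ) • E n (m + 1) := by
    intro n m; simp only [← hE, modeDiff_single]
  have e2 : ∀ n m, modeDiffAdj (E n m) = (Real.sqrt (n + 1) : ℂ) • E (n + 1) m -
      (Real.sqrt m : ℂ) • E n (m - 1) := by
    intro n m; simp only [← hE, modeDiffAdj_single]
  have h1 := hs n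
  have h2 := hs m
  simp only [LinearMap.comp_apply, Finsupp.lsingle_apply, Module.End.mul_apply, hE, e1, e2,
    map_sub, map_smul, Nat.add_sub_cancel, smul_sub, smul_smul]
  cases n with
  | zero =>
    cases m with
    | zero => simp
    | succ m =>
      have h4 := hs m
      push_cast at h2
      simp only [Nat.add_sub_cancel, Nat.cast_add, Nat.cast_one, h2, h4]
      simp
      module
  | succ n =>
    have h3 := hs n
    push_cast at h1
    cases m with
    | zero =>
      simp only [Nat.add_sub_cancel, Nat.cast_add, Nat.cast_one, h1, h3]
      simp
      module
    | succ m =>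
      have h4 := hs m
      push_cast at h2
      simp only [Nat.add_sub_cancel, Nat.cast_add, Nat.cast_one, h1, h2, h3, h4]
      module

/-- `(a† - b)^k |0,0⟩ = √k! |k,0⟩`, because `b` annihilates all the vectors that occur. -/
theorem modeDiffAdj_pow_vacuum (k : ℕ) : (modeDiffAdj ^ k) (Finsupp.single (0, 0) 1) =
    (Real.sqrt k.factorial : ℂ) • Finsupp.single (k, 0) 1 := by
  induction k with
  | zero => simp
  | succ k ih =>
    rw [pow_succ', Module.End.mul_apply, ih, map_smul, modeDiffAdj_single, Nat.factorial_succ,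
      Nat.cast_mul, Real.sqrt_mul (by positivity)]
    simp [mul_comm]

/-! ### Weyl symbols -/

/-- The function `z ↦ ⟨⟨D(z)|w⟩⟩` of a finite vector `w`. -/
noncomputable def weylSymbol (w : ℕ × ℕ →₀ ℂ) (z : ℂ) : ℂ := pairing (displacementKet z) w

theorem weylSymbol_add (w w' : ℕ × ℕ →₀ ℂ) (z : ℂ) :
    weylSymbol (w + w') z = weylSymbol w z + weylSymbol w' z := pairing_add _ _ _

theorem weylSymbol_smul (c : ℂ) (w : ℕ × ℕ →₀ ℂ) (z : ℂ) :
    weylSymbol (c • w) z = c * weylSymbol w z := pairing_smul _ _ _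

theorem weylSymbol_zero (z : ℂ) : weylSymbol 0 z = 0 := pairing_zero _

theorem weylSymbol_sub (w w' : ℕ × ℕ →₀ ℂ) (z : ℂ) :
    weylSymbol (w - w') z = weylSymbol w z - weylSymbol w' z := by
  rw [sub_eq_add_neg, ← neg_one_smul ℂ, weylSymbol_add, weylSymbol_smul]; ring

theorem displacementKet_eq (z : ℂ) (p : ℕ × ℕ) :
    displacementKet z p = expEntry (ladder z (-starRingEnd ℂ z) 0) p.1 p.2 := by
  rw [displacementKet, ladder]
  congr 1
  module

theorem weylSymbol_single (p : ℕ × ℕ) (z : ℂ) :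
    weylSymbol (Finsupp.single p 1) z = starRingEnd ℂ (displacementKet z p) := by
  rw [weylSymbol, pairing_single, mul_one]

/-- The Weyl symbol of the vacuum is the Gaussian `e^(-|z|²/2)`. -/
theorem weylSymbol_vacuum (z : ℂ) :
    weylSymbol (Finsupp.single (0, 0) 1) z = (Real.exp (-‖z‖ ^ 2 / 2) : ℝ) := by
  rw [weylSymbol_single, displacementKet_eq, expEntry_vacuum, mul_neg, Complex.mul_conj,
    Complex.normSq_eq_norm_sq, ← Complex.ofReal_neg, ← Complex.ofReal_ofNat, ← Complex.ofReal_div,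
    ← Complex.ofReal_exp, Complex.conj_ofReal]

/-- Induction over finite vectors by linearity, from the basis vectors. -/
theorem finsupp_induction_single_one {ι : Type} {P : (ι →₀ ℂ) → Prop} (h : ∀ p, P (Finsupp.single p 1))
    (h0 : P 0) (ha : ∀ v w, P v → P w → P (v + w)) (hs : ∀ (c : ℂ) w, P w → P (c • w)) (w) : P w := by
  have : (⟨⟨⟨{w | P w}, fun {a b} => ha a b⟩, h0⟩, fun c {w} => hs c w⟩ :
    Submodule ℂ (ι →₀ ℂ)) = ⊤ := finsupp_eq_top_of_single_mem h
  exact (this ▸ Submodule.mem_top : w ∈ (⟨⟨⟨{w | P w}, fun {a b} => ha a b⟩, h0⟩,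
    fun c {w} => hs c w⟩ : Submodule ℂ (ι →₀ ℂ)))

/-- In the Weyl representation `a - b†` is multiplication by `z`. -/
theorem weylSymbol_modeDiff (w : ℕ × ℕ →₀ ℂ) (z : ℂ) :
    weylSymbol (modeDiff w) z = z * weylSymbol w z := by
  induction w using finsupp_induction_single_one with
  | h p =>
    obtain ⟨n, m⟩ := p
    rw [modeDiff_single, weylSymbol_sub, weylSymbol_smul, weylSymbol_smul]
    simp only [weylSymbol_single, displacementKet_eq]
    have h := congrArg (starRingEnd ℂ) (expEntry_succ_right z (-starRingEnd ℂ z) 0 n m)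
    simp only [map_add, map_mul, map_neg, Complex.conj_ofReal, Complex.conj_conj] at h
    linear_combination -h
  | h0 => simp [weylSymbol_zero]
  | ha v w hv hw => rw [map_add, weylSymbol_add, weylSymbol_add, hv, hw]; ring
  | hs c w hw => rw [map_smul, weylSymbol_smul, weylSymbol_smul, hw]; ring

/-- In the Weyl representation `a† - b` is multiplication by `z̄`. -/
theorem weylSymbol_modeDiffAdj (w : ℕ × ℕ →₀ ℂ) (z : ℂ) :
    weylSymbol (modeDiffAdj w) z = starRingEnd ℂ z * weylSymbol w z := by
  induction w using finsupp_induction_single_one with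
  | h p =>
    obtain ⟨n, m⟩ := p
    rw [modeDiffAdj_single, weylSymbol_sub, weylSymbol_smul, weylSymbol_smul]
    simp only [weylSymbol_single, displacementKet_eq]
    have h := congrArg (starRingEnd ℂ) (expEntry_succ_left z (-starRingEnd ℂ z) 0 n m)
    simp only [map_add, map_mul, Complex.conj_ofReal] at h
    linear_combination h
  | h0 => simp [weylSymbol_zero]
  | ha v w hv hw => rw [map_add, weylSymbol_add, weylSymbol_add, hv, hw]; ring
  | hs c w hw => rw [map_smul, weylSymbol_smul, weylSymbol_smul, hw]; ring

theorem continuous_weylSymbol (w : ℕ × ℕ →₀ ℂ) : Continuous (weylSymbol w) := by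
  let P : Submodule ℂ (ℕ × ℕ →₀ ℂ) :=
    { carrier := {w | Continuous (weylSymbol w)}
      add_mem' := fun {a b} ha hb => by
        change Continuous fun z => weylSymbol (a + b) z
        simp only [weylSymbol_add]
        exact Continuous.add ha hb
      zero_mem' := by
        change Continuous fun z => weylSymbol 0 z
        simp only [weylSymbol_zero]
        exact continuous_const
      smul_mem' := fun c w hw => by
        change Continuous fun z => weylSymbol (c • w) z
        simp only [weylSymbol_smul]
        exact continuous_const.mul hw }
  have hP : P = ⊤ := by
    refine eq_top_of_modeDiff_stable ?_ ?_ ?_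
    · change Continuous fun z => weylSymbol _ z
      simp only [weylSymbol_vacuum]
      fun_prop
    · intro w hw
      change Continuous fun z => weylSymbol _ z
      simp only [weylSymbol_modeDiff]
      exact continuous_id.mul hw
    · intro w hw
      change Continuous fun z => weylSymbol _ z
      simp only [weylSymbol_modeDiffAdj]
      exact Complex.continuous_conj.mul hw
  exact (hP ▸ Submodule.mem_top : w ∈ P)

/-- A Gaussian absorbs polynomial and exponential factors at the price of half its rate. -/
theorem exists_poly_mul_exp_le (N : ℕ) (c : ℝ) : ∃ C : ℝ, 0 ≤ C ∧ ∀ t : ℝ, 0 ≤ t →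
    Real.exp (c * t) * (1 + t) ^ N * Real.exp (-t ^ 2 / 2) ≤ C * Real.exp (-t ^ 2 / 4) := by
  refine ⟨N.factorial * Real.exp (1 + (c + 1) ^ 2), by positivity, fun t ht => ?_⟩
  have h1 : (1 + t) ^ N ≤ N.factorial * Real.exp (1 + t) := by
    have := Real.pow_div_factorial_le_exp (1 + t) (by linarith) N
    rw [div_le_iff₀ (by positivity)] at this
    linarith
  calc Real.exp (c * t) * (1 + t) ^ N * Real.exp (-t ^ 2 / 2)
      ≤ Real.exp (c * t) * (N.factorial * Real.exp (1 + t)) * Real.exp (-t ^ 2 / 2) := by gcongr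
    _ = N.factorial * Real.exp (c * t + (1 + t) + -t ^ 2 / 2) := by
        rw [Real.exp_add (c * t + (1 + t)), Real.exp_add (c * t)]; ring
    _ ≤ N.factorial * Real.exp (1 + (c + 1) ^ 2 + -t ^ 2 / 4) := by
        refine mul_le_mul_of_nonneg_left (Real.exp_le_exp.2 ?_) (by positivity)
        nlinarith [sq_nonneg (t / 2 - (c + 1))]
    _ = _ := by rw [Real.exp_add]; ring

/-- Weyl symbols of finite vectors are dominated by a Gaussian, even after multiplication by a
polynomial. -/
theorem exists_weylSymbol_bound (w : ℕ × ℕ →₀ ℂ) : ∀ N : ℕ, ∃ C : ℝ, 0 ≤ C ∧ ∀ z : ℂ,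
    (1 + ‖z‖) ^ N * ‖weylSymbol w z‖ ≤ C * Real.exp (-‖z‖ ^ 2 / 4) := by
  let P : Submodule ℂ (ℕ × ℕ →₀ ℂ) :=
    { carrier := {w | ∀ N : ℕ, ∃ C : ℝ, 0 ≤ C ∧ ∀ z : ℂ,
        (1 + ‖z‖) ^ N * ‖weylSymbol w z‖ ≤ C * Real.exp (-‖z‖ ^ 2 / 4)}
      add_mem' := fun {a b} ha hb N => by
        obtain ⟨C, hC, h1⟩ := ha N
        obtain ⟨D, hD, h2⟩ := hb N
        refine ⟨C + D, by positivity, fun z => ?_⟩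
        rw [weylSymbol_add]
        calc _ ≤ (1 + ‖z‖) ^ N * (‖weylSymbol a z‖ + ‖weylSymbol b z‖) := by
              gcongr; exact norm_add_le _ _
          _ ≤ _ := by linarith [h1 z, h2 z]
      zero_mem' := fun N => ⟨0, le_rfl, fun z => by simp [weylSymbol_zero]⟩
      smul_mem' := fun c w hw N => by
        obtain ⟨C, hC, h1⟩ := hw N
        refine ⟨‖c‖ * C, by positivity, fun z => ?_⟩
        rw [weylSymbol_smul, norm_mul]
        calc _ = ‖c‖ * ((1 + ‖z‖) ^ N * ‖weylSymbol w z‖) := by ring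
          _ ≤ ‖c‖ * (C * Real.exp (-‖z‖ ^ 2 / 4)) :=
            mul_le_mul_of_nonneg_left (h1 z) (norm_nonneg c)
          _ = _ := by ring }
  have hmul : ∀ w ∈ P, ∀ w' : ℕ × ℕ →₀ ℂ,
      (∀ z, ‖weylSymbol w' z‖ = ‖z‖ * ‖weylSymbol w z‖) → w' ∈ P := by
    intro w hw w' h N
    obtain ⟨C, hC, h1⟩ := hw (N + 1)
    refine ⟨C, hC, fun z => (le_trans ?_ (h1 z))⟩
    rw [h, pow_succ, mul_assoc]
    gcongr
    linarith
  have hP : P = ⊤ := by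
    refine eq_top_of_modeDiff_stable ?_ ?_ ?_
    · intro N
      obtain ⟨C, hC, h⟩ := exists_poly_mul_exp_le N 0
      refine ⟨C, hC, fun z => ?_⟩
      rw [weylSymbol_vacuum, Complex.norm_real, Real.norm_of_nonneg (Real.exp_pos _).le]
      simpa using h ‖z‖ (norm_nonneg _)
    · intro w hw
      exact hmul w hw _ fun z => by rw [weylSymbol_modeDiff, norm_mul]
    · intro w hw
      exact hmul w hw _ fun z => by rw [weylSymbol_modeDiffAdj, norm_mul, RCLike.norm_conj]
  exact (hP ▸ Submodule.mem_top : w ∈ P)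

/-! ### The Weyl transform is isometric -/

theorem integrable_exp_neg_norm_sq {b : ℝ} (hb : 0 < b) :
    Integrable fun z : ℂ => Real.exp (-b * ‖z‖ ^ 2) := by
  have h := GaussianFourier.integrable_cexp_neg_mul_sq_norm_add (V := ℂ) (b := b) (by simpa) 0 0
  refine h.norm.congr (Filter.Eventually.of_forall fun z => ?_)
  simp only [inner_zero_left, Complex.ofReal_zero, mul_zero, add_zero]
  rw [Complex.norm_exp]
  congr 1
  rw [← Complex.ofReal_pow, ← Complex.ofReal_neg, ← Complex.ofReal_mul, Complex.ofReal_re]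

theorem integrable_of_gaussian_bound {f : ℂ → ℂ} (hf : Continuous f) {C : ℝ}
    (h : ∀ z, ‖f z‖ ≤ C * Real.exp (-‖z‖ ^ 2 / 4)) : Integrable f := by
  refine ((integrable_exp_neg_norm_sq (b := 1 / 4) (by norm_num)).const_mul C).mono'
    hf.aestronglyMeasurable (Filter.Eventually.of_forall fun z => (h z).trans_eq ?_)
  ring_nf

theorem integrable_weylSymbol_mul (w w' : ℕ × ℕ →₀ ℂ) :
    Integrable fun z => starRingEnd ℂ (weylSymbol w z) * weylSymbol w' z := by
  obtain ⟨C, hC, h1⟩ := exists_weylSymbol_bound w 0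
  obtain ⟨D, hD, h2⟩ := exists_weylSymbol_bound w' 0
  refine integrable_of_gaussian_bound (C := C * D)
    ((Complex.continuous_conj.comp (continuous_weylSymbol w)).mul (continuous_weylSymbol w'))
    fun z => ?_
  simp only [pow_zero, one_mul] at h1 h2
  rw [norm_mul, RCLike.norm_conj, mul_assoc]
  have h3 : D * Real.exp (-‖z‖ ^ 2 / 4) ≤ D := by
    refine mul_le_of_le_one_right hD (Real.exp_le_one_iff.2 ?_)
    nlinarith [sq_nonneg ‖z‖]
  calc _ ≤ (C * Real.exp (-‖z‖ ^ 2 / 4)) * D := by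
        gcongr
        · exact h1 z
        · exact (h2 z).trans h3
    _ = _ := by ring

theorem integral_norm_pow_mul_exp (k : ℕ) :
    ∫ z : ℂ, ‖z‖ ^ (2 * k) * Real.exp (-‖z‖ ^ 2) = Real.pi * k.factorial := by
  have h := Complex.integral_rpow_mul_exp_neg_rpow (p := 2) (q := 2 * k) (by norm_num)
    (by have : (0 : ℝ) ≤ k := Nat.cast_nonneg k
        linarith)
  have e1 : ((2 * k : ℝ) + 2) / 2 = k + 1 := by ring
  rw [e1, Real.Gamma_nat_eq_factorial] at h
  rw [show Real.pi * (k.factorial : ℝ) = 2 * Real.pi / 2 * k.factorial by ring, ← h]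
  congr 1
  funext z
  have e2 : ((2 * k : ℝ)) = ((2 * k : ℕ) : ℝ) := by push_cast; ring
  rw [e2, Real.rpow_natCast, Real.rpow_two]

/-- The Gaussian moments `∫ z̄^k z^l e^(-|z|²) d²z = π k! δ_kl`; the off-diagonal ones vanish by
rotation invariance. -/
theorem integral_gaussian_moment (k l : ℕ) :
    ∫ z : ℂ, starRingEnd ℂ z ^ k * z ^ l * (Real.exp (-‖z‖ ^ 2) : ℝ) =
      if k = l then (Real.pi * k.factorial : ℂ) else 0 := by
  split_ifs with hkl
  · subst hkl
    rw [← Complex.ofReal_natCast, ← Complex.ofReal_mul, ← integral_norm_pow_mul_exp,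
      ← integral_complex_ofReal]
    congr 1
    funext z
    rw [← mul_pow, mul_comm (starRingEnd ℂ z), Complex.mul_conj, Complex.normSq_eq_norm_sq, pow_mul]
    push_cast
    ring
  · -- rotate by a half-turn divided by `l - k`
    set θ : ℝ := Real.pi / ((l : ℝ) - k) with hθ
    have hlk : (l : ℝ) - k ≠ 0 := by
      rw [sub_ne_zero]; exact_mod_cast Ne.symm hkl
    have hrot := (rotation (Circle.exp θ)).measurePreserving
    have h := hrot.integral_comp (rotation (Circle.exp θ)).toHomeomorph.measurableEmbedding
      (fun z : ℂ => starRingEnd ℂ z ^ k * z ^ l * (Real.exp (-‖z‖ ^ 2) : ℝ))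
    have hphase : starRingEnd ℂ ((Circle.exp θ : Circle) : ℂ) ^ k * ((Circle.exp θ : Circle) : ℂ) ^ l
        = -1 := by
      rw [Circle.coe_exp, ← Complex.exp_conj, ← Complex.exp_nat_mul, ← Complex.exp_nat_mul,
        ← Complex.exp_add, ← Complex.exp_pi_mul_I]
      congr 1
      simp only [map_mul, Complex.conj_ofReal, Complex.conj_I]
      have : (θ : ℂ) * (l - k) = Real.pi := by
        rw [hθ]; push_cast
        have : (l : ℂ) - k ≠ 0 := by exact_mod_cast hlk
        field_simp
      linear_combination Complex.I * this
    have h2 : ∀ z : ℂ, starRingEnd ℂ (rotation (Circle.exp θ) z) ^ k * (rotation (Circle.exp θ) z) ^ l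
        * ((Real.exp (-‖rotation (Circle.exp θ) z‖ ^ 2) : ℝ) : ℂ) =
        -(starRingEnd ℂ z ^ k * z ^ l * (Real.exp (-‖z‖ ^ 2) : ℝ)) := by
      intro z
      rw [LinearIsometryEquiv.norm_map, rotation_apply, map_mul, mul_pow, mul_pow]
      linear_combination (starRingEnd ℂ z ^ k * z ^ l * (Real.exp (-‖z‖ ^ 2) : ℝ)) * hphase
    simp only [h2] at h
    rw [integral_neg] at h
    exact self_eq_neg.1 h.symm

theorem weylSymbol_modeDiffAdj_pow_vacuum (k : ℕ) (z : ℂ) :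
    weylSymbol ((modeDiffAdj ^ k) (Finsupp.single (0, 0) 1)) z =
      starRingEnd ℂ z ^ k * (Real.exp (-‖z‖ ^ 2 / 2) : ℝ) := by
  induction k with
  | zero => simp [weylSymbol_vacuum]
  | succ k ih => rw [pow_succ', Module.End.mul_apply, weylSymbol_modeDiffAdj, ih]; ring

/-- The defect `∫ ŵ* ŵ' d²z - π ⟨w|w'⟩` of the Weyl transform from being isometric. -/
noncomputable def weylDefect (w w' : ℕ × ℕ →₀ ℂ) : ℂ :=
  (∫ z, starRingEnd ℂ (weylSymbol w z) * weylSymbol w' z) - Real.pi * pairing w w'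

theorem weylDefect_add_right (w v v' : ℕ × ℕ →₀ ℂ) :
    weylDefect w (v + v') = weylDefect w v + weylDefect w v' := by
  simp only [weylDefect, weylSymbol_add, mul_add, pairing_add]
  rw [integral_add (integrable_weylSymbol_mul w v) (integrable_weylSymbol_mul w v')]
  ring

theorem weylDefect_smul_right (c : ℂ) (w v : ℕ × ℕ →₀ ℂ) :
    weylDefect w (c • v) = c * weylDefect w v := by
  simp only [weylDefect, weylSymbol_smul, pairing_smul]
  simp_rw [mul_left_comm _ c]
  rw [integral_const_mul]
  ring

theorem pairing_comm (w w' : ℕ × ℕ →₀ ℂ) : pairing w w' = starRingEnd ℂ (pairing w' w) := by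
  classical
  rw [pairing, pairing, Finsupp.sum_of_support_subset (s := w.support ∪ w'.support) _
    Finset.subset_union_right _ (by simp), Finsupp.sum_of_support_subset (s := w.support ∪ w'.support)
    _ Finset.subset_union_left _ (by simp), map_sum]
  refine Finset.sum_congr rfl fun i _ => ?_
  rw [map_mul, Complex.conj_conj, mul_comm]

theorem weylDefect_comm (w w' : ℕ × ℕ →₀ ℂ) :
    weylDefect w w' = starRingEnd ℂ (weylDefect w' w) := by
  simp only [weylDefect, map_sub, map_mul, Complex.conj_ofReal]
  rw [← pairing_comm, ← integral_conj]
  congr 2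
  funext z
  rw [map_mul, Complex.conj_conj, mul_comm]

theorem sqrt_mul_ite (n n' : ℕ) (Q : Prop) [Decidable Q] :
    (Real.sqrt n : ℂ) * (if n - 1 = n' ∧ Q then 1 else 0) =
      (Real.sqrt (n' + 1) : ℂ) * (if n' + 1 = n ∧ Q then 1 else 0) := by
  cases n with
  | zero => simp
  | succ n =>
    by_cases h : n = n'
    · subst h; simp
    · simp [h, Ne.symm h]

/-- `a - b†` and `a† - b` are formally adjoint. -/
theorem pairing_modeDiff (w w' : ℕ × ℕ →₀ ℂ) :
    pairing w (modeDiff w') = pairing (modeDiffAdj w) w' := by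
  induction w' using finsupp_induction_single_one with
  | h p =>
    rw [pairing_comm (modeDiffAdj w), pairing_comm w]
    congr 1
    induction w using finsupp_induction_single_one with
    | h q =>
      obtain ⟨n, m⟩ := p
      obtain ⟨n', m'⟩ := q
      simp only [modeDiff_single, modeDiffAdj_single, pairing_single, sub_eq_add_neg,
        ← neg_smul, pairing_add, pairing_smul, Finsupp.add_apply, Finsupp.smul_apply, smul_eq_mul,
        Finsupp.single_apply, Prod.mk.injEq]
      have h1 := sqrt_mul_ite n n' (m' = m)
      have h2 := sqrt_mul_ite m' m (n' = n)
      simp only [eq_comm, and_comm, map_one, mul_one, Complex.conj_ofReal, map_mul, map_add, map_neg,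
        apply_ite (starRingEnd ℂ), map_zero] at h1 h2 ⊢
      linear_combination h1 + h2
    | h0 => simp [pairing_zero]
    | ha v w hv hw => rw [map_add, pairing_add, pairing_add, hv, hw]
    | hs c w hw => rw [map_smul, pairing_smul, pairing_smul, hw]
  | h0 => simp [pairing_zero]
  | ha v v' hv hw => rw [map_add, pairing_add, pairing_add, hv, hw]
  | hs c v hv => rw [map_smul, pairing_smul, pairing_smul, hv]

theorem weylDefect_modeDiff (w w' : ℕ × ℕ →₀ ℂ) :
    weylDefect w (modeDiff w') = weylDefect (modeDiffAdj w) w' := by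
  simp only [weylDefect, pairing_modeDiff, weylSymbol_modeDiff, weylSymbol_modeDiffAdj]
  congr 2
  funext z
  rw [map_mul, Complex.conj_conj]
  ring

theorem weylDefect_modeDiffAdj (w w' : ℕ × ℕ →₀ ℂ) :
    weylDefect w (modeDiffAdj w') = weylDefect (modeDiff w) w' := by
  rw [weylDefect_comm, ← weylDefect_modeDiff, ← weylDefect_comm]

/-- On the vectors `(a† - b)^k |0,0⟩`, with symbols `z̄^k e^(-|z|²/2)`, isometry is the computation of
the Gaussian moments. -/
theorem weylDefect_vacuum_pow (k l : ℕ) :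
    weylDefect ((modeDiffAdj ^ k) (Finsupp.single (0, 0) 1))
      ((modeDiffAdj ^ l) (Finsupp.single (0, 0) 1)) = 0 := by
  have h1 : ∀ z : ℂ, starRingEnd ℂ (weylSymbol ((modeDiffAdj ^ k) (Finsupp.single (0, 0) 1)) z) *
      weylSymbol ((modeDiffAdj ^ l) (Finsupp.single (0, 0) 1)) z =
      starRingEnd ℂ z ^ l * z ^ k * (Real.exp (-‖z‖ ^ 2) : ℝ) := by
    intro z
    have : Real.exp (-‖z‖ ^ 2) = Real.exp (-‖z‖ ^ 2 / 2) * Real.exp (-‖z‖ ^ 2 / 2) := by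
      rw [← Real.exp_add]; ring_nf
    rw [weylSymbol_modeDiffAdj_pow_vacuum, weylSymbol_modeDiffAdj_pow_vacuum, map_mul, map_pow,
      Complex.conj_conj, Complex.conj_ofReal, this]
    push_cast
    ring
  rw [weylDefect]
  simp_rw [h1]
  rw [integral_gaussian_moment, modeDiffAdj_pow_vacuum, modeDiffAdj_pow_vacuum, pairing_smul,
    pairing_single]
  simp only [Finsupp.smul_apply, smul_eq_mul, map_mul, Complex.conj_ofReal, Finsupp.single_apply,
    Prod.mk.injEq, and_true, mul_one]
  by_cases h : l = k
  · subst h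
    have : ((Real.sqrt l.factorial : ℝ) : ℂ) * (Real.sqrt l.factorial : ℝ) = l.factorial := by
      rw [← Complex.ofReal_mul, Real.mul_self_sqrt (by positivity)]; simp
    simp only [if_true, map_one]
    linear_combination (-(Real.pi : ℂ)) * this
  · simp [h, Ne.symm h]

/-- The Weyl transform is isometric: `∫ ŵ* ŵ' d²z = π ⟨w|w'⟩`.  Both forms make `a - b†` and
`a† - b` mutually adjoint, so it is enough to compare them on the vectors `(a† - b)^k |0,0⟩`. -/
theorem integral_weylSymbol_mul (w w' : ℕ × ℕ →₀ ℂ) :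
    ∫ z, starRingEnd ℂ (weylSymbol w z) * weylSymbol w' z = Real.pi * pairing w w' := by
  -- powers of `a - b†` in the right argument become powers of `a† - b` on the vacuum in the left
  -- one; commutativity then lets `hvac` propagate from the vacuum to all vectors
  have hpow1 : ∀ (i : ℕ) (v v' : ℕ × ℕ →₀ ℂ),
      weylDefect v ((modeDiff ^ i) v') = weylDefect ((modeDiffAdj ^ i) v) v' := by
    intro i
    induction i with
    | zero => simp
    | succ i ih =>
      intro v v'
      rw [pow_succ', Module.End.mul_apply, weylDefect_modeDiff, ih, pow_succ, Module.End.mul_apply]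
  have hcomm : Commute modeDiff modeDiffAdj := modeDiff_mul_modeDiffAdj
  have hvac : ∀ v : ℕ × ℕ →₀ ℂ, ∀ i j : ℕ,
      weylDefect (Finsupp.single (0, 0) 1) ((modeDiff ^ i * modeDiffAdj ^ j) v) = 0 := by
    let P : Submodule ℂ (ℕ × ℕ →₀ ℂ) :=
      { carrier := {v | ∀ i j : ℕ,
          weylDefect (Finsupp.single (0, 0) 1) ((modeDiff ^ i * modeDiffAdj ^ j) v) = 0}
        add_mem' := fun {a b} ha hb i j => by
          rw [map_add, weylDefect_add_right, ha i j, hb i j, add_zero]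
        zero_mem' := fun i j => by
          rw [map_zero]
          have := weylDefect_smul_right 0 (Finsupp.single (0, 0) 1) 0
          simpa using this
        smul_mem' := fun c v hv i j => by
          rw [map_smul, weylDefect_smul_right, hv i j, mul_zero] }
    have hP : P = ⊤ := by
      refine eq_top_of_modeDiff_stable ?_ ?_ ?_
      · intro i j
        rw [Module.End.mul_apply, hpow1]
        exact weylDefect_vacuum_pow i j
      · intro v hv i j
        have h := hv (i + 1) j
        rwa [pow_succ, mul_assoc, (hcomm.pow_right j).eq, ← mul_assoc, Module.End.mul_apply] at h
      · intro v hv i j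
        have h := hv i (j + 1)
        rwa [pow_succ, ← mul_assoc, Module.End.mul_apply] at h
    intro v
    exact (hP ▸ Submodule.mem_top : v ∈ P)
  have hall : ∀ v v' : ℕ × ℕ →₀ ℂ, weylDefect v' v = 0 := by
    intro v
    let P : Submodule ℂ (ℕ × ℕ →₀ ℂ) :=
      { carrier := {u | ∀ v, weylDefect v u = 0}
        add_mem' := fun {a b} ha hb v => by rw [weylDefect_add_right, ha v, hb v, add_zero]
        zero_mem' := fun v => by simpa using weylDefect_smul_right 0 v 0
        smul_mem' := fun c u hu v => by rw [weylDefect_smul_right, hu v, mul_zero] }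
    have hP : P = ⊤ := by
      refine eq_top_of_modeDiff_stable ?_ ?_ ?_
      · intro v
        have := hvac v 0 0
        rw [weylDefect_comm]
        simpa using this
      · intro u hu v
        rw [weylDefect_modeDiff, hu]
      · intro u hu v
        rw [weylDefect_modeDiffAdj, hu]
    exact (hP ▸ Submodule.mem_top : v ∈ P)
  exact sub_eq_zero.1 (hall w' w)

/-! ### Density of the Weyl symbols -/

theorem integrable_exp_neg_mul_norm_slicePoint_sq {b : ℝ} (hb : 0 < b) :
    Integrable (fun ζ => Real.exp (-b * ‖slicePoint ζ‖ ^ 2)) quorumMeasure := by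
  have h1 : Integrable (fun _ : ℝ => (1 : ℝ))
      (ENNReal.ofReal Real.pi⁻¹ • volume.restrict (Set.Ico 0 Real.pi)) := integrable_const _
  have h2 := h1.mul_prod (integrable_exp_neg_mul_sq (b := b * Real.pi ^ 2) (by positivity))
  refine h2.congr (Filter.Eventually.of_forall fun ζ => ?_)
  simp only [norm_slicePoint, one_mul, mul_pow, sq_abs]
  ring_nf

theorem memLp_comp_slicePoint {f : ℂ → ℂ} (hf : Continuous f) {C : ℝ}
    (h : ∀ z, ‖f z‖ ≤ C * Real.exp (-‖z‖ ^ 2 / 4)) :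
    MemLp (fun ζ => f (slicePoint ζ)) 2 quorumMeasure := by
  have hc : Continuous fun ζ => f (slicePoint ζ) := hf.comp continuous_slicePoint
  rw [memLp_two_iff_integrable_sq_norm hc.aestronglyMeasurable]
  refine ((integrable_exp_neg_mul_norm_slicePoint_sq (b := 1 / 2) (by norm_num)).const_mul
    (C ^ 2)).mono' (hc.norm.pow 2).aestronglyMeasurable (Filter.Eventually.of_forall fun ζ => ?_)
  rw [Real.norm_of_nonneg (by positivity)]
  calc ‖f (slicePoint ζ)‖ ^ 2 ≤ (C * Real.exp (-‖slicePoint ζ‖ ^ 2 / 4)) ^ 2 := by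
        gcongr; exact h _
    _ = _ := by rw [mul_pow, ← Real.exp_nat_mul]; congr 2; push_cast; ring

/-- The self-adjoint combination of `a - b†` and `a† - b` that is multiplication by the real inner
product `⟨ξ, z⟩` in the Weyl representation. -/
noncomputable def modeQuadrature (ξ : ℂ) : Module.End ℂ (ℕ × ℕ →₀ ℂ) :=
  (1 / 2 : ℂ) • (starRingEnd ℂ ξ • modeDiff + ξ • modeDiffAdj)

theorem weylSymbol_modeQuadrature (ξ : ℂ) (w : ℕ × ℕ →₀ ℂ) (z : ℂ) :
    weylSymbol (modeQuadrature ξ w) z = ((inner ℝ z ξ : ℝ) : ℂ) * weylSymbol w z := by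
  rw [modeQuadrature, LinearMap.smul_apply, LinearMap.add_apply, LinearMap.smul_apply,
    LinearMap.smul_apply, weylSymbol_smul, weylSymbol_add, weylSymbol_smul, weylSymbol_smul,
    weylSymbol_modeDiff, weylSymbol_modeDiffAdj, Complex.inner, Complex.re_eq_add_conj, map_mul,
    Complex.conj_conj]
  ring

theorem weylSymbol_modeQuadrature_pow (ξ : ℂ) (k : ℕ) (z : ℂ) :
    weylSymbol ((modeQuadrature ξ ^ k) (Finsupp.single (0, 0) 1)) z =
      ((inner ℝ z ξ : ℝ) : ℂ) ^ k * (Real.exp (-‖z‖ ^ 2 / 2) : ℝ) := by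
  induction k with
  | zero => simp [weylSymbol_vacuum]
  | succ k ih =>
    rw [pow_succ', Module.End.mul_apply]
    rw [weylSymbol_modeQuadrature, ih]
    ring

/-- A function on `[0,π) × ℝ` whose product with a Gaussian has all exponential moments has
vanishing characteristic function if it is orthogonal to all Weyl symbols of finite vectors. -/
theorem integral_character_eq_zero {r : ℝ × ℝ → ℂ}
    (hint : ∀ c : ℝ, Integrable (fun ζ => Real.exp (c * ‖slicePoint ζ‖) *
      ‖(Real.exp (-‖slicePoint ζ‖ ^ 2 / 2) : ℂ) * r ζ‖) quorumMeasure)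
    (hr : AEStronglyMeasurable r quorumMeasure)
    (h : ∀ w, ∫ ζ, starRingEnd ℂ (weylSymbol w (slicePoint ζ)) * r ζ ∂quorumMeasure = 0) (ξ : ℂ) :
    ∫ ζ, Complex.exp (((2 * Real.pi * inner ℝ (slicePoint ζ) ξ : ℝ) : ℂ) * Complex.I) *
      ((Real.exp (-‖slicePoint ζ‖ ^ 2 / 2) : ℂ) * r ζ) ∂quorumMeasure = 0 := by
  set R : ℝ × ℝ → ℂ := fun ζ => (Real.exp (-‖slicePoint ζ‖ ^ 2 / 2) : ℂ) * r ζ with hR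
  have hRm : AEStronglyMeasurable R quorumMeasure := by
    refine AEStronglyMeasurable.mul ?_ hr
    have := continuous_slicePoint
    exact (by fun_prop : Continuous fun ζ : ℝ × ℝ =>
      (Real.exp (-‖slicePoint ζ‖ ^ 2 / 2) : ℂ)).aestronglyMeasurable
  set t : ℝ × ℝ → ℂ := fun ζ => ((2 * Real.pi * inner ℝ (slicePoint ζ) ξ : ℝ) : ℂ) * Complex.I with ht
  have htc : Continuous t := by
    have := continuous_slicePoint
    rw [ht]; fun_prop
  have htn : ∀ ζ, ‖t ζ‖ ≤ 2 * Real.pi * ‖ξ‖ * ‖slicePoint ζ‖ := by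
    intro ζ
    rw [ht]
    simp only
    rw [norm_mul, Complex.norm_I, mul_one, Complex.norm_real, norm_mul,
      Real.norm_of_nonneg (by positivity : (0 : ℝ) ≤ 2 * Real.pi), mul_assoc (2 * Real.pi),
      mul_comm ‖ξ‖]
    exact mul_le_mul_of_nonneg_left (norm_inner_le_norm (𝕜 := ℝ) (slicePoint ζ) ξ)
      (by positivity : (0 : ℝ) ≤ 2 * Real.pi)
  -- expand the character in powers of `⟨z, ξ⟩`: each term pairs `r` with the Weyl symbol of a power
  -- of `modeQuadrature ξ` on the vacuum
  have hsum := hasSum_integral_of_dominated_convergence (μ := quorumMeasure)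
    (F := fun (k : ℕ) ζ => t ζ ^ k / (k.factorial : ℂ) * R ζ)
    (f := fun ζ => Complex.exp (t ζ) * R ζ)
    (fun (k : ℕ) ζ => (2 * Real.pi * ‖ξ‖ * ‖slicePoint ζ‖) ^ k / (k.factorial : ℝ) * ‖R ζ‖)
    (fun k => ((htc.pow k).div_const _).aestronglyMeasurable.mul hRm)
    (fun k => Filter.Eventually.of_forall fun ζ => by
      rw [norm_mul, norm_div, norm_pow, Complex.norm_natCast]
      gcongr
      exact htn ζ)
    (Filter.Eventually.of_forall fun ζ => (Real.summable_pow_div_factorial _).mul_right _)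
    (by
      refine (hint (2 * Real.pi * ‖ξ‖)).congr (Filter.Eventually.of_forall fun ζ => ?_)
      simp only
      have hexp : ∀ x : ℝ, ∑' k : ℕ, x ^ k / (k.factorial : ℝ) = Real.exp x := fun x => by
        rw [Real.exp_eq_exp_ℝ, NormedSpace.exp_eq_tsum_div]
      rw [tsum_mul_right, hexp])
    (Filter.Eventually.of_forall fun ζ => by
      have := NormedSpace.expSeries_div_hasSum_exp (𝔸 := ℂ) (t ζ)
      rw [← Complex.exp_eq_exp_ℂ] at this
      exact this.mul_right _)
  have hzero : ∀ k : ℕ, ∫ ζ, t ζ ^ k / (k.factorial : ℂ) * R ζ ∂quorumMeasure = 0 := by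
    intro k
    have hk := h ((modeQuadrature ξ ^ k) (Finsupp.single (0, 0) 1))
    simp only [weylSymbol_modeQuadrature_pow, map_mul, map_pow, Complex.conj_ofReal] at hk
    have : ∀ ζ, t ζ ^ k / (k.factorial : ℂ) * R ζ = ((2 * Real.pi * Complex.I) ^ k / k.factorial) *
        (((inner ℝ (slicePoint ζ) ξ : ℝ) : ℂ) ^ k * (Real.exp (-‖slicePoint ζ‖ ^ 2 / 2) : ℝ) * r ζ) := by
      intro ζ
      rw [ht, hR]
      simp only
      push_cast
      ring
    simp_rw [this]
    rw [integral_const_mul, hk, mul_zero]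
  simp only [hzero] at hsum
  exact hsum.unique hasSum_zero

/-- A complex density on `[0,π) × ℝ` whose push-forward to phase space has vanishing
characteristic function is zero: by Fourier inversion it annihilates all test functions of the
point of phase space. -/
theorem ae_eq_zero_of_integral_character {R : ℝ × ℝ → ℂ} (hR : Integrable R quorumMeasure)
    (h : ∀ ξ : ℂ, ∫ ζ, Complex.exp (((2 * Real.pi * inner ℝ (slicePoint ζ) ξ : ℝ) : ℂ) * Complex.I) *
      R ζ ∂quorumMeasure = 0) : R =ᵐ[quorumMeasure] 0 := by
  have htest : ∀ g : ℂ → ℝ, ContDiff ℝ ∞ g → HasCompactSupport g →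
      ∫ ζ, (g (slicePoint ζ) : ℂ) * R ζ ∂quorumMeasure = 0 := by
    intro g hg hgc
    have hg1 : ContDiff ℝ ∞ fun z => (g z : ℂ) := Complex.ofRealCLM.contDiff.comp hg
    have hg2 : HasCompactSupport fun z => (g z : ℂ) := hgc.comp_left Complex.ofReal_zero
    set f : SchwartzMap ℂ ℂ := hg2.toSchwartzMap hg1 with hf
    have hfz : ∀ z, (g z : ℂ) =
        ∫ ξ : ℂ, Complex.exp (((2 * Real.pi * inner ℝ z ξ : ℝ) : ℂ) * Complex.I) *
          FourierTransform.fourier f ξ := by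
      intro z
      have h1 : f z = FourierTransformInv.fourierInv (FourierTransform.fourier f) z := by simp
      have h2 : f z = g z := rfl
      rw [← h2, h1, SchwartzMap.fourierInv_coe, Real.fourierInv_eq']
      congr 1
      funext ξ
      rw [smul_eq_mul, real_inner_comm]
    simp_rw [hfz]
    simp_rw [← integral_mul_const]
    rw [integral_integral_swap]
    · have : ∀ ξ : ℂ, ∫ ζ, Complex.exp (((2 * Real.pi * inner ℝ (slicePoint ζ) ξ : ℝ) : ℂ) * Complex.I) *
          FourierTransform.fourier f ξ * R ζ ∂quorumMeasure = 0 := by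
        intro ξ
        rw [← mul_zero (FourierTransform.fourier f ξ), ← h ξ, ← integral_const_mul]
        congr 1
        funext ζ
        ring
      simp_rw [this]
      simp
    · have h1 : Integrable (fun p : (ℝ × ℝ) × ℂ => R p.1 * FourierTransform.fourier f p.2)
          (quorumMeasure.prod volume) := hR.mul_prod (FourierTransform.fourier f).integrable
      have hc : Continuous fun p : (ℝ × ℝ) × ℂ =>
          Complex.exp (((2 * Real.pi * inner ℝ (slicePoint p.1) p.2 : ℝ) : ℂ) * Complex.I) := by
        have := continuous_slicePoint
        fun_prop
      have h2 := h1.bdd_mul (c := 1) hc.aestronglyMeasurable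
        (Filter.Eventually.of_forall fun p => (Complex.norm_exp_ofReal_mul_I _).le)
      refine h2.congr (Filter.Eventually.of_forall fun p => ?_)
      simp only [Function.uncurry]
      ring
  -- the slices cover phase space once up to null sets, so `R` is a function of the point of phase space
  obtain ⟨R₀, hR₀m, hR₀⟩ := hR.aestronglyMeasurable
  have hcomp : (fun ζ => R₀ (sliceCoord (slicePoint ζ))) =ᵐ[quorumMeasure] R := by
    filter_upwards [ae_sliceCoord_slicePoint, hR₀] with ζ h1 h2
    rw [h1, h2]
  have hmeas : AEStronglyMeasurable (fun z => R₀ (sliceCoord z)) (Measure.map slicePoint quorumMeasure) :=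
    (hR₀m.comp_measurable measurable_sliceCoord).aestronglyMeasurable
  have hint : Integrable (fun z => R₀ (sliceCoord z)) (Measure.map slicePoint quorumMeasure) := by
    rw [integrable_map_measure hmeas continuous_slicePoint.aemeasurable]
    exact hR.congr hcomp.symm
  have hzero := ae_eq_zero_of_integral_contDiff_smul_eq_zero hint.locallyIntegrable (by
    intro g hg hgc
    have hgm : AEStronglyMeasurable (fun z => g z • R₀ (sliceCoord z))
        (Measure.map slicePoint quorumMeasure) := hg.continuous.aestronglyMeasurable.smul hmeas
    rw [integral_map continuous_slicePoint.aemeasurable hgm, ← htest g hg hgc]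
    apply integral_congr_ae
    filter_upwards [hcomp] with ζ hζ
    rw [hζ, Complex.real_smul])
  have h3 := ae_of_ae_map continuous_slicePoint.aemeasurable hzero
  filter_upwards [h3, hcomp] with ζ h1 h2
  rw [← h2, h1, Pi.zero_apply]

/-- Density of the Weyl symbols of finite vectors, that is of polynomials in `z` and `z̄` times a
Gaussian, in weighted `L²`, stated by duality for weights of polynomial growth: the moment problem
for densities with Gaussian decay is determinate. -/
theorem ae_eq_zero_of_integral_weylSymbol {r : ℝ × ℝ → ℂ} {N : ℕ}
    (hr : AEStronglyMeasurable r quorumMeasure)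
    (hr2 : MemLp (fun ζ => (((1 + ‖slicePoint ζ‖) ^ N)⁻¹ : ℝ) * ‖r ζ‖) 2 quorumMeasure)
    (h : ∀ w, ∫ ζ, starRingEnd ℂ (weylSymbol w (slicePoint ζ)) * r ζ ∂quorumMeasure = 0) :
    r =ᵐ[quorumMeasure] 0 := by
  have hcs := continuous_slicePoint
  have hint : ∀ c : ℝ, Integrable (fun ζ => Real.exp (c * ‖slicePoint ζ‖) *
      ‖(Real.exp (-‖slicePoint ζ‖ ^ 2 / 2) : ℂ) * r ζ‖) quorumMeasure := by
    intro c
    obtain ⟨C, hC, hb⟩ := exists_poly_mul_exp_le N c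
    have hG := memLp_comp_slicePoint (C := 1) (f := fun z => (Real.exp (-‖z‖ ^ 2 / 4) : ℂ))
      (by fun_prop) (fun z => by
        rw [one_mul, Complex.norm_real, Real.norm_of_nonneg (Real.exp_pos _).le])
    have hprod := (hG.norm.integrable_mul hr2).const_mul C
    refine hprod.mono' ?_ (Filter.Eventually.of_forall fun ζ => ?_)
    · refine AEStronglyMeasurable.mul ?_ ((AEStronglyMeasurable.mul (f := fun ζ =>
        (Real.exp (-‖slicePoint ζ‖ ^ 2 / 2) : ℂ)) ?_ hr).norm)
      · exact (by fun_prop : Continuous fun ζ : ℝ × ℝ =>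
          Real.exp (c * ‖slicePoint ζ‖)).aestronglyMeasurable
      · exact (by fun_prop : Continuous fun ζ : ℝ × ℝ =>
          (Real.exp (-‖slicePoint ζ‖ ^ 2 / 2) : ℂ)).aestronglyMeasurable
    · have hpos : 0 < (1 + ‖slicePoint ζ‖) ^ N := by positivity
      rw [Pi.mul_apply, Real.norm_of_nonneg (by positivity), norm_mul, Complex.norm_real,
        Complex.norm_real, Real.norm_of_nonneg (Real.exp_pos _).le,
        Real.norm_of_nonneg (Real.exp_pos _).le]
      calc _ = (Real.exp (c * ‖slicePoint ζ‖) * (1 + ‖slicePoint ζ‖) ^ N *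
            Real.exp (-‖slicePoint ζ‖ ^ 2 / 2)) * (((1 + ‖slicePoint ζ‖) ^ N)⁻¹ * ‖r ζ‖) := by
            field_simp
        _ ≤ (C * Real.exp (-‖slicePoint ζ‖ ^ 2 / 4)) * (((1 + ‖slicePoint ζ‖) ^ N)⁻¹ * ‖r ζ‖) := by
            exact mul_le_mul_of_nonneg_right (hb _ (norm_nonneg _)) (by positivity)
        _ = _ := by ring
  have hR : Integrable (fun ζ => (Real.exp (-‖slicePoint ζ‖ ^ 2 / 2) : ℂ) * r ζ) quorumMeasure := by
    have h0 := hint 0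
    simp only [zero_mul, Real.exp_zero, one_mul] at h0
    have hm : AEStronglyMeasurable (fun ζ => (Real.exp (-‖slicePoint ζ‖ ^ 2 / 2) : ℂ) * r ζ)
        quorumMeasure := AEStronglyMeasurable.mul (by fun_prop : Continuous fun ζ : ℝ × ℝ =>
      (Real.exp (-‖slicePoint ζ‖ ^ 2 / 2) : ℂ)).aestronglyMeasurable hr
    exact (integrable_norm_iff hm).1 h0
  have hzero := ae_eq_zero_of_integral_character hR (integral_character_eq_zero hint hr h)
  filter_upwards [hzero] with ζ hζ
  rw [Pi.zero_apply, mul_eq_zero] at hζ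
  exact hζ.resolve_left (Complex.ofReal_ne_zero.2 (Real.exp_pos _).ne')

/-! ### The Weyl representation of the doubled space -/

theorem mem_graph_coreOp {ι : Type} [DecidableEq ι] {F : Type*} [AddCommGroup F] [Module ℂ F]
    (L : (ι →₀ ℂ) →ₗ[ℂ] F) (x : Ell2 ι) (y : F) :
    (x, y) ∈ (coreOp L).graph ↔ ∃ w, toEll2 w = x ∧ L w = y := by
  rw [LinearPMap.mem_graph_iff]
  constructor
  · rintro ⟨⟨_, w, rfl⟩, h1, h2⟩
    refine ⟨w, h1, Eq.trans ?_ h2⟩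
    change L w = L ((LinearEquiv.ofInjective toEll2 toEll2_injective).symm ⟨toEll2 w, _⟩)
    congr 1
    exact ((LinearEquiv.symm_apply_eq _).2 rfl).symm
  · rintro ⟨w, rfl, rfl⟩
    refine ⟨⟨toEll2 w, w, rfl⟩, rfl, ?_⟩
    change L ((LinearEquiv.ofInjective toEll2 toEll2_injective).symm ⟨toEll2 w, _⟩) = L w
    congr 1
    exact (LinearEquiv.symm_apply_eq _).2 rfl

theorem ae_slicePoint_ne_zero : ∀ᵐ ζ ∂quorumMeasure, slicePoint ζ ≠ 0 := by
  filter_upwards [ae_quorumMeasure_interior] with ζ h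
  rw [← norm_ne_zero_iff, norm_slicePoint]
  exact mul_ne_zero Real.pi_ne_zero (abs_ne_zero.2 h.2.2)

/-- The square root `√(π|z|)` of the density of `d²z / π` with respect to the measure `dφ/π dκ` of
the slices. -/
noncomputable def weylWeight (ζ : ℝ × ℝ) : ℝ := Real.sqrt (Real.pi * ‖slicePoint ζ‖)

theorem weylWeight_nonneg (ζ : ℝ × ℝ) : 0 ≤ weylWeight ζ := Real.sqrt_nonneg _

theorem weylWeight_mul_self (ζ : ℝ × ℝ) : weylWeight ζ * weylWeight ζ = Real.pi * ‖slicePoint ζ‖ :=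
  Real.mul_self_sqrt (by positivity)

theorem weylWeight_pos {ζ : ℝ × ℝ} (h : slicePoint ζ ≠ 0) : 0 < weylWeight ζ :=
  Real.sqrt_pos.2 (mul_pos Real.pi_pos (norm_pos_iff.2 h))

theorem continuous_weylWeight : Continuous weylWeight := by
  have := continuous_slicePoint
  unfold weylWeight
  fun_prop

theorem sqrt_pi_mul_le {t : ℝ} (ht : 0 ≤ t) : Real.sqrt (Real.pi * t) ≤ Real.pi * (1 + t) := by
  have hπ := Real.pi_gt_three
  rw [Real.sqrt_le_left (by positivity)]
  nlinarith [mul_nonneg ht ht, mul_pos Real.pi_pos Real.pi_pos]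

theorem memLp_mul_weylSymbol (w : ℕ × ℕ →₀ ℂ) {g : ℂ → ℂ} (hg : Continuous g) {D : ℝ} {N : ℕ}
    (hD : 0 ≤ D) (h : ∀ z, ‖g z‖ ≤ D * (1 + ‖z‖) ^ N) :
    MemLp (fun ζ => g (slicePoint ζ) * weylSymbol w (slicePoint ζ)) 2 quorumMeasure := by
  obtain ⟨C, hC, hb⟩ := exists_weylSymbol_bound w N
  refine memLp_comp_slicePoint (f := fun z => g z * weylSymbol w z) (C := D * C)
    (hg.mul (continuous_weylSymbol w)) fun z => ?_
  calc ‖g z * weylSymbol w z‖ ≤ D * (1 + ‖z‖) ^ N * ‖weylSymbol w z‖ := by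
        rw [norm_mul]
        exact mul_le_mul_of_nonneg_right (h z) (norm_nonneg _)
    _ = D * ((1 + ‖z‖) ^ N * ‖weylSymbol w z‖) := by ring
    _ ≤ D * (C * Real.exp (-‖z‖ ^ 2 / 4)) := mul_le_mul_of_nonneg_left (hb z) hD
    _ = _ := by ring

theorem memLp_weylWeight_mul (w : ℕ × ℕ →₀ ℂ) :
    MemLp (fun ζ => (weylWeight ζ : ℂ) * weylSymbol w (slicePoint ζ)) 2 quorumMeasure :=
  memLp_mul_weylSymbol w (g := fun z => (Real.sqrt (Real.pi * ‖z‖) : ℂ)) (D := Real.pi) (N := 1)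
    (by fun_prop) Real.pi_pos.le fun z => by
      rw [Complex.norm_real, Real.norm_of_nonneg (Real.sqrt_nonneg _), pow_one]
      exact sqrt_pi_mul_le (norm_nonneg z)

/-- The Weyl transform `w ↦ √(π|z|) ŵ(z)` of finite vectors, in the coordinates of the slices; the
factor makes it isometric for the measure `dφ/π dκ`. -/
noncomputable def weylVector : (ℕ × ℕ →₀ ℂ) →ₗ[ℂ] QuorumL2 where
  toFun w := (memLp_weylWeight_mul w).toLp
  map_add' w w' := by
    rw [← MemLp.toLp_add]
    refine MemLp.toLp_congr _ _ (Filter.Eventually.of_forall fun ζ => ?_)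
    simp only [Pi.add_apply, weylSymbol_add, mul_add]
  map_smul' c w := by
    rw [RingHom.id_apply, ← MemLp.toLp_const_smul]
    refine MemLp.toLp_congr _ _ (Filter.Eventually.of_forall fun ζ => ?_)
    simp only [Pi.smul_apply, weylSymbol_smul, smul_eq_mul]
    ring

theorem weylVector_ae (w : ℕ × ℕ →₀ ℂ) :
    (weylVector w : ℝ × ℝ → ℂ) =ᵐ[quorumMeasure]
      fun ζ => (weylWeight ζ : ℂ) * weylSymbol w (slicePoint ζ) :=
  (memLp_weylWeight_mul w).coeFn_toLp

theorem inner_weylVector (w w' : ℕ × ℕ →₀ ℂ) :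
    inner ℂ (weylVector w) (weylVector w') = pairing w w' := by
  have hπ : (Real.pi : ℂ) ≠ 0 := Complex.ofReal_ne_zero.2 Real.pi_ne_zero
  have h1 : inner ℂ (weylVector w) (weylVector w') = ∫ ζ,
      (fun z : ℂ => ((Real.pi * ‖z‖ : ℝ) : ℂ) * (starRingEnd ℂ (weylSymbol w z) * weylSymbol w' z))
        (slicePoint ζ) ∂quorumMeasure := by
    rw [L2.inner_def]
    refine integral_congr_ae ?_
    filter_upwards [weylVector_ae w, weylVector_ae w'] with ζ a b
    rw [a, b, RCLike.inner_apply, map_mul, Complex.conj_ofReal, ← weylWeight_mul_self]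
    push_cast
    ring
  have hc : Continuous fun z : ℂ =>
      ((Real.pi * ‖z‖ : ℝ) : ℂ) * (starRingEnd ℂ (weylSymbol w z) * weylSymbol w' z) := by
    have a := continuous_weylSymbol w
    have b := continuous_weylSymbol w'
    exact Continuous.mul (by fun_prop) ((Complex.continuous_conj.comp a).mul b)
  rw [h1, integral_comp_slicePoint hc.aestronglyMeasurable,
    ← mul_right_inj' hπ, ← integral_weylSymbol_mul, ← integral_const_mul]
  refine integral_congr_ae ?_
  have h0 : ∀ᵐ z : ℂ, z ≠ 0 := Measure.ae_ne volume 0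
  filter_upwards [h0] with z hz
  have hz' : (‖z‖ : ℂ) ≠ 0 := Complex.ofReal_ne_zero.2 (norm_ne_zero_iff.2 hz)
  push_cast
  field_simp

theorem orthonormal_weylVector :
    Orthonormal ℂ fun p : ℕ × ℕ => weylVector (Finsupp.single p 1) := by
  rw [orthonormal_iff_ite]
  intro p q
  rw [inner_weylVector, pairing_single, Finsupp.single_apply]
  split_ifs <;> simp_all

/-- Weighted density of the Weyl symbols: a pair of square-integrable functions is annihilated by
`√(π|z|) ŵ(z) (1, m)` for all finite `w` only if its combination vanishes. -/
theorem add_conj_mul_eq_zero_of_integral {m : ℝ × ℝ → ℂ} (hm : Measurable m) {D : ℝ} {N : ℕ}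
    (hD : 0 ≤ D) (hb : ∀ ζ, weylWeight ζ * ‖m ζ‖ ≤ D * (1 + ‖slicePoint ζ‖) ^ N) (v v' : QuorumL2)
    (h : ∀ w, ∫ ζ, starRingEnd ℂ (weylVector w ζ) * (v ζ + starRingEnd ℂ (m ζ) * v' ζ)
      ∂quorumMeasure = 0) :
    (fun ζ => v ζ + starRingEnd ℂ (m ζ) * v' ζ) =ᵐ[quorumMeasure] 0 := by
  have hmc : Measurable fun ζ => starRingEnd ℂ (m ζ) := Complex.continuous_conj.measurable.comp hm
  have hrm : AEStronglyMeasurable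
      (fun ζ => (weylWeight ζ : ℂ) * (v ζ + starRingEnd ℂ (m ζ) * v' ζ)) quorumMeasure :=
    (Complex.continuous_ofReal.comp continuous_weylWeight).aestronglyMeasurable.mul
      ((Lp.aestronglyMeasurable v).add
        (hmc.aestronglyMeasurable.mul (Lp.aestronglyMeasurable v')))
  have hcs := continuous_slicePoint
  have hr := ae_eq_zero_of_integral_weylSymbol (N := N + 1) hrm (by
    refine MemLp.mono (g := fun ζ => Real.pi * ‖v ζ‖ + D * ‖v' ζ‖)
      (((Lp.memLp v).norm.const_mul _).add ((Lp.memLp v').norm.const_mul _)) ?_ ?_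
    · refine AEStronglyMeasurable.mul ?_ hrm.norm
      exact (by
        refine Continuous.inv₀ (by fun_prop) fun ζ => ?_
        positivity : Continuous fun ζ : ℝ × ℝ =>
          ((1 + ‖slicePoint ζ‖) ^ (N + 1))⁻¹).aestronglyMeasurable
    · refine Filter.Eventually.of_forall fun ζ => ?_
      have hπ := Real.pi_pos
      have h1 : 1 ≤ 1 + ‖slicePoint ζ‖ := by linarith [norm_nonneg (slicePoint ζ)]
      have hp : 0 < (1 + ‖slicePoint ζ‖) ^ (N + 1) := by positivity
      have hw : weylWeight ζ ≤ Real.pi * (1 + ‖slicePoint ζ‖) ^ (N + 1) :=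
        (sqrt_pi_mul_le (norm_nonneg _)).trans
          (mul_le_mul_of_nonneg_left (le_self_pow₀ h1 (Nat.succ_ne_zero N)) hπ.le)
      have hw' : weylWeight ζ * ‖m ζ‖ ≤ D * (1 + ‖slicePoint ζ‖) ^ (N + 1) :=
        (hb ζ).trans (mul_le_mul_of_nonneg_left (pow_le_pow_right₀ h1 (Nat.le_succ N)) hD)
      rw [Real.norm_of_nonneg (by positivity), Real.norm_of_nonneg (by positivity),
        inv_mul_le_iff₀ hp, norm_mul, Complex.norm_real, Real.norm_of_nonneg (weylWeight_nonneg ζ)]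
      calc weylWeight ζ * ‖v ζ + starRingEnd ℂ (m ζ) * v' ζ‖
          ≤ weylWeight ζ * (‖v ζ‖ + ‖m ζ‖ * ‖v' ζ‖) := by
            refine mul_le_mul_of_nonneg_left ((norm_add_le _ _).trans_eq ?_) (weylWeight_nonneg ζ)
            rw [norm_mul, RCLike.norm_conj]
        _ = weylWeight ζ * ‖v ζ‖ + (weylWeight ζ * ‖m ζ‖) * ‖v' ζ‖ := by ring
        _ ≤ Real.pi * (1 + ‖slicePoint ζ‖) ^ (N + 1) * ‖v ζ‖ +
            (D * (1 + ‖slicePoint ζ‖) ^ (N + 1)) * ‖v' ζ‖ :=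
          add_le_add (mul_le_mul_of_nonneg_right hw (norm_nonneg _))
            (mul_le_mul_of_nonneg_right hw' (norm_nonneg _))
        _ = _ := by ring)
    (by
      intro w
      rw [← h w]
      refine integral_congr_ae ?_
      filter_upwards [weylVector_ae w] with ζ a
      rw [a, map_mul, Complex.conj_ofReal]
      ring)
  filter_upwards [hr, ae_slicePoint_ne_zero] with ζ h1 h2
  rw [Pi.zero_apply, mul_eq_zero] at h1
  exact h1.resolve_left (Complex.ofReal_ne_zero.2 (weylWeight_pos h2).ne')

/-- The Weyl symbols of the matrix units form an orthonormal basis of `L²` of phase space. -/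
noncomputable def weylBasis : HilbertBasis (ℕ × ℕ) ℂ QuorumL2 :=
  HilbertBasis.mkOfOrthogonalEqBot orthonormal_weylVector (by
    rw [Submodule.eq_bot_iff]
    intro u hu
    rw [Submodule.mem_orthogonal] at hu
    have h0 : ∀ w, inner ℂ (weylVector w) u = 0 := by
      intro w
      refine hu _ ?_
      induction w using Finsupp.induction_linear with
      | zero => simp
      | add a b ha hb => rw [map_add]; exact Submodule.add_mem _ ha hb
      | single p c =>
        rw [← mul_one c, ← smul_eq_mul, ← Finsupp.smul_single, map_smul]
        exact Submodule.smul_mem _ _ (Submodule.subset_span ⟨p, rfl⟩)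
    have h1 := add_conj_mul_eq_zero_of_integral (m := 0) (D := 0) (N := 0) measurable_zero le_rfl
      (by simp) u 0 (by
        intro w
        rw [← h0 w, L2.inner_def]
        refine integral_congr_ae (Filter.Eventually.of_forall fun ζ => ?_)
        simp only [Pi.zero_apply, map_zero, zero_mul, add_zero, RCLike.inner_apply]
        ring)
    rw [Lp.eq_zero_iff_ae_eq_zero]
    filter_upwards [h1] with ζ h
    simpa using h)

/-- The Weyl representation of the doubled space as a unitary onto `L²` of phase space, in the
coordinates of the slices. -/
noncomputable def weylUnitary : Ell2 (ℕ × ℕ) ≃ₗᵢ[ℂ] QuorumL2 := weylBasis.repr.symm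

theorem weylUnitary_toEll2 (w : ℕ × ℕ →₀ ℂ) : weylUnitary (toEll2 w) = weylVector w := by
  have h : weylUnitary.toLinearEquiv.toLinearMap ∘ₗ toEll2 = weylVector := by
    refine Finsupp.lhom_ext' fun p => LinearMap.ext_ring ?_
    simp only [LinearMap.comp_apply, Finsupp.lsingle_apply, toEll2,
      Finsupp.linearCombination_single, one_smul]
    change weylBasis.repr.symm (lp.single 2 p 1) = _
    rw [HilbertBasis.repr_symm_single, weylBasis, HilbertBasis.coe_mkOfOrthogonalEqBot]
  exact LinearMap.congr_fun h w

/-- An operator that acts on the finite vectors as multiplication of Weyl symbols by a function of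
polynomial growth is closable, and its closure is the maximal multiplication operator. -/
theorem closure_coreOp_eq_mulOp {F : Type*} [NormedAddCommGroup F] [InnerProductSpace ℂ F]
    [CompleteSpace F] (B : F ≃ₗᵢ[ℂ] QuorumL2) {m : ℝ × ℝ → ℂ} (hm : Measurable m) {D : ℝ} {N : ℕ}
    (hD : 0 ≤ D) (hb : ∀ ζ, weylWeight ζ * ‖m ζ‖ ≤ D * (1 + ‖slicePoint ζ‖) ^ N)
    {L : (ℕ × ℕ →₀ ℂ) →ₗ[ℂ] F}
    (hL : ∀ w, (B (L w) : ℝ × ℝ → ℂ) =ᵐ[quorumMeasure]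
      fun ζ => m ζ * ((weylWeight ζ : ℂ) * weylSymbol w (slicePoint ζ))) :
    (coreOp L).IsClosable ∧ (coreOp L).closure = mulOp weylUnitary B m := by
  refine closure_eq_mulOp weylUnitary B hm ?_ ?_
  · rw [← LinearPMap.le_graph_iff]
    rintro ⟨x, y⟩ hxy
    obtain ⟨w, rfl, rfl⟩ := (mem_graph_coreOp L x y).1 hxy
    rw [mem_graph_mulOp, weylUnitary_toEll2]
    filter_upwards [hL w, weylVector_ae w] with ζ a b
    rw [a, b]
  · intro v v' hv h
    have h1 := add_conj_mul_eq_zero_of_integral hm hD hb v v' (fun w => by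
      have := h ⟨toEll2 w, w, rfl⟩
      simpa only [weylUnitary_toEll2] using this)
    rw [Lp.eq_zero_iff_ae_eq_zero]
    filter_upwards [h1, hv] with ζ a b
    rw [b] at a
    -- orthogonality to the graph forces `(1 + |m|²) v = 0`
    have h2 : v ζ * (1 + ((‖m ζ‖ ^ 2 : ℝ) : ℂ)) = 0 := by
      rw [Pi.zero_apply] at a
      rw [← a, Complex.ofReal_pow, ← Complex.conj_mul']
      ring
    rw [Pi.zero_apply]
    refine (mul_eq_zero.1 h2).resolve_right ?_
    rw [← Complex.ofReal_one, ← Complex.ofReal_add]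
    exact Complex.ofReal_ne_zero.2 (by positivity)

/-! ### Tensor products of `L²` spaces -/

section Tensor

variable {X Y : Type*} [MeasurableSpace X] [MeasurableSpace Y] {μ : Measure X} {ν : Measure Y}

theorem memLp_tensor {f : X → ℂ} {g : Y → ℂ} (hf : MemLp f 2 μ) (hg : MemLp g 2 ν) :
    MemLp (fun p : X × Y => f p.1 * g p.2) 2 (μ.prod ν) := by
  have hm : AEStronglyMeasurable (fun p : X × Y => f p.1 * g p.2) (μ.prod ν) :=
    hf.1.comp_fst.mul hg.1.comp_snd
  rw [memLp_two_iff_integrable_sq_norm hm]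
  refine (((memLp_two_iff_integrable_sq_norm hf.1).1 hf).mul_prod
    ((memLp_two_iff_integrable_sq_norm hg.1).1 hg)).congr (Filter.Eventually.of_forall fun p => ?_)
  simp only [norm_mul, mul_pow]

/-- The elementary tensor `a ⊗ s` as a function of two variables. -/
noncomputable def tensorLp (a : Lp ℂ 2 μ) (s : Lp ℂ 2 ν) : Lp ℂ 2 (μ.prod ν) :=
  (memLp_tensor (Lp.memLp a) (Lp.memLp s)).toLp

theorem tensorLp_ae (a : Lp ℂ 2 μ) (s : Lp ℂ 2 ν) :
    (tensorLp a s : X × Y → ℂ) =ᵐ[μ.prod ν] fun p => a p.1 * s p.2 :=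
  (memLp_tensor (Lp.memLp a) (Lp.memLp s)).coeFn_toLp

theorem tensorLp_ae_of_ae {a : Lp ℂ 2 μ} {s : Lp ℂ 2 ν} {f : X → ℂ} {g : Y → ℂ}
    (hf : (a : X → ℂ) =ᵐ[μ] f) (hg : (s : Y → ℂ) =ᵐ[ν] g) :
    (tensorLp a s : X × Y → ℂ) =ᵐ[μ.prod ν] fun p => f p.1 * g p.2 := by
  filter_upwards [tensorLp_ae a s, Measure.quasiMeasurePreserving_fst.ae_eq_comp hf,
    Measure.quasiMeasurePreserving_snd.ae_eq_comp hg] with p h1 h2 h3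
  rw [h1]
  exact congrArg₂ _ h2 h3

variable [SFinite μ] [SFinite ν]

theorem inner_tensorLp (a b : Lp ℂ 2 μ) (s r : Lp ℂ 2 ν) :
    inner ℂ (tensorLp a s) (tensorLp b r) = inner ℂ a b * inner ℂ s r := by
  rw [L2.inner_def, L2.inner_def, L2.inner_def, ← integral_prod_mul]
  refine integral_congr_ae ?_
  filter_upwards [tensorLp_ae a s, tensorLp_ae b r] with p h1 h2
  rw [h1, h2]
  simp only [RCLike.inner_apply, map_mul]
  ring

theorem norm_tensorLp (a : Lp ℂ 2 μ) (s : Lp ℂ 2 ν) : ‖tensorLp a s‖ = ‖a‖ * ‖s‖ := by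
  have h := inner_tensorLp a a s s
  simp only [inner_self_eq_norm_sq_to_K] at h
  have h2 : ‖tensorLp a s‖ ^ 2 = (‖a‖ * ‖s‖) ^ 2 := by
    rw [mul_pow]; exact_mod_cast h
  exact (pow_left_inj₀ (norm_nonneg _) (by positivity) two_ne_zero).1 h2

/-- Tensoring with a fixed left factor. -/
noncomputable def tensorLeft (a : Lp ℂ 2 μ) : Lp ℂ 2 ν →L[ℂ] Lp ℂ 2 (μ.prod ν) :=
  LinearMap.mkContinuous
    { toFun := tensorLp a
      map_add' := fun s r => Lp.ext (by
        filter_upwards [tensorLp_ae_of_ae (Filter.EventuallyEq.refl _ (a : X → ℂ))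
          (Lp.coeFn_add s r), Lp.coeFn_add (tensorLp a s) (tensorLp a r), tensorLp_ae a s,
          tensorLp_ae a r] with p h1 h2 h3 h4
        rw [h1, h2, Pi.add_apply, Pi.add_apply, h3, h4, mul_add])
      map_smul' := fun c s => Lp.ext (by
        filter_upwards [tensorLp_ae_of_ae (Filter.EventuallyEq.refl _ (a : X → ℂ))
          (Lp.coeFn_smul c s), Lp.coeFn_smul c (tensorLp a s), tensorLp_ae a s] with p h1 h2 h3
        rw [h1, RingHom.id_apply, h2, Pi.smul_apply, Pi.smul_apply, h3, smul_eq_mul, smul_eq_mul,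
          mul_left_comm]) }
    ‖a‖ fun s => (norm_tensorLp a s).le

/-- Tensoring with a fixed right factor. -/
noncomputable def tensorRight (s : Lp ℂ 2 ν) : Lp ℂ 2 μ →L[ℂ] Lp ℂ 2 (μ.prod ν) :=
  LinearMap.mkContinuous
    { toFun := fun a => tensorLp a s
      map_add' := fun a b => Lp.ext (by
        filter_upwards [tensorLp_ae_of_ae (Lp.coeFn_add a b)
          (Filter.EventuallyEq.refl _ (s : Y → ℂ)), Lp.coeFn_add (tensorLp a s) (tensorLp b s),
          tensorLp_ae a s, tensorLp_ae b s] with p h1 h2 h3 h4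
        rw [h1, h2, Pi.add_apply, Pi.add_apply, h3, h4, add_mul])
      map_smul' := fun c a => Lp.ext (by
        filter_upwards [tensorLp_ae_of_ae (Lp.coeFn_smul c a)
          (Filter.EventuallyEq.refl _ (s : Y → ℂ)), Lp.coeFn_smul c (tensorLp a s),
          tensorLp_ae a s] with p h1 h2 h3
        rw [h1, RingHom.id_apply, h2, Pi.smul_apply, Pi.smul_apply, h3, smul_eq_mul, smul_eq_mul,
          mul_assoc]) }
    ‖s‖ fun a => (norm_tensorLp a s).le.trans_eq (mul_comm _ _)

theorem HilbertBasis.clm_eq_zero {ι E F : Type*} [NormedAddCommGroup E] [InnerProductSpace ℂ E]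
    [NormedAddCommGroup F] [InnerProductSpace ℂ F] (b : HilbertBasis ι ℂ E) (T : E →L[ℂ] F)
    (h : ∀ i, T (b i) = 0) : T = 0 := by
  refine ContinuousLinearMap.ext_on (s := Set.range b) ?_ ?_
  · rw [Submodule.dense_iff_topologicalClosure_eq_top]
    exact b.dense_span
  · rintro _ ⟨i, rfl⟩
    simp [h i]

/-- A vector orthogonal to the tensors of two bases is orthogonal to all elementary tensors. -/
theorem inner_tensorLp_eq_zero {ι κ : Type*} (e : HilbertBasis ι ℂ (Lp ℂ 2 μ))
    (f : HilbertBasis κ ℂ (Lp ℂ 2 ν)) (u : Lp ℂ 2 (μ.prod ν))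
    (h : ∀ i k, inner ℂ u (tensorLp (e i) (f k)) = 0) (a : Lp ℂ 2 μ) (s : Lp ℂ 2 ν) :
    inner ℂ u (tensorLp a s) = 0 := by
  have h1 : ∀ i, (innerSL ℂ u).comp (tensorLeft (e i) : Lp ℂ 2 ν →L[ℂ] _) = 0 := fun i =>
    f.clm_eq_zero _ fun k => h i k
  have h2 : (innerSL ℂ u).comp (tensorRight s : Lp ℂ 2 μ →L[ℂ] _) = 0 :=
    e.clm_eq_zero _ fun i => DFunLike.congr_fun (h1 i) s
  exact DFunLike.congr_fun h2 a

theorem orthonormal_tensorLp {ι κ : Type*} (e : HilbertBasis ι ℂ (Lp ℂ 2 μ))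
    (f : HilbertBasis κ ℂ (Lp ℂ 2 ν)) :
    Orthonormal ℂ fun p : ι × κ => tensorLp (e p.1) (f p.2) := by
  classical
  rw [orthonormal_iff_ite]
  intro p q
  rw [inner_tensorLp, orthonormal_iff_ite.1 e.orthonormal, orthonormal_iff_ite.1 f.orthonormal,
    ite_zero_mul_ite_zero, one_mul]
  simp only [Prod.ext_iff]

/-- A unitary of the second factor extends to the `L²` space of the product, provided the
elementary tensors are total there. -/
theorem exists_tensorLp_isometryEquiv
    (htotal : ∀ u : Lp ℂ 2 (μ.prod ν), (∀ a s, inner ℂ u (tensorLp a s) = 0) → u = 0)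
    (V : Lp ℂ 2 ν ≃ₗᵢ[ℂ] Lp ℂ 2 ν) :
    ∃ B : Lp ℂ 2 (μ.prod ν) ≃ₗᵢ[ℂ] Lp ℂ 2 (μ.prod ν),
      ∀ a s, B (tensorLp a s) = tensorLp a (V s) := by
  obtain ⟨I, e, -⟩ := exists_hilbertBasis ℂ (Lp ℂ 2 μ)
  obtain ⟨K, f, -⟩ := exists_hilbertBasis ℂ (Lp ℂ 2 ν)
  -- `B` carries the product basis built from `f` to the one built from `V f`
  set f' : HilbertBasis K ℂ (Lp ℂ 2 ν) := HilbertBasis.ofRepr (V.symm.trans f.repr) with hf'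
  have hf'V : ∀ k, f' k = V (f k) := by
    intro k
    apply f'.repr.injective
    classical
    rw [HilbertBasis.repr_self, hf']
    change _ = f.repr (V.symm (V (f k)))
    rw [LinearIsometryEquiv.symm_apply_apply, HilbertBasis.repr_self]
  have hb : ∀ g : HilbertBasis K ℂ (Lp ℂ 2 ν),
      (Submodule.span ℂ (Set.range fun p : I × K => tensorLp (e p.1) (g p.2)))ᗮ = ⊥ := by
    intro g
    rw [Submodule.eq_bot_iff]
    intro u hu
    rw [Submodule.mem_orthogonal'] at hu
    exact htotal u (inner_tensorLp_eq_zero e g u fun i k =>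
      hu _ (Submodule.subset_span ⟨(i, k), rfl⟩))
  set b := HilbertBasis.mkOfOrthogonalEqBot (orthonormal_tensorLp e f) (hb f) with hbdef
  set b' := HilbertBasis.mkOfOrthogonalEqBot (orthonormal_tensorLp e f') (hb f') with hbdef'
  refine ⟨b.repr.trans b'.repr.symm, fun a s => ?_⟩
  apply b'.repr.injective
  rw [LinearIsometryEquiv.trans_apply, LinearIsometryEquiv.apply_symm_apply]
  refine lp.ext (funext fun p => ?_)
  rw [HilbertBasis.repr_apply_apply, HilbertBasis.repr_apply_apply, hbdef, hbdef',
    HilbertBasis.coe_mkOfOrthogonalEqBot, HilbertBasis.coe_mkOfOrthogonalEqBot, inner_tensorLp,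
    inner_tensorLp, hf'V, LinearIsometryEquiv.inner_map_map]

end Tensor

/-! ### The Fourier transform on `L²(ℝ)` -/

section FourierL2

open FourierTransform

/-- Real test functions are Schwartz functions. -/
theorem exists_schwartz_eq {g : ℝ → ℝ} (hg : ContDiff ℝ ∞ g) (hgc : HasCompactSupport g) :
    ∃ G : SchwartzMap ℝ ℂ, ∀ x, G x = (g x : ℂ) := by
  have hg1 : ContDiff ℝ ∞ fun z => (g z : ℂ) := Complex.ofRealCLM.contDiff.comp hg
  have hg2 : HasCompactSupport fun z => (g z : ℂ) := hgc.comp_left Complex.ofReal_zero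
  exact ⟨hg2.toSchwartzMap hg1, fun x => rfl⟩

theorem integral_fourier_mul_eq_flip {f g : ℝ → ℂ} (hf : Integrable f) (hg : Integrable g) :
    ∫ x, 𝓕 f x * g x = ∫ x, f x * 𝓕 g x := by
  have h := VectorFourier.integral_fourierIntegral_smul_eq_flip (L := innerₗ ℝ)
    Real.continuous_fourierChar continuous_inner hf hg
  rw [flip_innerₗ] at h
  exact h

theorem continuous_fourier {f : ℝ → ℂ} (hf : Integrable f) : Continuous (𝓕 f) :=
  VectorFourier.fourierIntegral_continuous Real.continuous_fourierChar continuous_inner hf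

theorem fourierInv_conj_of_real {G : ℝ → ℂ} (hG : ∀ x, starRingEnd ℂ (G x) = G x) (x : ℝ) :
    starRingEnd ℂ (𝓕⁻ G x) = 𝓕 G x := by
  rw [Real.fourierInv_eq', Real.fourier_eq', ← integral_conj]
  congr 1
  funext y
  rw [smul_eq_mul, smul_eq_mul, map_mul, hG, ← Complex.exp_conj]
  congr 2
  simp only [map_mul, Complex.conj_I, Complex.conj_ofReal]
  push_cast
  ring

theorem inner_toLp_schwartz (G : SchwartzMap ℝ ℂ) (u : Lp ℂ 2 (volume : Measure ℝ)) :
    inner ℂ (G.toLp 2) u = ∫ x, u x * starRingEnd ℂ (G x) := by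
  rw [L2.inner_def]
  refine integral_congr_ae ?_
  filter_upwards [G.coeFn_toLp 2 volume] with x hx
  rw [hx, RCLike.inner_apply]

/-- On `L¹ ∩ L²` the unitary Fourier transform is given by the Fourier integral. -/
theorem fourierTransform_toLp_ae {f : ℝ → ℂ} (h1 : Integrable f) (h2 : MemLp f 2) :
    (Lp.fourierTransformₗᵢ ℝ ℂ h2.toLp : ℝ → ℂ) =ᵐ[volume] 𝓕 f := by
  refine ae_eq_of_integral_contDiff_smul_eq
    ((Lp.memLp _).locallyIntegrable one_le_two) (continuous_fourier h1).locallyIntegrable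
    fun g hg hgc => ?_
  obtain ⟨G, hG⟩ := exists_schwartz_eq hg hgc
  have hGr : ∀ x, starRingEnd ℂ (G x) = G x := fun x => by rw [hG, Complex.conj_ofReal]
  calc ∫ x, g x • (Lp.fourierTransformₗᵢ ℝ ℂ h2.toLp : ℝ → ℂ) x
      = inner ℂ (G.toLp 2) (Lp.fourierTransformₗᵢ ℝ ℂ h2.toLp) := by
        rw [inner_toLp_schwartz]
        congr 1
        funext x
        rw [hGr, hG, Complex.real_smul, mul_comm]
    _ = inner ℂ ((𝓕⁻ G : SchwartzMap ℝ ℂ).toLp 2) h2.toLp := by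
        rw [← SchwartzMap.toLp_fourierInv_eq]
        have h := (Lp.fourierTransformₗᵢ ℝ ℂ).inner_map_map
          ((Lp.fourierTransformₗᵢ ℝ ℂ).symm (G.toLp 2)) h2.toLp
        rwa [LinearIsometryEquiv.apply_symm_apply] at h
    _ = ∫ x, f x * 𝓕 (G : ℝ → ℂ) x := by
        rw [inner_toLp_schwartz]
        refine integral_congr_ae ?_
        filter_upwards [h2.coeFn_toLp] with x hx
        rw [hx, SchwartzMap.fourierInv_coe, fourierInv_conj_of_real hGr]
    _ = ∫ x, g x • 𝓕 f x := by
        rw [← integral_fourier_mul_eq_flip h1 G.integrable]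
        congr 1
        funext x
        rw [hG, Complex.real_smul, mul_comm]

theorem fourierTransform_symm_toLp_ae {f : ℝ → ℂ} (h1 : Integrable f) (h2 : MemLp f 2) :
    ((Lp.fourierTransformₗᵢ ℝ ℂ).symm h2.toLp : ℝ → ℂ) =ᵐ[volume] 𝓕⁻ f := by
  have hinv : ∀ x, 𝓕⁻ f x = 𝓕 f (-x) := fun x => Real.fourierInv_eq_fourier_neg f x
  have hc : Continuous (𝓕⁻ f) := by
    have : 𝓕⁻ f = fun x => 𝓕 f (-x) := funext hinv
    rw [this]
    exact (continuous_fourier h1).comp continuous_neg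
  refine ae_eq_of_integral_contDiff_smul_eq
    ((Lp.memLp _).locallyIntegrable one_le_two) hc.locallyIntegrable fun g hg hgc => ?_
  obtain ⟨G, hG⟩ := exists_schwartz_eq hg hgc
  have hGr : ∀ x, starRingEnd ℂ (G x) = G x := fun x => by rw [hG, Complex.conj_ofReal]
  calc ∫ x, g x • ((Lp.fourierTransformₗᵢ ℝ ℂ).symm h2.toLp : ℝ → ℂ) x
      = inner ℂ (G.toLp 2) ((Lp.fourierTransformₗᵢ ℝ ℂ).symm h2.toLp) := by
        rw [inner_toLp_schwartz]
        congr 1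
        funext x
        rw [hGr, hG, Complex.real_smul, mul_comm]
    _ = inner ℂ ((𝓕 G : SchwartzMap ℝ ℂ).toLp 2) h2.toLp := by
        rw [← SchwartzMap.toLp_fourier_eq, ← (Lp.fourierTransformₗᵢ ℝ ℂ).inner_map_map,
          LinearIsometryEquiv.apply_symm_apply]
        rfl
    _ = ∫ x, f x * 𝓕 (fun y => G (-y)) x := by
        rw [inner_toLp_schwartz]
        refine integral_congr_ae ?_
        filter_upwards [h2.coeFn_toLp] with x hx
        rw [hx, SchwartzMap.fourier_coe, ← fourierInv_conj_of_real hGr, Complex.conj_conj,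
          Real.fourierInv_eq_fourier_comp_neg]
    _ = ∫ x, g x • 𝓕⁻ f x := by
        rw [← integral_fourier_mul_eq_flip h1 G.integrable.comp_neg, ← integral_neg_eq_self]
        congr 1
        funext x
        rw [hinv, neg_neg, hG, Complex.real_smul, mul_comm]

end FourierL2

/-! ### Characters of the quadratures and the partial Fourier transform -/

theorem expEntry_quadrature_sub (φ k x : ℝ) (p : ℕ × ℕ) :
    expEntry ((Complex.I * k) • (quadrature φ - (x : ℂ) • 1)) p.1 p.2 =
      Complex.exp (-(Complex.I * (k * x))) * (fockPhase φ p.1 p.2 * fockFourier k p.1 p.2) := by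
  rw [quadrature_exponent, expEntry_add_scalar, ← quadrature_exponent_zero, expEntry_quadrature,
    mul_assoc Complex.I]

/-- On the slice at angle `φ` the displacement operators are the characters of `X_φ`. -/
theorem displacementKet_slicePoint (ζ : ℝ × ℝ) (p : ℕ × ℕ) :
    displacementKet (slicePoint ζ) p =
      fockPhase ζ.1 p.1 p.2 * fockFourier (2 * Real.pi * ζ.2) p.1 p.2 := by
  rw [← expEntry_quadrature, quadrature_exponent_zero, displacementKet_eq]
  congr 2
  · rw [slicePoint]
    push_cast
    ring
  · rw [slicePoint]
    simp only [map_mul, Complex.conj_I, Complex.conj_ofReal, ← Complex.exp_conj, neg_mul]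
    push_cast
    ring

theorem fockPhase_zero (n m : ℕ) : fockPhase 0 n m = 1 := by simp [fockPhase_eq]

/-- The characteristic functions of the quadratures are Weyl symbols on the slice at angle `0`, and so
inherit their continuity and their decay. -/
theorem fockFourier_eq_conj_weylSymbol (k : ℝ) (p : ℕ × ℕ) :
    fockFourier k p.1 p.2 =
      starRingEnd ℂ (weylSymbol (Finsupp.single p 1) (slicePoint (0, k / (2 * Real.pi)))) := by
  rw [weylSymbol_single, Complex.conj_conj, displacementKet_slicePoint, fockPhase_zero, one_mul]
  congr 1
  have := Real.pi_ne_zero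
  simp only
  field_simp

theorem continuous_fockFourier (p : ℕ × ℕ) : Continuous fun k => fockFourier k p.1 p.2 := by
  simp only [fockFourier_eq_conj_weylSymbol _ p]
  have h := continuous_weylSymbol (Finsupp.single p 1)
  have hs := continuous_slicePoint
  exact Complex.continuous_conj.comp (h.comp (hs.comp (by fun_prop)))

theorem exists_fockFourier_bound (p : ℕ × ℕ) : ∃ C : ℝ, 0 ≤ C ∧ ∀ k : ℝ,
    (1 + |k|) * ‖fockFourier k p.1 p.2‖ ≤ C * Real.exp (-(1 / 16) * k ^ 2) := by
  obtain ⟨C, hC, h⟩ := exists_weylSymbol_bound (Finsupp.single p 1) 1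
  refine ⟨2 * C, by positivity, fun k => ?_⟩
  have h1 := h (slicePoint (0, k / (2 * Real.pi)))
  have h2 : ‖slicePoint (0, k / (2 * Real.pi))‖ = |k| / 2 := by
    have := Real.pi_pos
    rw [norm_slicePoint, abs_div, abs_of_pos (by positivity : 0 < 2 * Real.pi)]
    field_simp
  rw [h2, pow_one, div_pow, sq_abs] at h1
  rw [fockFourier_eq_conj_weylSymbol, RCLike.norm_conj]
  have h3 : Real.exp (-(k ^ 2 / 2 ^ 2) / 4) = Real.exp (-(1 / 16) * k ^ 2) := by ring_nf
  rw [h3] at h1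
  nlinarith [norm_nonneg (weylSymbol (Finsupp.single p 1) (slicePoint (0, k / (2 * Real.pi)))),
    abs_nonneg k]

theorem memLp_of_gaussian_bound {f : ℝ → ℂ} (hf : Continuous f) {C b : ℝ} (hb : 0 < b)
    (h : ∀ x, ‖f x‖ ≤ C * Real.exp (-b * x ^ 2)) : Integrable f ∧ MemLp f 2 := by
  refine ⟨((integrable_exp_neg_mul_sq hb).const_mul C).mono' hf.aestronglyMeasurable
    (Filter.Eventually.of_forall h), ?_⟩
  rw [memLp_two_iff_integrable_sq_norm hf.aestronglyMeasurable]
  refine ((integrable_exp_neg_mul_sq (b := 2 * b) (by positivity)).const_mul (C ^ 2)).mono'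
    (hf.norm.pow 2).aestronglyMeasurable (Filter.Eventually.of_forall fun x => ?_)
  rw [Real.norm_of_nonneg (by positivity)]
  calc ‖f x‖ ^ 2 ≤ (C * Real.exp (-b * x ^ 2)) ^ 2 := by gcongr; exact h x
    _ = _ := by rw [mul_pow, ← Real.exp_nat_mul]; congr 2; push_cast; ring

theorem integrable_abs_mul_expEntry (φ x : ℝ) (p : ℕ × ℕ) : Integrable fun k : ℝ =>
    ((|k| : ℝ) : ℂ) * expEntry ((Complex.I * k) • (quadrature φ - (x : ℂ) • 1)) p.1 p.2 := by
  simp only [expEntry_quadrature_sub]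
  obtain ⟨C, hC, h⟩ := exists_fockFourier_bound p
  have hc := continuous_fockFourier p
  refine (memLp_of_gaussian_bound (b := 1 / 16) (C := C) ?_ (by norm_num) fun k => ?_).1
  · fun_prop
  · have h1 : ‖Complex.exp (-(Complex.I * (k * x)))‖ = 1 := by
      rw [Complex.exp_neg, norm_inv, norm_exp_I_mul_mul, inv_one]
    rw [norm_mul, norm_mul, norm_mul, h1, norm_fockPhase, one_mul, one_mul, Complex.norm_real,
      Real.norm_eq_abs, abs_abs]
    refine le_trans ?_ (h k)
    gcongr
    linarith

/-- The Fourier density `π²|κ| ⟨n|e^{2πiκX₀}|m⟩*` of the conjugate homodyne kernel. -/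
noncomputable def homodyneDensity (p : ℕ × ℕ) (κ : ℝ) : ℂ :=
  ((Real.pi ^ 2 * |κ| : ℝ) : ℂ) * starRingEnd ℂ (fockFourier (2 * Real.pi * κ) p.1 p.2)

theorem homodyneDensity_memLp (p : ℕ × ℕ) :
    Integrable (homodyneDensity p) ∧ MemLp (homodyneDensity p) 2 := by
  obtain ⟨C, hC, h⟩ := exists_fockFourier_bound p
  have hc := continuous_fockFourier p
  have hπ := Real.pi_pos
  refine memLp_of_gaussian_bound (b := Real.pi ^ 2 / 4) (C := Real.pi * C) ?_ (by positivity)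
    fun κ => ?_
  · unfold homodyneDensity
    exact Continuous.mul (by fun_prop) (Complex.continuous_conj.comp (hc.comp (by fun_prop)))
  · have h1 := h (2 * Real.pi * κ)
    rw [abs_mul, abs_of_pos (by positivity : 0 < 2 * Real.pi),
      show -(1 / 16) * (2 * Real.pi * κ) ^ 2 = -(Real.pi ^ 2 / 4) * κ ^ 2 by ring] at h1
    rw [homodyneDensity, norm_mul, Complex.norm_real, Real.norm_of_nonneg (by positivity),
      RCLike.norm_conj, mul_assoc Real.pi C]
    refine le_trans ?_ (mul_le_mul_of_nonneg_left h1 hπ.le)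
    rw [← mul_assoc]
    refine mul_le_mul_of_nonneg_right ?_ (norm_nonneg _)
    nlinarith [mul_nonneg (sq_nonneg Real.pi) (abs_nonneg κ)]

open FourierTransform in
/-- For fixed angle, the conjugate homodyne kernel is an inverse Fourier transform in `x`. -/
theorem conj_homodyneKernel (ζ : ℝ × ℝ) (p : ℕ × ℕ) : starRingEnd ℂ (homodyneKernel ζ p) =
    starRingEnd ℂ (fockPhase ζ.1 p.1 p.2) * 𝓕⁻ (homodyneDensity p) ζ.2 := by
  obtain ⟨φ, x⟩ := ζ
  have hπ := Real.pi_pos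
  simp only [homodyneKernel, expEntry_quadrature_sub]
  set f : ℝ → ℂ := fun k => ((|k| : ℝ) : ℂ) * (Complex.exp (-(Complex.I * (k * x))) *
    (fockPhase φ p.1 p.2 * fockFourier k p.1 p.2)) with hf
  -- substitute `k = 2πκ`
  have hsub : ∫ k, f k = (2 * Real.pi : ℂ) * ∫ κ, f (2 * Real.pi * κ) := by
    rw [Measure.integral_comp_mul_left f (2 * Real.pi), abs_of_pos (by positivity),
      Complex.real_smul]
    have : (Real.pi : ℂ) ≠ 0 := Complex.ofReal_ne_zero.2 hπ.ne'
    push_cast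
    field_simp
  rw [hsub, map_mul, map_mul, ← integral_conj, Real.fourierInv_eq', ← mul_assoc,
    ← integral_const_mul, ← integral_const_mul]
  congr 1
  funext κ
  have hexp : Complex.exp (((2 * Real.pi * inner ℝ κ x : ℝ) : ℂ) * Complex.I) =
      Complex.exp (Complex.I * (((2 * Real.pi * κ : ℝ) : ℂ) * x)) := by
    congr 1
    simp only [RCLike.inner_apply, conj_trivial]
    push_cast
    ring
  rw [hf, homodyneDensity, hexp]
  simp only [map_mul, Complex.conj_ofReal, ← Complex.exp_conj, map_neg, Complex.conj_I, neg_mul,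
    neg_neg, smul_eq_mul, abs_mul, abs_of_pos hπ, abs_two, map_div₀, map_one, map_ofNat]
  push_cast
  ring

open FourierTransform in
theorem fourier_fockWave_mul (p : ℕ × ℕ) (κ : ℝ) :
    𝓕 (fun x => ((fockWave p.1 x * fockWave p.2 x : ℝ) : ℂ)) κ =
      starRingEnd ℂ (fockFourier (2 * Real.pi * κ) p.1 p.2) := by
  rw [Real.fourier_real_eq_integral_exp_smul, fockFourier, ← integral_conj]
  congr 1
  funext x
  rw [smul_eq_mul, map_mul, Complex.conj_ofReal, ← Complex.exp_conj]
  congr 2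
  simp only [map_mul, Complex.conj_I, Complex.conj_ofReal]
  push_cast
  ring

theorem fockWave_mul_memLp (p : ℕ × ℕ) :
    Integrable (fun x => ((fockWave p.1 x * fockWave p.2 x : ℝ) : ℂ)) ∧
      MemLp (fun x => ((fockWave p.1 x * fockWave p.2 x : ℝ) : ℂ)) 2 := by
  obtain ⟨C, hC, h⟩ := exists_fockWave_mul_bound p.1 p.2
  refine memLp_of_gaussian_bound (b := 1) (C := C)
    (Complex.continuous_ofReal.comp ((continuous_fockWave _).mul (continuous_fockWave _)))
    one_pos fun x => ?_
  rw [Complex.norm_real, Real.norm_eq_abs]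
  simpa using h x

/-- The normalized measure on the angles. -/
noncomputable abbrev angleMeasure : Measure ℝ :=
  ENNReal.ofReal Real.pi⁻¹ • volume.restrict (Set.Ico 0 Real.pi)

theorem memLp_conj_fockPhase (p : ℕ × ℕ) :
    MemLp (fun φ => starRingEnd ℂ (fockPhase φ p.1 p.2)) 2 angleMeasure := by
  refine MemLp.of_bound (C := 1) ?_ (Filter.Eventually.of_forall fun φ => ?_)
  · refine Continuous.aestronglyMeasurable ?_
    simp only [fockPhase_eq]
    exact Complex.continuous_conj.comp (by fun_prop)
  · rw [RCLike.norm_conj, norm_fockPhase]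

/-- The function `e^{-i(n-m)φ} s(x)` of `(φ, x)`. -/
noncomputable def phaseTensor (p : ℕ × ℕ) (s : Lp ℂ 2 (volume : Measure ℝ)) : QuorumL2 :=
  tensorLp (memLp_conj_fockPhase p).toLp s

theorem phaseTensor_ae (p : ℕ × ℕ) {s : Lp ℂ 2 (volume : Measure ℝ)} {g : ℝ → ℂ}
    (hg : (s : ℝ → ℂ) =ᵐ[volume] g) : (phaseTensor p s : ℝ × ℝ → ℂ) =ᵐ[quorumMeasure]
      fun ζ => starRingEnd ℂ (fockPhase ζ.1 p.1 p.2) * g ζ.2 :=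
  tensorLp_ae_of_ae (memLp_conj_fockPhase p).coeFn_toLp hg

theorem conj_fockFourier_memLp (p : ℕ × ℕ) :
    MemLp (fun κ => starRingEnd ℂ (fockFourier (2 * Real.pi * κ) p.1 p.2)) 2 := by
  obtain ⟨h1, h2⟩ := fockWave_mul_memLp p
  have h3 := fourierTransform_toLp_ae h1 h2
  refine (memLp_congr_ae ?_).1 (Lp.memLp (Lp.fourierTransformₗᵢ ℝ ℂ h2.toLp))
  filter_upwards [h3] with κ h
  rw [h, fourier_fockWave_mul]

theorem weylSymbol_single_slicePoint (p : ℕ × ℕ) (ζ : ℝ × ℝ) :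
    weylSymbol (Finsupp.single p 1) (slicePoint ζ) =
      starRingEnd ℂ (fockPhase ζ.1 p.1 p.2) *
        starRingEnd ℂ (fockFourier (2 * Real.pi * ζ.2) p.1 p.2) := by
  rw [weylSymbol_single, displacementKet_slicePoint, map_mul]

/-- The elementary tensors are total, since the Weyl symbols of the matrix units are elementary
tensors. -/
theorem eq_zero_of_inner_tensorLp (u : Lp ℂ 2 (angleMeasure.prod (volume : Measure ℝ)))
    (h : ∀ a s, inner ℂ u (tensorLp a s) = 0) : u = 0 := by
  have hu : (u : ℝ × ℝ → ℂ) =ᵐ[quorumMeasure] 0 := by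
    refine ae_eq_zero_of_integral_weylSymbol (N := 0) (Lp.aestronglyMeasurable u) ?_ ?_
    · simp only [pow_zero, inv_one, one_mul]
      exact (Lp.memLp u).norm
    · intro w
      have hint : ∀ w, Integrable (fun ζ => starRingEnd ℂ (weylSymbol w (slicePoint ζ)) * u ζ)
          quorumMeasure := by
        intro w
        have hw := memLp_mul_weylSymbol w (g := fun _ => 1) (D := 1) (N := 0) continuous_const
          zero_le_one (by simp)
        simp only [one_mul] at hw
        exact (hw.star).integrable_mul (Lp.memLp u)
      induction w using Finsupp.induction_linear with
      | zero => simp [weylSymbol_zero]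
      | add a b ha hb =>
        simp only [weylSymbol_add, map_add, add_mul]
        rw [integral_add (hint a) (hint b), ha, hb, add_zero]
      | single p c =>
        have h1 := h (memLp_conj_fockPhase p).toLp (conj_fockFourier_memLp p).toLp
        rw [← inner_conj_symm, map_eq_zero, L2.inner_def] at h1
        have h2 : ∫ ζ, starRingEnd ℂ (weylSymbol (Finsupp.single p 1) (slicePoint ζ)) * u ζ
            ∂quorumMeasure = 0 := by
          rw [← h1]
          refine integral_congr_ae ?_
          filter_upwards [tensorLp_ae_of_ae (memLp_conj_fockPhase p).coeFn_toLp
            (conj_fockFourier_memLp p).coeFn_toLp] with ζ hζ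
          rw [hζ, RCLike.inner_apply, weylSymbol_single_slicePoint, mul_comm]
        rw [← mul_one c, ← smul_eq_mul, ← Finsupp.smul_single]
        simp only [weylSymbol_smul, map_mul, mul_assoc]
        rw [integral_const_mul, h2, mul_zero]
  exact (Lp.eq_zero_iff_ae_eq_zero).2 hu

theorem exists_partialFourier : ∃ B : QuorumL2 ≃ₗᵢ[ℂ] QuorumL2, ∀ p s,
    B (phaseTensor p s) = phaseTensor p (Lp.fourierTransformₗᵢ ℝ ℂ s) := by
  obtain ⟨B, hB⟩ := exists_tensorLp_isometryEquiv eq_zero_of_inner_tensorLp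
    (Lp.fourierTransformₗᵢ ℝ ℂ)
  exact ⟨B, fun p s => hB _ s⟩

/-- The Fourier transform in the second variable, as a unitary of `L²([0,π) × ℝ)`; it is pinned
only by its action on the products `e^{-i(n-m)φ} s(x)`. -/
noncomputable def partialFourier : QuorumL2 ≃ₗᵢ[ℂ] QuorumL2 := Classical.choose exists_partialFourier

theorem partialFourier_phaseTensor (p : ℕ × ℕ) (s : Lp ℂ 2 (volume : Measure ℝ)) :
    partialFourier (phaseTensor p s) = phaseTensor p (Lp.fourierTransformₗᵢ ℝ ℂ s) :=
  Classical.choose_spec exists_partialFourier p s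

/-! ### The two analysis operators -/

theorem memLp_of_conj {Φ : ℝ × ℝ → ℂ} (h : MemLp (fun ζ => starRingEnd ℂ (Φ ζ)) 2 quorumMeasure) :
    MemLp Φ 2 quorumMeasure := by
  refine (memLp_congr_ae (Filter.Eventually.of_forall fun ζ => ?_)).1 h.star
  exact Complex.conj_conj (Φ ζ)

theorem analysisMap_single {Φ : ℝ × ℝ → ℕ × ℕ → ℂ} {p : ℕ × ℕ}
    (h : MemLp (fun ζ => starRingEnd ℂ (Φ ζ p)) 2 quorumMeasure) :
    analysisMap Φ (Finsupp.single p 1) = h.toLp := by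
  rw [analysisMap, Finsupp.linearCombination_single, one_smul, dif_pos h]

theorem analysisMap_ae {Φ : ℝ × ℝ → ℕ × ℕ → ℂ}
    (h : ∀ p, MemLp (fun ζ => Φ ζ p) 2 quorumMeasure) (w : ℕ × ℕ →₀ ℂ) :
    (analysisMap Φ w : ℝ × ℝ → ℂ) =ᵐ[quorumMeasure] fun ζ => pairing (Φ ζ) w := by
  induction w using Finsupp.induction_linear with
  | zero =>
    rw [map_zero]
    filter_upwards [Lp.coeFn_zero ℂ 2 quorumMeasure] with ζ h1
    rw [h1, pairing_zero, Pi.zero_apply]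
  | add a b ha hb =>
    rw [map_add]
    filter_upwards [Lp.coeFn_add (analysisMap Φ a) (analysisMap Φ b), ha, hb] with ζ h1 h2 h3
    rw [h1, Pi.add_apply, h2, h3, pairing_add]
  | single p c =>
    have hp : MemLp (fun ζ => starRingEnd ℂ (Φ ζ p)) 2 quorumMeasure := (h p).star
    rw [← mul_one c, ← smul_eq_mul, ← Finsupp.smul_single, map_smul, analysisMap_single hp]
    filter_upwards [Lp.coeFn_smul c hp.toLp, hp.coeFn_toLp] with ζ h1 h2
    rw [h1, Pi.smul_apply, h2, pairing_smul, pairing_single, mul_one, smul_eq_mul]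

theorem partialFourier_analysisMap_ae {Φ : ℝ × ℝ → ℕ × ℕ → ℂ} {m : ℝ × ℝ → ℂ}
    (h : ∀ p, (partialFourier (analysisMap Φ (Finsupp.single p 1)) : ℝ × ℝ → ℂ) =ᵐ[quorumMeasure]
      fun ζ => m ζ * weylSymbol (Finsupp.single p 1) (slicePoint ζ)) (w : ℕ × ℕ →₀ ℂ) :
    (partialFourier (analysisMap Φ w) : ℝ × ℝ → ℂ) =ᵐ[quorumMeasure]
      fun ζ => m ζ * weylSymbol w (slicePoint ζ) := by
  induction w using Finsupp.induction_linear with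
  | zero =>
    rw [map_zero, map_zero]
    filter_upwards [Lp.coeFn_zero ℂ 2 quorumMeasure] with ζ h1
    rw [h1, weylSymbol_zero, Pi.zero_apply, mul_zero]
  | add a b ha hb =>
    rw [map_add, map_add]
    filter_upwards [Lp.coeFn_add (partialFourier (analysisMap Φ a))
      (partialFourier (analysisMap Φ b)), ha, hb] with ζ h1 h2 h3
    rw [h1, Pi.add_apply, h2, h3, weylSymbol_add, mul_add]
  | single p c =>
    rw [← mul_one c, ← smul_eq_mul, ← Finsupp.smul_single, map_smul, map_smul]
    filter_upwards [Lp.coeFn_smul c (partialFourier (analysisMap Φ (Finsupp.single p 1))), h p]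
      with ζ h1 h2
    rw [h1, Pi.smul_apply, h2, weylSymbol_smul, smul_eq_mul, mul_left_comm]

theorem phaseTensor_ae_conj_quadProjector (p : ℕ × ℕ) :
    (phaseTensor p (fockWave_mul_memLp p).2.toLp : ℝ × ℝ → ℂ) =ᵐ[quorumMeasure]
      fun ζ => starRingEnd ℂ (quadProjector ζ p) := by
  filter_upwards [phaseTensor_ae p (fockWave_mul_memLp p).2.coeFn_toLp] with ζ h
  rw [h, quadProjector_eq, map_mul, Complex.conj_ofReal]

theorem memLp_conj_quadProjector (p : ℕ × ℕ) :
    MemLp (fun ζ => starRingEnd ℂ (quadProjector ζ p)) 2 quorumMeasure :=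
  (memLp_congr_ae (phaseTensor_ae_conj_quadProjector p)).1 (Lp.memLp _)

/-- The partial Fourier transform of `⟨⟨Ξ(φ,x)|w⟩⟩` in `x` is the Weyl symbol of `w` on the slice at
angle `φ`. -/
theorem partialFourier_analysisMap_quadProjector (w : ℕ × ℕ →₀ ℂ) :
    (partialFourier (analysisMap quadProjector w) : ℝ × ℝ → ℂ) =ᵐ[quorumMeasure]
      fun ζ => weylSymbol w (slicePoint ζ) := by
  have h := partialFourier_analysisMap_ae (Φ := quadProjector) (m := fun _ => 1) (fun p => by
    have h1 : analysisMap quadProjector (Finsupp.single p 1) =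
        phaseTensor p (fockWave_mul_memLp p).2.toLp := by
      rw [analysisMap_single (memLp_conj_quadProjector p)]
      refine Lp.ext ?_
      filter_upwards [(memLp_conj_quadProjector p).coeFn_toLp, phaseTensor_ae_conj_quadProjector p]
        with ζ h1 h2
      rw [h1, h2]
    rw [h1, partialFourier_phaseTensor]
    filter_upwards [phaseTensor_ae p
      (fourierTransform_toLp_ae (fockWave_mul_memLp p).1 (fockWave_mul_memLp p).2)] with ζ h2
    rw [h2, one_mul, weylSymbol_single_slicePoint, fourier_fockWave_mul]) w
  simpa only [one_mul] using h

theorem phaseTensor_ae_conj_homodyneKernel (p : ℕ × ℕ) :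
    (phaseTensor p ((Lp.fourierTransformₗᵢ ℝ ℂ).symm (homodyneDensity_memLp p).2.toLp) :
      ℝ × ℝ → ℂ) =ᵐ[quorumMeasure] fun ζ => starRingEnd ℂ (homodyneKernel ζ p) := by
  filter_upwards [phaseTensor_ae p (fourierTransform_symm_toLp_ae (homodyneDensity_memLp p).1
    (homodyneDensity_memLp p).2)] with ζ h
  rw [h, conj_homodyneKernel]

theorem memLp_conj_homodyneKernel (p : ℕ × ℕ) :
    MemLp (fun ζ => starRingEnd ℂ (homodyneKernel ζ p)) 2 quorumMeasure :=
  (memLp_congr_ae (phaseTensor_ae_conj_homodyneKernel p)).1 (Lp.memLp _)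

/-- The factor `|k|` of the homodyne kernel turns into the factor `π|z|` of the Weyl symbol. -/
theorem partialFourier_analysisMap_homodyneKernel (w : ℕ × ℕ →₀ ℂ) :
    (partialFourier (analysisMap homodyneKernel w) : ℝ × ℝ → ℂ) =ᵐ[quorumMeasure]
      fun ζ => ((Real.pi * ‖slicePoint ζ‖ : ℝ) : ℂ) * weylSymbol w (slicePoint ζ) := by
  refine partialFourier_analysisMap_ae (Φ := homodyneKernel)
    (m := fun ζ => ((Real.pi * ‖slicePoint ζ‖ : ℝ) : ℂ)) (fun p => ?_) w
  have h1 : analysisMap homodyneKernel (Finsupp.single p 1) =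
      phaseTensor p ((Lp.fourierTransformₗᵢ ℝ ℂ).symm (homodyneDensity_memLp p).2.toLp) := by
    rw [analysisMap_single (memLp_conj_homodyneKernel p)]
    refine Lp.ext ?_
    filter_upwards [(memLp_conj_homodyneKernel p).coeFn_toLp, phaseTensor_ae_conj_homodyneKernel p]
      with ζ h1 h2
    rw [h1, h2]
  rw [h1, partialFourier_phaseTensor, LinearIsometryEquiv.apply_symm_apply]
  filter_upwards [phaseTensor_ae p (homodyneDensity_memLp p).2.coeFn_toLp] with ζ h2
  rw [h2, weylSymbol_single_slicePoint, homodyneDensity, norm_slicePoint]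
  push_cast
  ring

/-! ### The operators of the frame in the Weyl representation -/

/-- The modulus `|z|` on the slices, as a complex symbol. -/
noncomputable def modSymbol (ζ : ℝ × ℝ) : ℂ := ((‖slicePoint ζ‖ : ℝ) : ℂ)

/-- `√(π|z|)` as a complex symbol. -/
noncomputable def weightSymbol (ζ : ℝ × ℝ) : ℂ := ((weylWeight ζ : ℝ) : ℂ)

/-- `1/√(π|z|)` as a complex symbol. -/
noncomputable def invWeightSymbol (ζ : ℝ × ℝ) : ℂ := (((weylWeight ζ)⁻¹ : ℝ) : ℂ)

theorem measurable_modSymbol : Measurable modSymbol :=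
  Complex.measurable_ofReal.comp continuous_slicePoint.norm.measurable

theorem measurable_weightSymbol : Measurable weightSymbol :=
  Complex.measurable_ofReal.comp continuous_weylWeight.measurable

theorem measurable_invWeightSymbol : Measurable invWeightSymbol :=
  Complex.measurable_ofReal.comp continuous_weylWeight.measurable.inv

theorem norm_weightSymbol (ζ : ℝ × ℝ) : ‖weightSymbol ζ‖ = weylWeight ζ := by
  rw [weightSymbol, Complex.norm_real, Real.norm_of_nonneg (weylWeight_nonneg ζ)]

theorem norm_invWeightSymbol (ζ : ℝ × ℝ) : ‖invWeightSymbol ζ‖ = (weylWeight ζ)⁻¹ := by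
  rw [invWeightSymbol, Complex.norm_real, Real.norm_of_nonneg (inv_nonneg.2 (weylWeight_nonneg ζ))]

theorem weightSymbol_mul_self (ζ : ℝ × ℝ) :
    weightSymbol ζ * weightSymbol ζ = Real.pi * modSymbol ζ := by
  rw [weightSymbol, modSymbol, ← Complex.ofReal_mul, ← Complex.ofReal_mul, weylWeight_mul_self]

theorem conj_invWeightSymbol (ζ : ℝ × ℝ) : starRingEnd ℂ (invWeightSymbol ζ) = invWeightSymbol ζ :=
  Complex.conj_ofReal _

theorem conj_weightSymbol (ζ : ℝ × ℝ) : starRingEnd ℂ (weightSymbol ζ) = weightSymbol ζ :=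
  Complex.conj_ofReal _

theorem ae_invWeightSymbol_mul : ∀ᵐ ζ ∂quorumMeasure, invWeightSymbol ζ * weightSymbol ζ = 1 := by
  filter_upwards [ae_slicePoint_ne_zero] with ζ h
  rw [invWeightSymbol, weightSymbol, ← Complex.ofReal_mul, inv_mul_cancel₀ (weylWeight_pos h).ne',
    Complex.ofReal_one]

theorem ae_invWeightSymbol_ne_zero : ∀ᵐ ζ ∂quorumMeasure, invWeightSymbol ζ ≠ 0 := by
  filter_upwards [ae_invWeightSymbol_mul] with ζ h h0
  rw [h0, zero_mul] at h
  exact zero_ne_one h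

theorem ae_modSymbol_ne_zero : ∀ᵐ ζ ∂quorumMeasure, modSymbol ζ ≠ 0 := by
  filter_upwards [ae_slicePoint_ne_zero] with ζ h
  exact Complex.ofReal_ne_zero.2 (norm_ne_zero_iff.2 h)

/-- The analysis operator of the quadrature projectors is multiplication by `1/√(π|z|)`. -/
theorem analysisOp_quadProjector_eq : (coreOp (analysisMap quadProjector)).IsClosable ∧
    analysisOp quadProjector = mulOp weylUnitary partialFourier invWeightSymbol := by
  refine closure_coreOp_eq_mulOp partialFourier measurable_invWeightSymbol (D := 1) (N := 0)
    zero_le_one (fun ζ => ?_) fun w => ?_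
  · rw [norm_invWeightSymbol, pow_zero, one_mul]
    exact mul_inv_le_one
  · filter_upwards [partialFourier_analysisMap_quadProjector w, ae_invWeightSymbol_mul] with ζ h1 h2
    rw [h1, ← mul_assoc]
    change _ = invWeightSymbol ζ * weightSymbol ζ * _
    rw [h2, one_mul]

/-- The analysis operator of the homodyne kernels is multiplication by `√(π|z|)`. -/
theorem analysisOp_homodyneKernel_eq : (coreOp (analysisMap homodyneKernel)).IsClosable ∧
    analysisOp homodyneKernel = mulOp weylUnitary partialFourier weightSymbol := by
  have hπ := Real.pi_pos
  refine closure_coreOp_eq_mulOp partialFourier measurable_weightSymbol (D := Real.pi) (N := 1)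
    hπ.le (fun ζ => ?_) fun w => ?_
  · rw [norm_weightSymbol, weylWeight_mul_self, pow_one]
    gcongr
    linarith
  · filter_upwards [partialFourier_analysisMap_homodyneKernel w] with ζ h1
    rw [h1, ← mul_assoc]
    change _ = weightSymbol ζ * weightSymbol ζ * _
    rw [weightSymbol_mul_self, modSymbol, Complex.ofReal_mul]

theorem mem_graph_analysisOp_quadProjector {x : Ell2 (ℕ × ℕ)} {y : QuorumL2} :
    (x, y) ∈ (analysisOp quadProjector).graph ↔ (partialFourier y : ℝ × ℝ → ℂ) =ᵐ[quorumMeasure]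
      fun ζ => invWeightSymbol ζ * (weylUnitary x : ℝ × ℝ → ℂ) ζ := by
  rw [analysisOp_quadProjector_eq.2, mem_graph_mulOp]

theorem mem_graph_analysisOp_homodyneKernel {x : Ell2 (ℕ × ℕ)} {y : QuorumL2} :
    (x, y) ∈ (analysisOp homodyneKernel).graph ↔ (partialFourier y : ℝ × ℝ → ℂ) =ᵐ[quorumMeasure]
      fun ζ => weightSymbol ζ * (weylUnitary x : ℝ × ℝ → ℂ) ζ := by
  rw [analysisOp_homodyneKernel_eq.2, mem_graph_mulOp]

/-- `a - b†` is multiplication by `z`. -/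
theorem modeDifference_eq : modeDifferenceCore.IsClosable ∧
    modeDifference = mulOp weylUnitary weylUnitary slicePoint := by
  have hπ := Real.pi_pos
  refine closure_coreOp_eq_mulOp weylUnitary continuous_slicePoint.measurable (D := Real.pi)
    (N := 2) hπ.le (fun ζ => ?_) fun w => ?_
  · have h1 : weylWeight ζ ≤ Real.pi * (1 + ‖slicePoint ζ‖) := sqrt_pi_mul_le (norm_nonneg _)
    calc weylWeight ζ * ‖slicePoint ζ‖ ≤ Real.pi * (1 + ‖slicePoint ζ‖) * (1 + ‖slicePoint ζ‖) :=
          mul_le_mul h1 (by linarith) (norm_nonneg _) (by positivity)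
      _ = _ := by ring
  · change (weylUnitary (toEll2 (modeDiff w)) : ℝ × ℝ → ℂ) =ᵐ[quorumMeasure] _
    rw [weylUnitary_toEll2]
    filter_upwards [weylVector_ae (modeDiff w)] with ζ h1
    rw [h1, weylSymbol_modeDiff, mul_left_comm]

theorem adjoint_analysisOp_quadProjector : (analysisOp quadProjector).adjoint =
    mulOp partialFourier weylUnitary invWeightSymbol := by
  rw [analysisOp_quadProjector_eq.2, mulOp_adjoint _ _ measurable_invWeightSymbol]
  simp only [conj_invWeightSymbol]

/-- The frame operator is multiplication by `1/(π|z|)`. -/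
theorem frameOp_quadProjector_eq : frameOp quadProjector =
    mulOp weylUnitary weylUnitary (fun ζ => invWeightSymbol ζ * invWeightSymbol ζ) := by
  rw [frameOp, adjoint_analysisOp_quadProjector, analysisOp_quadProjector_eq.2]
  refine pcomp_mulOp _ _ _ measurable_invWeightSymbol (Filter.Eventually.of_forall fun ζ => ?_)
  rw [norm_mul]
  nlinarith [sq_nonneg (‖invWeightSymbol ζ‖ - 1), norm_nonneg (invWeightSymbol ζ)]

/-- The inverse frame operator is multiplication by `π|z|`. -/
theorem inverse_frameOp_quadProjector_eq : (frameOp quadProjector).inverse =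
    mulOp weylUnitary weylUnitary (fun ζ => (Real.pi : ℂ) * modSymbol ζ) := by
  rw [frameOp_quadProjector_eq, mulOp_inverse]
  · refine mulOp_congr _ _ ?_
    filter_upwards [ae_invWeightSymbol_mul] with ζ h
    rw [← weightSymbol_mul_self, mul_inv, eq_inv_of_mul_eq_one_right h]
  · filter_upwards [ae_invWeightSymbol_ne_zero] with ζ h
    exact mul_ne_zero h h

theorem isPosSelfAdjoint_frameOp : IsPosSelfAdjoint (frameOp quadProjector) := by
  have h := mulOp_isPosSelfAdjoint weylUnitary
    (m := fun ζ => (weylWeight ζ)⁻¹ * (weylWeight ζ)⁻¹)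
    (continuous_weylWeight.measurable.inv.mul continuous_weylWeight.measurable.inv)
    (fun ζ => mul_self_nonneg _)
  rw [frameOp_quadProjector_eq]
  simp only [Complex.ofReal_mul] at h
  exact h

theorem injective_frameOp : Function.Injective (frameOp quadProjector).toFun := by
  rw [frameOp_quadProjector_eq]
  refine LinearMap.ker_eq_bot.1 (mulOp_ker _ _ ?_)
  filter_upwards [ae_invWeightSymbol_ne_zero] with ζ h
  exact mul_ne_zero h h

theorem dense_domain_inverse_frameOp :
    Dense ((frameOp quadProjector).inverse.domain : Set (Ell2 (ℕ × ℕ))) := by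
  rw [inverse_frameOp_quadProjector_eq]
  exact dense_domain_mulOp _ _ (measurable_modSymbol.const_mul _)

/-- `|a - b†|`, which is multiplication by `|z|` in the Weyl representation. -/
noncomputable def modeModulus : Ell2 (ℕ × ℕ) →ₗ.[ℂ] Ell2 (ℕ × ℕ) :=
  mulOp weylUnitary weylUnitary modSymbol

theorem isModulus_modeModulus : IsModulus modeDifference modeModulus := by
  refine ⟨mulOp_isPosSelfAdjoint weylUnitary continuous_slicePoint.norm.measurable
    fun ζ => norm_nonneg _, ?_⟩
  have h1 : ∀ a : ℂ, ∀ b : ℂ, ‖b‖ = ‖a‖ → ‖a‖ ≤ 1 + ‖b * a‖ := fun a b hab => by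
    rw [norm_mul, hab]
    nlinarith [sq_nonneg (‖a‖ - 1), norm_nonneg a]
  rw [modeModulus, modeDifference_eq.2, mulOp_adjoint _ _ continuous_slicePoint.measurable,
    pcomp_mulOp _ _ _ measurable_modSymbol (Filter.Eventually.of_forall fun ζ => h1 _ _ rfl),
    pcomp_mulOp _ _ _ continuous_slicePoint.measurable
      (Filter.Eventually.of_forall fun ζ => h1 _ _ (RCLike.norm_conj _))]
  congr 1
  funext ζ
  rw [modSymbol, Complex.conj_mul', sq]

theorem injective_modeModulus : Function.Injective modeModulus.toFun :=
  LinearMap.ker_eq_bot.1 (mulOp_ker _ _ ae_modSymbol_ne_zero)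

theorem inverse_frameOp_eq_smul_modeModulus :
    (frameOp quadProjector).inverse = (Real.pi : ℂ) • modeModulus := by
  rw [inverse_frameOp_quadProjector_eq, modeModulus,
    smul_mulOp _ _ (Complex.ofReal_ne_zero.2 Real.pi_ne_zero)]

theorem frameOp_eq_inverse_smul_modeModulus :
    frameOp quadProjector = ((Real.pi : ℂ) • modeModulus).inverse := by
  rw [modeModulus, smul_mulOp _ _ (Complex.ofReal_ne_zero.2 Real.pi_ne_zero), mulOp_inverse,
    frameOp_quadProjector_eq]
  · refine mulOp_congr _ _ ?_
    filter_upwards [ae_invWeightSymbol_mul] with ζ h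
    rw [← weightSymbol_mul_self, mul_inv, eq_inv_of_mul_eq_one_left h]
  · filter_upwards [ae_modSymbol_ne_zero] with ζ h
    exact mul_ne_zero (Complex.ofReal_ne_zero.2 Real.pi_ne_zero) h

/-! ### Quadratic forms in terms of displacement operators -/

theorem memLp_weylSymbol (w : ℕ × ℕ →₀ ℂ) :
    MemLp (fun ζ => weylSymbol w (slicePoint ζ)) 2 quorumMeasure := by
  simpa using memLp_mul_weylSymbol w (g := fun _ => 1) (D := 1) (N := 0) continuous_const
    zero_le_one (by simp)

theorem continuous_conj_weylSymbol_mul (w w' : ℕ × ℕ →₀ ℂ) :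
    Continuous fun z => starRingEnd ℂ (weylSymbol w z) * weylSymbol w' z :=
  (Complex.continuous_conj.comp (continuous_weylSymbol w)).mul (continuous_weylSymbol w')

theorem integrable_frame_form (w w' : ℕ × ℕ →₀ ℂ) :
    Integrable (fun z : ℂ => ((1 / (Real.pi ^ 2 * ‖z‖) : ℝ) : ℂ) *
      (starRingEnd ℂ (weylSymbol w z) * weylSymbol w' z)) :=
  (integrable_comp_slicePoint_iff
    (continuous_conj_weylSymbol_mul w w').aestronglyMeasurable).1
    ((memLp_weylSymbol w).star.integrable_mul (memLp_weylSymbol w'))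

theorem inner_analysisMap_quadProjector (w w' : ℕ × ℕ →₀ ℂ) :
    inner ℂ (analysisMap quadProjector w) (analysisMap quadProjector w') =
      ∫ z : ℂ, ((1 / (Real.pi ^ 2 * ‖z‖) : ℝ) : ℂ) *
        (starRingEnd ℂ (weylSymbol w z) * weylSymbol w' z) := by
  rw [← integral_comp_slicePoint (f := fun z => starRingEnd ℂ (weylSymbol w z) * weylSymbol w' z)
    (continuous_conj_weylSymbol_mul w w').aestronglyMeasurable,
    ← partialFourier.inner_map_map, L2.inner_def]
  refine integral_congr_ae ?_
  filter_upwards [partialFourier_analysisMap_quadProjector w,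
    partialFourier_analysisMap_quadProjector w'] with ζ h1 h2
  rw [h1, h2, RCLike.inner_apply, mul_comm]

theorem integrable_inverse_form (w w' : ℕ × ℕ →₀ ℂ) :
    Integrable (fun z : ℂ => (‖z‖ : ℂ) *
      (starRingEnd ℂ (weylSymbol w z) * weylSymbol w' z)) := by
  obtain ⟨C, hC, h1⟩ := exists_weylSymbol_bound w 1
  obtain ⟨D, hD, h2⟩ := exists_weylSymbol_bound w' 0
  refine integrable_of_gaussian_bound (C := C * D)
    ((by fun_prop : Continuous fun z : ℂ => (‖z‖ : ℂ)).mul (continuous_conj_weylSymbol_mul w w'))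
    fun z => ?_
  have h3 := h1 z
  have h4 := h2 z
  rw [pow_zero, one_mul] at h4
  rw [pow_one] at h3
  have h5 : Real.exp (-‖z‖ ^ 2 / 4) ≤ 1 := Real.exp_le_one_iff.2 (by
    have := sq_nonneg ‖z‖; linarith)
  rw [norm_mul, norm_mul, RCLike.norm_conj, Complex.norm_real, norm_norm]
  calc ‖z‖ * (‖weylSymbol w z‖ * ‖weylSymbol w' z‖)
      ≤ ((1 + ‖z‖) * ‖weylSymbol w z‖) * ‖weylSymbol w' z‖ := by
        rw [← mul_assoc]
        gcongr
        linarith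
    _ ≤ (C * Real.exp (-‖z‖ ^ 2 / 4)) * (D * 1) := by
        refine mul_le_mul h3 (h4.trans ?_) (norm_nonneg _) (by positivity)
        gcongr
    _ = _ := by ring

/-- Finite vectors `w` lie in the domain of `T F⁻¹`, and `T F⁻¹ w` is the analysis of `w` by the
homodyne kernels.  The last clause is the Weyl transform of `F⁻¹ w`. -/
theorem exists_inverse_frameOp_toEll2 (w : ℕ × ℕ →₀ ℂ) : ∃ y : Ell2 (ℕ × ℕ),
    (toEll2 w, y) ∈ (frameOp quadProjector).inverse.graph ∧
    (y, analysisMap homodyneKernel w) ∈ (analysisOp quadProjector).graph ∧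
    (weylUnitary y : ℝ × ℝ → ℂ) =ᵐ[quorumMeasure] fun ζ => (Real.pi * modSymbol ζ) *
      (weightSymbol ζ * weylSymbol w (slicePoint ζ)) := by
  have hmem : MemLp (fun ζ => ((Real.pi : ℂ) * modSymbol ζ) *
      (weylUnitary (toEll2 w) : ℝ × ℝ → ℂ) ζ) 2 quorumMeasure := by
    refine (memLp_congr_ae ?_).1 (memLp_mul_weylSymbol w
      (g := fun z => (Real.pi * ‖z‖ : ℂ) * (Real.sqrt (Real.pi * ‖z‖) : ℂ)) (D := Real.pi ^ 2)
      (N := 2) (by fun_prop) (by positivity) fun z => ?_)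
    · rw [weylUnitary_toEll2]
      filter_upwards [weylVector_ae w] with ζ h
      rw [h, modSymbol, weylWeight, mul_assoc]
    · have h1 := sqrt_pi_mul_le (norm_nonneg z)
      have hπ := Real.pi_pos
      rw [norm_mul, norm_mul, Complex.norm_real, Complex.norm_real, Complex.norm_real, norm_norm,
        Real.norm_of_nonneg hπ.le, Real.norm_of_nonneg (Real.sqrt_nonneg _)]
      calc Real.pi * ‖z‖ * Real.sqrt (Real.pi * ‖z‖)
          ≤ Real.pi * (1 + ‖z‖) * (Real.pi * (1 + ‖z‖)) := by
            gcongr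
            linarith
        _ = _ := by ring
  have hy := mem_domain_mulOp_of_memLp weylUnitary hmem
  have hU := (mem_graph_mulOp _ _ _ _ _).1 hy
  set y := weylUnitary.symm (hmem.toLp _) with hydef
  have hU2 : (weylUnitary y : ℝ × ℝ → ℂ) =ᵐ[quorumMeasure] fun ζ => (Real.pi * modSymbol ζ) *
      (weightSymbol ζ * weylSymbol w (slicePoint ζ)) := by
    rw [weylUnitary_toEll2] at hU
    filter_upwards [hU, weylVector_ae w] with ζ h1 h2
    rw [h1, h2, weightSymbol]
  refine ⟨y, ?_, ?_, hU2⟩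
  · rw [inverse_frameOp_quadProjector_eq]
    exact hy
  · rw [analysisOp_quadProjector_eq.2, mem_graph_mulOp]
    filter_upwards [hU2, partialFourier_analysisMap_homodyneKernel w, ae_invWeightSymbol_mul]
      with ζ h1 h2 h3
    rw [h1, h2, modSymbol, mul_left_comm, ← mul_assoc (invWeightSymbol ζ), h3, one_mul,
      Complex.ofReal_mul]

theorem inner_toEll2_eq_integral {w w' : ℕ × ℕ →₀ ℂ} {y : Ell2 (ℕ × ℕ)}
    (hy : (weylUnitary y : ℝ × ℝ → ℂ) =ᵐ[quorumMeasure] fun ζ => (Real.pi * modSymbol ζ) *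
      (weightSymbol ζ * weylSymbol w' (slicePoint ζ))) :
    inner ℂ (toEll2 w) y = ∫ z : ℂ, (‖z‖ : ℂ) *
      (starRingEnd ℂ (weylSymbol w z) * weylSymbol w' z) := by
  have h1 : inner ℂ (toEll2 w) y = ∫ ζ, (fun z : ℂ => ((Real.pi * ‖z‖ : ℝ) : ℂ) ^ 2 *
      (starRingEnd ℂ (weylSymbol w z) * weylSymbol w' z)) (slicePoint ζ) ∂quorumMeasure := by
    rw [← weylUnitary.inner_map_map, weylUnitary_toEll2, L2.inner_def]
    refine integral_congr_ae ?_
    filter_upwards [weylVector_ae w, hy] with ζ h1 h2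
    rw [h1, h2, RCLike.inner_apply, map_mul]
    change _ * (starRingEnd ℂ (weightSymbol ζ) * _) = _
    rw [conj_weightSymbol]
    have h3 := weightSymbol_mul_self ζ
    rw [Complex.ofReal_mul]
    change _ = ((Real.pi : ℂ) * modSymbol ζ) ^ 2 * _
    rw [← h3]
    ring
  rw [h1, integral_comp_slicePoint (f := fun z : ℂ => ((Real.pi * ‖z‖ : ℝ) : ℂ) ^ 2 *
    (starRingEnd ℂ (weylSymbol w z) * weylSymbol w' z))]
  · refine integral_congr_ae ?_
    have h0 : ∀ᵐ z : ℂ, z ≠ 0 := Measure.ae_ne volume 0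
    filter_upwards [h0] with z hz
    have hz' : (‖z‖ : ℂ) ≠ 0 := Complex.ofReal_ne_zero.2 (norm_ne_zero_iff.2 hz)
    have hπ : (Real.pi : ℂ) ≠ 0 := Complex.ofReal_ne_zero.2 Real.pi_ne_zero
    push_cast
    field_simp
  · exact ((by fun_prop : Continuous fun z : ℂ => ((Real.pi * ‖z‖ : ℝ) : ℂ) ^ 2).mul
      (continuous_conj_weylSymbol_mul w w')).aestronglyMeasurable

/-! ### The canonical dual -/

/-- `T F⁻¹` lies between the analysis of finite vectors by the homodyne kernels and its closure: its
natural domain is smaller than that of multiplication by `√(π|z|)`, and a core for it. -/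
theorem analysisOp_homodyneKernel_eq_closure :
    (pcomp (analysisOp quadProjector) (frameOp quadProjector).inverse).IsClosable ∧
    analysisOp homodyneKernel =
      (pcomp (analysisOp quadProjector) (frameOp quadProjector).inverse).closure := by
  have hle : coreOp (analysisMap homodyneKernel) ≤
      pcomp (analysisOp quadProjector) (frameOp quadProjector).inverse := by
    rw [← LinearPMap.le_graph_iff]
    rintro ⟨x, y⟩ hxy
    obtain ⟨w, rfl, rfl⟩ := (mem_graph_coreOp _ x y).1 hxy
    obtain ⟨u, h1, h2, -⟩ := exists_inverse_frameOp_toEll2 w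
    exact (mem_graph_pcomp _ _ _ _).2 ⟨u, h1, h2⟩
  have hge : pcomp (analysisOp quadProjector) (frameOp quadProjector).inverse ≤
      (coreOp (analysisMap homodyneKernel)).closure := by
    change _ ≤ analysisOp homodyneKernel
    rw [analysisOp_homodyneKernel_eq.2, ← LinearPMap.le_graph_iff]
    rintro ⟨x, z⟩ hxz
    obtain ⟨y, h1, h2⟩ := (mem_graph_pcomp _ _ _ _).1 hxz
    rw [inverse_frameOp_quadProjector_eq, mem_graph_mulOp] at h1
    rw [analysisOp_quadProjector_eq.2, mem_graph_mulOp] at h2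
    rw [mem_graph_mulOp]
    filter_upwards [h1, h2, ae_invWeightSymbol_mul] with ζ a b c
    rw [b, a, ← weightSymbol_mul_self, ← mul_assoc, ← mul_assoc, c, one_mul]
  obtain ⟨h1, h2⟩ := LinearPMap.isClosable_closure_eq_of_le analysisOp_homodyneKernel_eq.1 hle hge
  exact ⟨h1, h2.symm⟩

theorem inner_eq_inner_analysisOp (A : (analysisOp homodyneKernel).domain)
    (B : (analysisOp quadProjector).domain) :
    inner ℂ (A : Ell2 (ℕ × ℕ)) (B : Ell2 (ℕ × ℕ)) =
      inner ℂ (analysisOp homodyneKernel A) (analysisOp quadProjector B) := by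
  have hA := mem_graph_analysisOp_homodyneKernel.1 (LinearPMap.mem_graph _ A)
  have hB := mem_graph_analysisOp_quadProjector.1 (LinearPMap.mem_graph _ B)
  rw [← weylUnitary.inner_map_map, ← partialFourier.inner_map_map (analysisOp homodyneKernel A),
    L2.inner_def, L2.inner_def]
  refine integral_congr_ae ?_
  filter_upwards [hA, hB, ae_invWeightSymbol_mul] with ζ a b c
  rw [a, b, RCLike.inner_apply, RCLike.inner_apply, map_mul, conj_weightSymbol]
  linear_combination (-(weylUnitary (B : Ell2 (ℕ × ℕ)) ζ *
    starRingEnd ℂ (weylUnitary (A : Ell2 (ℕ × ℕ)) ζ))) * c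

/-! ### Biorthogonality -/

/-- A densely defined restriction of the identity is closable, and its closure is the identity. -/
theorem closure_eq_id_of_graph_diagonal {E : Type*} [NormedAddCommGroup E] [NormedSpace ℂ E] {f : E →ₗ.[ℂ] E}
    (hf : ∀ x y, (x, y) ∈ f.graph → y = x) (hd : Dense (f.domain : Set E)) :
    f.IsClosable ∧ f.closure = (LinearMap.id : E →ₗ[ℂ] E).toPMap ⊤ := by
  have hgraph : ∀ x y : E, (x, y) ∈ ((LinearMap.id : E →ₗ[ℂ] E).toPMap ⊤).graph ↔ y = x := by
    intro x y
    rw [LinearPMap.mem_graph_iff]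
    constructor
    · rintro ⟨u, rfl, rfl⟩
      rfl
    · rintro rfl
      exact ⟨⟨y, trivial⟩, rfl, rfl⟩
  have hle : f ≤ (LinearMap.id : E →ₗ[ℂ] E).toPMap ⊤ := by
    rw [← LinearPMap.le_graph_iff]
    rintro ⟨x, y⟩ h
    exact (hgraph x y).2 (hf x y h)
  have hclosed : ((LinearMap.id : E →ₗ[ℂ] E).toPMap ⊤).IsClosed := by
    have : (((LinearMap.id : E →ₗ[ℂ] E).toPMap ⊤).graph : Set (E × E)) = {p | p.2 = p.1} := by
      ext ⟨x, y⟩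
      exact hgraph x y
    rw [LinearPMap.IsClosed, this]
    exact isClosed_eq continuous_snd continuous_fst
  have hcl : f.IsClosable := hclosed.isClosable.leIsClosable hle
  refine ⟨hcl, LinearPMap.eq_of_eq_graph ?_⟩
  rw [← hcl.graph_closure_eq_closure_graph]
  refine le_antisymm (Submodule.topologicalClosure_minimal _
    (LinearPMap.le_graph_of_le hle) hclosed) ?_
  rintro ⟨x, y⟩ h
  obtain rfl := (hgraph x y).1 h
  have hsub : (fun x : E => (x, x)) '' (f.domain : Set E) ⊆ f.graph := by
    rintro _ ⟨x, hx, rfl⟩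
    have h1 := LinearPMap.mem_graph f ⟨x, hx⟩
    rwa [hf _ _ h1] at h1
  have h2 : (y, y) ∈ closure ((fun x : E => (x, x)) '' (f.domain : Set E)) :=
    image_closure_subset_closure_image (continuous_id.prodMk continuous_id) ⟨y, hd y, rfl⟩
  exact closure_mono hsub h2

/-- `T F⁻¹ T†` acts as the identity, because `(π|z|)^(-1/2) · π|z| · (π|z|)^(-1/2) = 1`. -/
theorem mem_graph_kernelOp_imp (x y : QuorumL2) (h : (x, y) ∈ (kernelOp quadProjector).graph) :
    y = x := by
  obtain ⟨u, h1, h2⟩ := (mem_graph_pcomp _ _ _ _).1 h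
  obtain ⟨t, h3, h4⟩ := (mem_graph_pcomp _ _ _ _).1 h1
  rw [analysisOp_quadProjector_eq.2, mem_graph_mulOp] at h2
  rw [adjoint_analysisOp_quadProjector, mem_graph_mulOp] at h3
  rw [inverse_frameOp_quadProjector_eq, mem_graph_mulOp] at h4
  apply partialFourier.injective
  refine Lp.ext ?_
  filter_upwards [h2, h3, h4, ae_invWeightSymbol_mul] with ζ a b c d
  rw [a, c, b, ← weightSymbol_mul_self]
  linear_combination (partialFourier x ζ * (1 + invWeightSymbol ζ * weightSymbol ζ)) * d

/-- The domain of `T F⁻¹ T†` contains the functions whose transform is carried by an annulus. -/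
theorem dense_domain_kernelOp : Dense ((kernelOp quadProjector).domain : Set QuorumL2) := by
  set M : ℝ × ℝ → ℂ := fun ζ => ((weylWeight ζ + (weylWeight ζ)⁻¹ : ℝ) : ℂ) with hM
  have hMm : Measurable M := Complex.measurable_ofReal.comp
    (continuous_weylWeight.measurable.add continuous_weylWeight.measurable.inv)
  have hd := dense_of_truncations (μ := quorumMeasure) hMm ((kernelOp quadProjector).domain.map
    (partialFourier.toLinearEquiv : QuorumL2 →ₗ[ℂ] QuorumL2)) (by
    intro v n hv
    refine ⟨partialFourier.symm v, ?_, by simp⟩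
    have hnorm : ∀ ζ, ‖weightSymbol ζ‖ ≤ ‖M ζ‖ ∧ ‖invWeightSymbol ζ‖ ≤ ‖M ζ‖ := by
      intro ζ
      have h0 := weylWeight_nonneg ζ
      have h1 := inv_nonneg.2 h0
      rw [norm_weightSymbol, norm_invWeightSymbol, hM, Complex.norm_real,
        Real.norm_of_nonneg (add_nonneg h0 h1)]
      constructor <;> linarith
    have hw : MemLp (fun ζ => weightSymbol ζ * v ζ) 2 quorumMeasure := by
      refine memLp_mul_of_truncation measurable_weightSymbol v (C := n) ?_
      filter_upwards [hv] with ζ h h1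
      exact h (h1.trans_le (hnorm ζ).1)
    have hi : MemLp (fun ζ => invWeightSymbol ζ * v ζ) 2 quorumMeasure := by
      refine memLp_mul_of_truncation measurable_invWeightSymbol v (C := n) ?_
      filter_upwards [hv] with ζ h h1
      exact h (h1.trans_le (hnorm ζ).2)
    refine LinearPMap.mem_domain_of_mem_graph (y := partialFourier.symm v) ?_
    refine (mem_graph_pcomp _ _ _ _).2 ⟨weylUnitary.symm (hw.toLp _),
      (mem_graph_pcomp _ _ _ _).2 ⟨weylUnitary.symm (hi.toLp _), ?_, ?_⟩, ?_⟩
    · rw [adjoint_analysisOp_quadProjector, mem_graph_mulOp,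
        LinearIsometryEquiv.apply_symm_apply, LinearIsometryEquiv.apply_symm_apply]
      exact hi.coeFn_toLp
    · rw [inverse_frameOp_quadProjector_eq, mem_graph_mulOp,
        LinearIsometryEquiv.apply_symm_apply, LinearIsometryEquiv.apply_symm_apply]
      filter_upwards [hw.coeFn_toLp, hi.coeFn_toLp, ae_invWeightSymbol_mul] with ζ a b c
      rw [a, b, ← weightSymbol_mul_self]
      linear_combination (-(weightSymbol ζ * v ζ)) * c
    · rw [analysisOp_quadProjector_eq.2, mem_graph_mulOp,
        LinearIsometryEquiv.apply_symm_apply, LinearIsometryEquiv.apply_symm_apply]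
      filter_upwards [hw.coeFn_toLp, ae_invWeightSymbol_mul] with ζ a c
      rw [a, ← mul_assoc, c, one_mul])
  refine dense_preimage_isometryEquiv partialFourier hd ?_
  rintro _ ⟨x, hx, rfl⟩
  change partialFourier.symm (partialFourier x) ∈ _
  rw [LinearIsometryEquiv.symm_apply_apply]
  exact hx

/-! ### Duals of test functions -/

theorem hasDerivAt_fockWave_mul (n m : ℕ) (x : ℝ) :
    HasDerivAt (fun x => fockWave n x * fockWave m x)
      (2 * (Real.sqrt n * (fockWave (n - 1) x * fockWave m x) -
        Real.sqrt (m + 1) * (fockWave n x * fockWave (m + 1) x))) x := by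
  refine ((hasDerivAt_fockWave n x).mul (hasDerivAt_fockWave m x)).congr_deriv ?_
  linear_combination fockWave m x * two_mul_fockWave n x - fockWave n x * two_mul_fockWave m x

theorem exp_mul_conj_fockPhase (φ : ℝ) (n m : ℕ) :
    (Real.sqrt n : ℂ) * starRingEnd ℂ (fockPhase φ (n - 1) m) =
      (Real.sqrt n : ℂ) * (Complex.exp (Complex.I * φ) * starRingEnd ℂ (fockPhase φ n m)) := by
  cases n with
  | zero => simp
  | succ n =>
    simp only [fockPhase_eq, ← Complex.exp_conj, ← Complex.exp_add, map_mul, Complex.conj_I,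
      map_sub, map_natCast, Complex.conj_ofReal, Nat.add_sub_cancel]
    congr 2
    push_cast
    ring

theorem exp_mul_conj_fockPhase_succ (φ : ℝ) (n m : ℕ) :
    starRingEnd ℂ (fockPhase φ n (m + 1)) =
      Complex.exp (Complex.I * φ) * starRingEnd ℂ (fockPhase φ n m) := by
  simp only [fockPhase_eq, ← Complex.exp_conj, ← Complex.exp_add, map_mul, Complex.conj_I,
    map_sub, map_natCast, Complex.conj_ofReal]
  congr 1
  push_cast
  ring

/-- In the quadrature representation `a - b†` is `½ e^{iφ} ∂ₓ`. -/
theorem pairing_quadProjector_modeDiff (ζ : ℝ × ℝ) (n m : ℕ) :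
    pairing (quadProjector ζ) (modeDiff (Finsupp.single (n, m) 1)) =
      Complex.exp (Complex.I * ζ.1) * starRingEnd ℂ (fockPhase ζ.1 n m) *
        ((Real.sqrt n * (fockWave (n - 1) ζ.2 * fockWave m ζ.2) -
          Real.sqrt (m + 1) * (fockWave n ζ.2 * fockWave (m + 1) ζ.2) : ℝ) : ℂ) := by
  obtain ⟨φ, x⟩ := ζ
  rw [modeDiff_single, sub_eq_add_neg, ← neg_one_smul ℂ, pairing_add, pairing_smul, pairing_smul,
    pairing_smul, pairing_single, pairing_single, quadProjector_eq, quadProjector_eq]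
  simp only [map_mul, Complex.conj_ofReal, exp_mul_conj_fockPhase_succ, mul_one]
  have h := exp_mul_conj_fockPhase φ n m
  push_cast at h ⊢
  linear_combination ((fockWave (n - 1) x : ℂ) * fockWave m x) * h

theorem single_eq_smul_single_one (p : ℕ × ℕ) (c : ℂ) :
    Finsupp.single p c = c • (Finsupp.single p 1 : ℕ × ℕ →₀ ℂ) := by
  rw [Finsupp.smul_single, smul_eq_mul, mul_one]

section TestFunction

variable {g : ℝ × ℝ → ℂ}

instance : IsFiniteMeasureOnCompacts quorumMeasure := by
  unfold quorumMeasure; infer_instance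

theorem hasDerivAt_snd (hg : ContDiff ℝ ∞ g) (φ x : ℝ) :
    HasDerivAt (fun x => g (φ, x)) (fderiv ℝ g (φ, x) (0, 1)) x := by
  have h1 : HasFDerivAt g (fderiv ℝ g (φ, x)) (φ, x) :=
    (hg.differentiable (by simp) (φ, x)).hasFDerivAt
  exact h1.comp_hasDerivAt x ((hasDerivAt_const x φ).prodMk (hasDerivAt_id x))

theorem continuous_fderiv_snd (hg : ContDiff ℝ ∞ g) :
    Continuous fun ζ => fderiv ℝ g ζ (0, 1) :=
  (hg.continuous_fderiv (by simp)).clm_apply continuous_const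

/-- The function `-½ e^{-iφ} ∂ₓ g`, that is the formal adjoint of `½ e^{iφ} ∂ₓ` applied to `g`. -/
noncomputable def adjointTest (g : ℝ × ℝ → ℂ) (ζ : ℝ × ℝ) : ℂ :=
  -(1 / 2) * Complex.exp (-(Complex.I * ζ.1)) * fderiv ℝ g ζ (0, 1)

theorem continuous_adjointTest (hg : ContDiff ℝ ∞ g) : Continuous (adjointTest g) :=
  Continuous.mul (by fun_prop) (continuous_fderiv_snd hg)

theorem hasCompactSupport_adjointTest (hgc : HasCompactSupport g) :
    HasCompactSupport (adjointTest g) :=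
  (hgc.fderiv_apply (𝕜 := ℝ) (0, 1)).mul_left

/-- Integration by parts in `x` at fixed angle. -/
theorem integral_deriv_fockWave_mul_test (hg : ContDiff ℝ ∞ g) (hgc : HasCompactSupport g) (n m : ℕ)
    (φ : ℝ) :
    ∫ x, ((Real.sqrt n * (fockWave (n - 1) x * fockWave m x) -
        Real.sqrt (m + 1) * (fockWave n x * fockWave (m + 1) x) : ℝ) : ℂ) * g (φ, x) =
      -(1 / 2) * ∫ x, ((fockWave n x * fockWave m x : ℝ) : ℂ) * fderiv ℝ g (φ, x) (0, 1) := by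
  set u : ℝ → ℂ := fun x => ((fockWave n x * fockWave m x : ℝ) : ℂ) with hu
  set u' : ℝ → ℂ := fun x => 2 * ((Real.sqrt n * (fockWave (n - 1) x * fockWave m x) -
        Real.sqrt (m + 1) * (fockWave n x * fockWave (m + 1) x) : ℝ) : ℂ) with hu'
  have hemb : Topology.IsClosedEmbedding fun x : ℝ => (φ, x) :=
    Topology.IsClosedEmbedding.of_continuous_injective_isClosedMap (by fun_prop)
      (fun a b h => (Prod.ext_iff.1 h).2) (isClosedMap_prodMk_left φ)
  have hfw := continuous_fockWave
  have hgφ : HasCompactSupport fun x => g (φ, x) := hgc.comp_isClosedEmbedding hemb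
  have hgφ' : HasCompactSupport fun x => fderiv ℝ g (φ, x) (0, 1) :=
    (hgc.fderiv_apply (𝕜 := ℝ) (0, 1)).comp_isClosedEmbedding hemb
  have hcu : Continuous u := Complex.continuous_ofReal.comp ((hfw n).mul (hfw m))
  have hcu' : Continuous u' := continuous_const.mul (Complex.continuous_ofReal.comp
    ((continuous_const.mul ((hfw _).mul (hfw _))).sub
      (continuous_const.mul ((hfw _).mul (hfw _)))))
  have hcg : Continuous fun x => g (φ, x) := hg.continuous.comp (by fun_prop)
  have hcg' : Continuous fun x => fderiv ℝ g (φ, x) (0, 1) :=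
    (continuous_fderiv_snd hg).comp (by fun_prop)
  have h := integral_mul_deriv_eq_deriv_mul_of_integrable (u := u) (v := fun x => g (φ, x))
    (u' := u') (v' := fun x => fderiv ℝ g (φ, x) (0, 1))
    (fun x _ => (hasDerivAt_fockWave_mul n m x).ofReal_comp.congr_deriv (by
      rw [hu', Complex.ofReal_mul, Complex.ofReal_ofNat]))
    (fun x _ => hasDerivAt_snd hg φ x)
    ((hcu.mul hcg').integrable_of_hasCompactSupport hgφ'.mul_left)
    ((hcu'.mul hcg).integrable_of_hasCompactSupport hgφ.mul_left)
    ((hcu.mul hcg).integrable_of_hasCompactSupport hgφ.mul_left)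
  rw [h, hu']
  simp only [mul_assoc]
  rw [integral_const_mul]
  ring

theorem integral_conj_modeDiff_mul_test (hg : ContDiff ℝ ∞ g) (hgc : HasCompactSupport g)
    (n m : ℕ) :
    ∫ ζ, starRingEnd ℂ (pairing (quadProjector ζ) (modeDiff (Finsupp.single (n, m) 1))) * g ζ
        ∂quorumMeasure =
      ∫ ζ, starRingEnd ℂ (pairing (quadProjector ζ) (Finsupp.single (n, m) 1)) * adjointTest g ζ
        ∂quorumMeasure := by
  have hfw := continuous_fockWave
  have hph : Continuous fun ζ : ℝ × ℝ => fockPhase ζ.1 n m := by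
    simp only [fockPhase_eq]; fun_prop
  simp only [pairing_quadProjector_modeDiff, pairing_single, mul_one, Complex.conj_conj]
  have hint : ∀ {a b : ℝ × ℝ → ℂ}, Continuous a → Continuous b → HasCompactSupport b →
      Integrable (fun ζ => a ζ * b ζ) quorumMeasure := fun ha hb hbc =>
    (ha.mul hb).integrable_of_hasCompactSupport hbc.mul_left
  have hc1 : Continuous fun ζ : ℝ × ℝ => starRingEnd ℂ (Complex.exp (Complex.I * ζ.1) *
      starRingEnd ℂ (fockPhase ζ.1 n m) *
        ((Real.sqrt n * (fockWave (n - 1) ζ.2 * fockWave m ζ.2) -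
          Real.sqrt (m + 1) * (fockWave n ζ.2 * fockWave (m + 1) ζ.2) : ℝ) : ℂ)) := by
    refine Complex.continuous_conj.comp (Continuous.mul (Continuous.mul (by fun_prop)
      (Complex.continuous_conj.comp hph)) (Complex.continuous_ofReal.comp ?_))
    exact (continuous_const.mul (((hfw _).comp continuous_snd).mul ((hfw _).comp continuous_snd))).sub
      (continuous_const.mul (((hfw _).comp continuous_snd).mul ((hfw _).comp continuous_snd)))
  have hc2 : Continuous fun ζ : ℝ × ℝ => quadProjector ζ (n, m) := by
    have : (fun ζ : ℝ × ℝ => quadProjector ζ (n, m)) =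
        fun ζ => fockPhase ζ.1 n m * ((fockWave n ζ.2 * fockWave m ζ.2 : ℝ) : ℂ) :=
      funext fun ζ => quadProjector_eq ζ.1 ζ.2 (n, m)
    rw [this]
    exact hph.mul (Complex.continuous_ofReal.comp
      (((hfw _).comp continuous_snd).mul ((hfw _).comp continuous_snd)))
  have hi1 := hint hc1 hg.continuous hgc
  have hi2 := hint hc2 (continuous_adjointTest hg) (hasCompactSupport_adjointTest hgc)
  rw [quorumMeasure] at hi1 hi2 ⊢
  rw [integral_prod _ hi1, integral_prod _ hi2]
  congr 1
  funext φ
  simp only [map_mul, Complex.conj_conj, Complex.conj_ofReal, quadProjector_eq, adjointTest,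
    mul_assoc]
  rw [integral_const_mul, integral_const_mul, integral_const_mul]
  have h := integral_deriv_fockWave_mul_test hg hgc n m φ
  rw [h, ← Complex.exp_conj]
  have h3 : ∀ x, ((fockWave n x * fockWave m x : ℝ) : ℂ) * (-(1 / 2) *
      (Complex.exp (-(Complex.I * φ)) * fderiv ℝ g (φ, x) (0, 1))) =
      (-(1 / 2) * Complex.exp (-(Complex.I * φ))) *
        (((fockWave n x * fockWave m x : ℝ) : ℂ) * fderiv ℝ g (φ, x) (0, 1)) := fun x => by ring
  simp only [h3]
  rw [integral_const_mul]
  simp only [map_mul, Complex.conj_I, Complex.conj_ofReal, neg_mul]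
  ring

/-- Weak form of the correspondence between `a - b†` and `½ e^{iφ} ∂ₓ`, tested against `g`. -/
theorem inner_analysisMap_modeDiff (hgm : MemLp g 2 quorumMeasure)
    (hqm : MemLp (adjointTest g) 2 quorumMeasure) (hg : ContDiff ℝ ∞ g) (hgc : HasCompactSupport g)
    (w : ℕ × ℕ →₀ ℂ) :
    inner ℂ (analysisMap quadProjector (modeDiff w)) hgm.toLp =
      inner ℂ (analysisMap quadProjector w) hqm.toLp := by
  have hΞ : ∀ p, MemLp (fun ζ => quadProjector ζ p) 2 quorumMeasure :=
    fun p => memLp_of_conj (memLp_conj_quadProjector p)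
  have hinner : ∀ (w : ℕ × ℕ →₀ ℂ) {f : ℝ × ℝ → ℂ} (hf : MemLp f 2 quorumMeasure),
      inner ℂ (analysisMap quadProjector w) hf.toLp =
        ∫ ζ, starRingEnd ℂ (pairing (quadProjector ζ) w) * f ζ ∂quorumMeasure := by
    intro w f hf
    rw [L2.inner_def]
    refine integral_congr_ae ?_
    filter_upwards [analysisMap_ae hΞ w, hf.coeFn_toLp] with ζ h1 h2
    rw [h1, h2, RCLike.inner_apply, mul_comm]
  induction w using Finsupp.induction_linear with
  | zero => simp
  | add a b ha hb => rw [map_add, map_add, map_add, inner_add_left, inner_add_left, ha, hb]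
  | single p c =>
    rw [single_eq_smul_single_one p c, map_smul, map_smul, map_smul, inner_smul_left,
      inner_smul_left, hinner, hinner, integral_conj_modeDiff_mul_test hg hgc p.1 p.2]

/-- Test functions lie in the range of the analysis operator: since `½ e^{iφ} ∂ₓ` corresponds to
multiplication by `z`, one `x`-derivative gives the decay that makes `√(π|z|)` times the transform
square-integrable. -/
theorem exists_preimage_test (hg : ContDiff ℝ ∞ g) (hgc : HasCompactSupport g) :
    ∃ v y, (v, y) ∈ (analysisOp quadProjector).graph ∧
      (y : ℝ × ℝ → ℂ) =ᵐ[quorumMeasure] g ∧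
      ∀ p : ℕ × ℕ, Integrable (fun ζ => homodyneKernel ζ p * g ζ) quorumMeasure ∧
          (v : Ell2 (ℕ × ℕ)) p = ∫ ζ, homodyneKernel ζ p * g ζ ∂quorumMeasure := by
  have hgm : MemLp g 2 quorumMeasure := hg.continuous.memLp_of_hasCompactSupport hgc
  have hqm : MemLp (adjointTest g) 2 quorumMeasure :=
    (continuous_adjointTest hg).memLp_of_hasCompactSupport (hasCompactSupport_adjointTest hgc)
  set G : QuorumL2 := partialFourier hgm.toLp with hG
  set Q : QuorumL2 := partialFourier hqm.toLp with hQ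
  have hcs := continuous_slicePoint
  have hGm := Lp.aestronglyMeasurable G
  have hQm := Lp.aestronglyMeasurable Q
  have hzG : AEStronglyMeasurable (fun ζ => starRingEnd ℂ (slicePoint ζ) * G ζ) quorumMeasure :=
    (Complex.continuous_conj.comp hcs).aestronglyMeasurable.mul hGm
  have hsymb : ∀ w : ℕ × ℕ →₀ ℂ, ∀ u : QuorumL2,
      inner ℂ (partialFourier (analysisMap quadProjector w)) u =
        ∫ ζ, starRingEnd ℂ (weylSymbol w (slicePoint ζ)) * u ζ ∂quorumMeasure := by
    intro w u
    rw [L2.inner_def]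
    refine integral_congr_ae ?_
    filter_upwards [partialFourier_analysisMap_quadProjector w] with ζ h1
    rw [h1, RCLike.inner_apply, mul_comm]
  -- the transform `Q` of `-½ e^{-iφ} ∂ₓ g` is `z̄` times the transform `G` of `g`
  have hr := ae_eq_zero_of_integral_weylSymbol (N := 1)
    (r := fun ζ => starRingEnd ℂ (slicePoint ζ) * G ζ - Q ζ) (hzG.sub hQm) (by
      refine MemLp.mono (g := fun ζ => ‖G ζ‖ + ‖Q ζ‖) ((Lp.memLp G).norm.add (Lp.memLp Q).norm)
        ?_ (Filter.Eventually.of_forall fun ζ => ?_)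
      · refine AEStronglyMeasurable.mul ?_ (hzG.sub hQm).norm
        exact (by
          refine Continuous.inv₀ (by fun_prop) fun ζ => ?_
          positivity : Continuous fun ζ : ℝ × ℝ =>
            ((1 + ‖slicePoint ζ‖) ^ 1)⁻¹).aestronglyMeasurable
      · rw [Real.norm_of_nonneg (by positivity), Real.norm_of_nonneg (by positivity), pow_one,
          inv_mul_le_iff₀ (by positivity)]
        refine (norm_sub_le _ _).trans ?_
        rw [norm_mul, RCLike.norm_conj]
        nlinarith [norm_nonneg (slicePoint ζ), norm_nonneg (G ζ), norm_nonneg (Q ζ),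
          mul_nonneg (norm_nonneg (slicePoint ζ)) (norm_nonneg (Q ζ))])
    (by
      intro w
      have h1 := inner_analysisMap_modeDiff hgm hqm hg hgc w
      rw [← partialFourier.inner_map_map, ← partialFourier.inner_map_map (analysisMap _ w),
        hsymb, hsymb] at h1
      have hL : ∀ (w : ℕ × ℕ →₀ ℂ) (u : QuorumL2), Integrable
          (fun ζ => starRingEnd ℂ (weylSymbol w (slicePoint ζ)) * u ζ) quorumMeasure := fun w u =>
        (memLp_weylSymbol w).star.integrable_mul (Lp.memLp u)
      have h2 : ∀ ζ, starRingEnd ℂ (weylSymbol w (slicePoint ζ)) *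
          (starRingEnd ℂ (slicePoint ζ) * G ζ - Q ζ) =
          starRingEnd ℂ (weylSymbol (modeDiff w) (slicePoint ζ)) * G ζ -
            starRingEnd ℂ (weylSymbol w (slicePoint ζ)) * Q ζ := by
        intro ζ
        rw [weylSymbol_modeDiff, map_mul]
        ring
      simp only [h2]
      rw [integral_sub (hL _ _) (hL _ _), h1, sub_self])
  have hmem : MemLp (fun ζ => weightSymbol ζ * G ζ) 2 quorumMeasure := by
    refine MemLp.mono (g := fun ζ => Real.pi * (‖G ζ‖ + ‖Q ζ‖))
      (((Lp.memLp G).norm.add (Lp.memLp Q).norm).const_mul _)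
      (measurable_weightSymbol.aestronglyMeasurable.mul hGm) ?_
    filter_upwards [hr] with ζ h
    have h1 : ‖slicePoint ζ‖ * ‖G ζ‖ = ‖Q ζ‖ := by
      rw [← RCLike.norm_conj (slicePoint ζ), ← norm_mul, sub_eq_zero.1 h]
    have hπ := Real.pi_pos
    rw [Real.norm_of_nonneg (by positivity), norm_mul, norm_weightSymbol, ← h1]
    calc weylWeight ζ * ‖G ζ‖ ≤ Real.pi * (1 + ‖slicePoint ζ‖) * ‖G ζ‖ :=
          mul_le_mul_of_nonneg_right (sqrt_pi_mul_le (norm_nonneg _)) (norm_nonneg _)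
      _ = _ := by ring
  refine ⟨weylUnitary.symm (hmem.toLp _), hgm.toLp, ?_, hgm.coeFn_toLp, fun p => ?_⟩
  · rw [mem_graph_analysisOp_quadProjector, LinearIsometryEquiv.apply_symm_apply]
    filter_upwards [hmem.coeFn_toLp, ae_invWeightSymbol_mul] with ζ h1 h2
    rw [h1, ← mul_assoc, h2, one_mul]
  · have hp := memLp_conj_homodyneKernel p
    have hint : ∀ᵐ ζ ∂quorumMeasure,
        starRingEnd ℂ ((analysisMap homodyneKernel (Finsupp.single p 1) : ℝ × ℝ → ℂ) ζ) *
          (hgm.toLp g : ℝ × ℝ → ℂ) ζ =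
          homodyneKernel ζ p * g ζ := by
      rw [analysisMap_single hp]
      filter_upwards [hp.coeFn_toLp, hgm.coeFn_toLp] with ζ h1 h2
      rw [h1, h2, Complex.conj_conj]
    refine ⟨(memLp_of_conj hp).integrable_mul hgm, ?_⟩
    have h1 : (weylUnitary.symm (hmem.toLp _) : Ell2 (ℕ × ℕ)) p =
        inner ℂ (toEll2 (Finsupp.single p 1)) (weylUnitary.symm (hmem.toLp _)) := by
      rw [toEll2, Finsupp.linearCombination_single, one_smul, ket, lp.inner_single_left]
      simp
    rw [h1, ← weylUnitary.inner_map_map, LinearIsometryEquiv.apply_symm_apply, weylUnitary_toEll2]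
    have h2 : inner ℂ (weylVector (Finsupp.single p 1)) (hmem.toLp _) =
        inner ℂ (partialFourier (analysisMap homodyneKernel (Finsupp.single p 1))) G := by
      rw [L2.inner_def, L2.inner_def]
      refine integral_congr_ae ?_
      filter_upwards [weylVector_ae (Finsupp.single p 1), hmem.coeFn_toLp,
        partialFourier_analysisMap_homodyneKernel (Finsupp.single p 1)] with ζ a b c
      rw [a, b, c, RCLike.inner_apply, RCLike.inner_apply, map_mul, map_mul, Complex.conj_ofReal,
        Complex.conj_ofReal]
      have h3 := weightSymbol_mul_self ζ
      rw [Complex.ofReal_mul]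
      change weightSymbol ζ * _ * (weightSymbol ζ * _) = _ * (Real.pi * modSymbol ζ * _)
      rw [← h3]
      ring
    rw [h2, hG, partialFourier.inner_map_map, L2.inner_def]
    refine integral_congr_ae ?_
    filter_upwards [hint] with ζ h
    rw [← h, RCLike.inner_apply, mul_comm]

end TestFunction

/-! ### Hilbert–Schmidt operators and the doubled space -/

theorem memℓp_two_iff {ι : Type} {f : ι → ℂ} : Memℓp f 2 ↔ Summable fun i => ‖f i‖ ^ 2 := by
  rw [memℓp_gen_iff (by norm_num)]
  simp

theorem norm_sq_ell2 {ι : Type} (f : Ell2 ι) : HasSum (fun i => ‖f i‖ ^ 2) (‖f‖ ^ 2) := by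
  simpa using lp.hasSum_norm (p := 2) (by norm_num) f

theorem inner_ket_left {ι : Type} [DecidableEq ι] (i : ι) (f : Ell2 ι) :
    inner ℂ (ket i) f = f i := by
  rw [ket, lp.inner_single_left]
  simp

theorem clm_ext_ket {ι : Type} [DecidableEq ι] {F : Type*} [NormedAddCommGroup F]
    [InnerProductSpace ℂ F] {A B : Ell2 ι →L[ℂ] F} (h : ∀ i, A (ket i) = B (ket i)) : A = B := by
  refine lp.ext_continuousLinearMap (p := 2) (by norm_num) fun i => ?_
  ext
  exact h i

theorem injective_dket : Function.Injective dket := by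
  rintro ⟨A, hA⟩ ⟨B, hB⟩ h
  refine Subtype.ext (clm_ext_ket fun m => lp.ext (funext fun n => ?_))
  exact congrFun (congrArg (fun f : Ell2 (ℕ × ℕ) => (f : ℕ × ℕ → ℂ)) h) (n, m)

/-- A square-summable matrix is the matrix of a bounded operator: `A x` has the components
`⟨r_n, x⟩`, where `r_n` is the conjugate of the `n`-th row. -/
theorem surjective_dket : Function.Surjective dket := by
  intro c
  have hc : Summable fun p : ℕ × ℕ => ‖c p‖ ^ 2 := memℓp_two_iff.1 (lp.memℓp c)
  have hrow : ∀ n, Memℓp (fun m => starRingEnd ℂ (c (n, m))) 2 := fun n =>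
    memℓp_two_iff.2 (by simpa only [RCLike.norm_conj] using hc.prod_factor n)
  set r : ℕ → Ell2 ℕ := fun n => ⟨fun m => starRingEnd ℂ (c (n, m)), hrow n⟩ with hr
  have hrn : ∀ n, ∑' m, ‖c (n, m)‖ ^ 2 = ‖r n‖ ^ 2 := fun n => by
    rw [← (norm_sq_ell2 (r n)).tsum_eq]
    simp only [hr, RCLike.norm_conj]
  have hrs : Summable fun n => ‖r n‖ ^ 2 := by
    simpa only [hrn] using hc.prod
  have hle : ∀ (x : Ell2 ℕ) n, ‖inner ℂ (r n) x‖ ^ 2 ≤ ‖r n‖ ^ 2 * ‖x‖ ^ 2 := fun x n => by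
    rw [← mul_pow]
    gcongr
    exact norm_inner_le_norm _ _
  have hsum : ∀ x : Ell2 ℕ, Summable fun n => ‖inner ℂ (r n) x‖ ^ 2 := fun x =>
    Summable.of_nonneg_of_le (fun n => by positivity) (hle x) (hrs.mul_right _)
  let A : Ell2 ℕ →L[ℂ] Ell2 ℕ := LinearMap.mkContinuous
    { toFun := fun x => ⟨fun n => inner ℂ (r n) x, memℓp_two_iff.2 (hsum x)⟩
      map_add' := fun x y => lp.ext (funext fun n => inner_add_right _ _ _)
      map_smul' := fun a x => lp.ext (funext fun n => inner_smul_right _ _ _) }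
    (Real.sqrt (∑' n, ‖r n‖ ^ 2)) (fun x => by
      refine le_of_sq_le_sq ?_ (by positivity)
      rw [mul_pow, Real.sq_sqrt (tsum_nonneg fun n => by positivity), ← tsum_mul_right,
        ← (norm_sq_ell2 _).tsum_eq]
      exact (hsum x).tsum_le_tsum (hle x) (hrs.mul_right _))
  have hA : matrixOf A = c := by
    funext p
    change inner ℂ (r p.1) (ket p.2) = c p
    rw [← inner_conj_symm, inner_ket_left]
    exact Complex.conj_conj _
  exact ⟨⟨A, by rw [hA]; exact lp.memℓp c⟩, Subtype.ext hA⟩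

theorem hasSum_inner_dket (A B : HSOperator) :
    HasSum (fun m : ℕ => inner ℂ (ket m : Ell2 ℕ)
      ((ContinuousLinearMap.adjoint A.1) (B.1 (ket m)))) (inner ℂ (dket A) (dket B)) := by
  have h := (Equiv.prodComm ℕ ℕ).hasSum_iff.2 (lp.hasSum_inner (𝕜 := ℂ) (dket A) (dket B))
  refine h.prod_fiberwise fun m => ?_
  rw [ContinuousLinearMap.adjoint_inner_right]
  exact lp.hasSum_inner (𝕜 := ℂ) (A.1 (ket m)) (B.1 (ket m))

/-! ### Li's formula -/

theorem ae_eq_iff_pairing {Θ Ψ : ℝ × ℝ → ℕ × ℕ → ℂ} :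
    (∀ w : ℕ × ℕ →₀ ℂ, ∀ᵐ ζ ∂quorumMeasure, pairing (Θ ζ) w = pairing (Ψ ζ) w) ↔
      Θ =ᵐ[quorumMeasure] Ψ := by
  constructor
  · intro h
    have h1 : ∀ᵐ ζ ∂quorumMeasure, ∀ p : ℕ × ℕ, Θ ζ p = Ψ ζ p := by
      rw [ae_all_iff]
      intro p
      filter_upwards [h (Finsupp.single p 1)] with ζ h2
      rw [pairing_single, pairing_single, mul_one, mul_one] at h2
      exact (starRingEnd ℂ).injective h2
    filter_upwards [h1] with ζ h2
    exact funext h2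
  · intro h w
    filter_upwards [h] with ζ h1
    rw [h1]

theorem memLp_pairing_of_isBesselFamily {f : ℝ × ℝ → ℕ × ℕ → ℂ} (hf : IsBesselFamily f)
    (w : ℕ × ℕ →₀ ℂ) : MemLp (fun ζ => pairing (f ζ) w) 2 quorumMeasure := by
  obtain ⟨hm, B, hB⟩ := hf
  have hmw : AEStronglyMeasurable (fun ζ => pairing (f ζ) w) quorumMeasure := by
    unfold pairing Finsupp.sum
    refine Finset.aestronglyMeasurable_fun_sum _ fun p _ => ?_
    exact ((Complex.continuous_conj.comp_aestronglyMeasurable (hm p)).mul_const _)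
  refine ⟨hmw, ?_⟩
  rw [eLpNorm_lt_top_iff_lintegral_rpow_enorm_lt_top (by norm_num) (by norm_num)]
  have h1 : ∀ ζ, ‖pairing (f ζ) w‖ₑ ^ ((2 : ENNReal).toReal) = ‖pairing (f ζ) w‖ₑ ^ 2 := by
    intro ζ
    rw [ENNReal.toReal_ofNat, ENNReal.rpow_ofNat]
  simp only [h1]
  exact (hB w).trans_lt (ENNReal.mul_lt_top ENNReal.coe_lt_top
    (ENNReal.pow_lt_top enorm_lt_top))

/-- If the closed kernel operator is the identity, the last two terms of Li's formula cancel. -/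
theorem isLiDual_iff {Φ Ψ f Θ : ℝ × ℝ → ℕ × ℕ → ℂ}
    (hK : (kernelOp Φ).closure = (LinearMap.id : QuorumL2 →ₗ[ℂ] QuorumL2).toPMap ⊤)
    (hf : IsBesselFamily f) : IsLiDual Φ Ψ f Θ ↔ Θ =ᵐ[quorumMeasure] Ψ := by
  rw [← ae_eq_iff_pairing, IsLiDual, hK]
  refine forall_congr' fun w => ?_
  constructor
  · rintro ⟨g, hg, h⟩
    filter_upwards [hg, h] with ζ h1 h2
    have h3 : (((LinearMap.id : QuorumL2 →ₗ[ℂ] QuorumL2).toPMap ⊤) g : ℝ × ℝ → ℂ) ζ =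
        pairing (f ζ) w := h1
    rw [h2, h3, add_sub_cancel_right]
  · intro h
    have hw := memLp_pairing_of_isBesselFamily hf w
    refine ⟨⟨hw.toLp, trivial⟩, hw.coeFn_toLp, ?_⟩
    filter_upwards [hw.coeFn_toLp, h] with ζ h1 h2
    have h3 : (((LinearMap.id : QuorumL2 →ₗ[ℂ] QuorumL2).toPMap ⊤) ⟨hw.toLp, trivial⟩ :
        ℝ × ℝ → ℂ) ζ = pairing (f ζ) w := h1
    rw [h2, h3, add_sub_cancel_right]

theorem mainTheorem4 :
    -- the doubled-space picture: `A ↦ |A⟩⟩` is onto, and `⟨⟨A|B⟩⟩ = Tr[A† B]`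
    (Function.Bijective dket ∧
      ∀ A B : HSOperator,
        HasSum (fun m : ℕ => inner ℂ (ket m : Ell2 ℕ) ((ContinuousLinearMap.adjoint A.1) (B.1 (ket m))))
          (inner ℂ (dket A) (dket B))) ∧
    -- the exponential series converge on the Fock states
    (∀ (α β γ : ℂ) (m : ℕ), Summable (expTerm (α • raising + β • lowering + γ • 1) m)) ∧
    -- `|x⟩_φ` are the generalized eigenvectors of `X_φ`, and `|x⟩_φ⟨x| dx` is its spectral measure
    (∀ (φ x : ℝ) (w : ℕ →₀ ℂ),
      pairing (quadKet φ x) (quadrature φ w) = x * pairing (quadKet φ x) w) ∧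
    (∀ (φ k : ℝ) (p : ℕ × ℕ),
      Integrable (fun x : ℝ => Complex.exp (Complex.I * (k * x)) * quadProjector (φ, x) p) ∧
      ∫ x : ℝ, Complex.exp (Complex.I * (k * x)) * quadProjector (φ, x) p =
        expEntry ((Complex.I * k) • quadrature φ) p.1 p.2) ∧
    -- the quadrature projectors form a frame: the frame operator is positive and invertible
    (∀ p, MemLp (fun ζ => quadProjector ζ p) 2 quorumMeasure) ∧
    (coreOp (analysisMap quadProjector)).IsClosable ∧
    IsPosSelfAdjoint (frameOp quadProjector) ∧
    Function.Injective (frameOp quadProjector).toFun ∧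
    Dense ((frameOp quadProjector).inverse.domain : Set (Ell2 (ℕ × ℕ))) ∧
    -- `F = 1 / (π |a - b†|)` and `F⁻¹ = π |a - b†|`
    modeDifferenceCore.IsClosable ∧
    (∃ P : Ell2 (ℕ × ℕ) →ₗ.[ℂ] Ell2 (ℕ × ℕ), IsModulus modeDifference P ∧
      Function.Injective P.toFun ∧
      frameOp quadProjector = ((Real.pi : ℂ) • P).inverse ∧
      (frameOp quadProjector).inverse = (Real.pi : ℂ) • P) ∧
    -- `F = (1/π) ∫ d²z/π |z|⁻¹ |D(z)⟩⟩⟨⟨D(z)|`, as a quadratic form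
    (∀ w w' : ℕ × ℕ →₀ ℂ,
      Integrable (fun z : ℂ => ((1 / (Real.pi ^ 2 * ‖z‖) : ℝ) : ℂ) *
        (starRingEnd ℂ (pairing (displacementKet z) w) * pairing (displacementKet z) w')) ∧
      inner ℂ (analysisMap quadProjector w) (analysisMap quadProjector w') =
        ∫ z : ℂ, ((1 / (Real.pi ^ 2 * ‖z‖) : ℝ) : ℂ) *
          (starRingEnd ℂ (pairing (displacementKet z) w) * pairing (displacementKet z) w')) ∧
    -- `F⁻¹ = ∫ d²z |z| |D(z)⟩⟩⟨⟨D(z)|`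
    (∀ w w' : ℕ × ℕ →₀ ℂ,
      Integrable (fun z : ℂ => (‖z‖ : ℂ) *
        (starRingEnd ℂ (pairing (displacementKet z) w) * pairing (displacementKet z) w')) ∧
      ∃ u : (frameOp quadProjector).inverse.domain, (u : Ell2 (ℕ × ℕ)) = toEll2 w' ∧
        inner ℂ (toEll2 w) ((frameOp quadProjector).inverse u) =
          ∫ z : ℂ, (‖z‖ : ℂ) *
            (starRingEnd ℂ (pairing (displacementKet z) w) * pairing (displacementKet z) w')) ∧
    -- the integral defining the homodyne kernel converges, with square-integrable components
    (∀ (φ x : ℝ) (p : ℕ × ℕ), Integrable fun k : ℝ =>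
      ((|k| : ℝ) : ℂ) * expEntry ((Complex.I * k) • (quadrature φ - (x : ℂ) • 1)) p.1 p.2) ∧
    (∀ p, MemLp (fun ζ => homodyneKernel ζ p) 2 quorumMeasure) ∧
    (coreOp (analysisMap homodyneKernel)).IsClosable ∧
    -- the canonical dual `F⁻¹ |x⟩_φ⟨x|` is the homodyne kernel
    (∀ w : ℕ × ℕ →₀ ℂ,
      ∃ u : (frameOp quadProjector).inverse.domain, (u : Ell2 (ℕ × ℕ)) = toEll2 w ∧
      ∃ v : (analysisOp quadProjector).domain,
        (v : Ell2 (ℕ × ℕ)) = (frameOp quadProjector).inverse u ∧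
        ((analysisOp quadProjector v : QuorumL2) : ℝ × ℝ → ℂ)
          =ᵐ[quorumMeasure] fun ζ => pairing (homodyneKernel ζ) w) ∧
    (pcomp (analysisOp quadProjector) (frameOp quadProjector).inverse).IsClosable ∧
    analysisOp homodyneKernel =
      (pcomp (analysisOp quadProjector) (frameOp quadProjector).inverse).closure ∧
    -- frame and canonical dual resolve the identity
    (∀ (A : (analysisOp homodyneKernel).domain) (B : (analysisOp quadProjector).domain),
      inner ℂ (A : Ell2 (ℕ × ℕ)) (B : Ell2 (ℕ × ℕ)) =
        inner ℂ (analysisOp homodyneKernel A) (analysisOp quadProjector B)) ∧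
    -- biorthogonality: `⟨⟨Ξ(ζ)|F⁻¹|Ξ(ζ')⟩⟩` is the kernel `π δ(x - x') δ_π(φ - φ')` of the identity
    (∀ g : ℝ × ℝ → ℂ, ContDiff ℝ ∞ g → HasCompactSupport g →
      ∃ v : (analysisOp quadProjector).domain,
        (∀ p : ℕ × ℕ, Integrable (fun ζ => homodyneKernel ζ p * g ζ) quorumMeasure ∧
          (v : Ell2 (ℕ × ℕ)) p = ∫ ζ, homodyneKernel ζ p * g ζ ∂quorumMeasure) ∧
        ((analysisOp quadProjector v : QuorumL2) : ℝ × ℝ → ℂ) =ᵐ[quorumMeasure] g) ∧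
    Dense ((kernelOp quadProjector).domain : Set QuorumL2) ∧
    (kernelOp quadProjector).IsClosable ∧
    (kernelOp quadProjector).closure = (LinearMap.id : QuorumL2 →ₗ[ℂ] QuorumL2).toPMap ⊤ ∧
    -- Li's formula yields the canonical dual only, for every Bessel family
    (∀ f : ℝ × ℝ → ℕ × ℕ → ℂ, IsBesselFamily f → ∀ Θ : ℝ × ℝ → ℕ × ℕ → ℂ,
      IsLiDual quadProjector homodyneKernel f Θ ↔ Θ =ᵐ[quorumMeasure] homodyneKernel) := by
  have hΞ : ∀ p, MemLp (fun ζ => quadProjector ζ p) 2 quorumMeasure :=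
    fun p => memLp_of_conj (memLp_conj_quadProjector p)
  have hΨ : ∀ p, MemLp (fun ζ => homodyneKernel ζ p) 2 quorumMeasure :=
    fun p => memLp_of_conj (memLp_conj_homodyneKernel p)
  have hK := closure_eq_id_of_graph_diagonal mem_graph_kernelOp_imp dense_domain_kernelOp
  refine ⟨⟨⟨injective_dket, surjective_dket⟩, hasSum_inner_dket⟩, summable_expTerm,
    pairing_quadKet_quadrature,
    fun φ k p => ⟨integrable_exp_mul_quadProjector φ k p, integral_exp_mul_quadProjector φ k p⟩,
    hΞ, analysisOp_quadProjector_eq.1, isPosSelfAdjoint_frameOp, injective_frameOp,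
    dense_domain_inverse_frameOp, modeDifference_eq.1,
    ⟨modeModulus, isModulus_modeModulus, injective_modeModulus,
      frameOp_eq_inverse_smul_modeModulus, inverse_frameOp_eq_smul_modeModulus⟩,
    fun w w' => ⟨integrable_frame_form w w', inner_analysisMap_quadProjector w w'⟩,
    fun w w' => ⟨integrable_inverse_form w w', ?_⟩, integrable_abs_mul_expEntry, hΨ,
    analysisOp_homodyneKernel_eq.1, fun w => ?_, analysisOp_homodyneKernel_eq_closure.1,
    analysisOp_homodyneKernel_eq_closure.2, inner_eq_inner_analysisOp, fun g hg hgc => ?_,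
    dense_domain_kernelOp, hK.1, hK.2, fun f hf Θ => isLiDual_iff hK.2 hf⟩
  · obtain ⟨y, h1, -, h2⟩ := exists_inverse_frameOp_toEll2 w'
    obtain ⟨u, hu, hy⟩ := (LinearPMap.mem_graph_iff _).1 h1
    refine ⟨u, hu, ?_⟩
    rw [hy]
    exact inner_toEll2_eq_integral h2
  · obtain ⟨y, h1, h2, -⟩ := exists_inverse_frameOp_toEll2 w
    obtain ⟨u, hu, hy⟩ := (LinearPMap.mem_graph_iff _).1 h1
    obtain ⟨v, hv, hvy⟩ := (LinearPMap.mem_graph_iff _).1 h2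
    refine ⟨u, hu, v, hv.trans hy.symm, ?_⟩
    rw [hvy]
    exact analysisMap_ae hΨ w
  · obtain ⟨v, y, h1, h2, h3⟩ := exists_preimage_test hg hgc
    obtain ⟨u, hu, hy⟩ := (LinearPMap.mem_graph_iff _).1 h1
    refine ⟨u, fun p => ?_, ?_⟩
    · rw [hu]
      exact h3 p
    · rw [hy]
      exact h2
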